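/- **Privacy calculation of ModelMix via Rényi divergence.** *Setting.* A dataset $D$ is a finite multiset of data points; two datasets are neighbours, $D\sim D'$, if one is the other together with one additional data point. A randomized algorithm $\mathcal A$ is $(\epsilon,\delta)$-DP if $\mathbb P(\mathcal A(D)\in S)\le e^{\epsilon}\,\mathbb P(\mathcal A(D')\in S)+\delta$ for all $D\sim D'$ and all events $S$. For $\alpha>1$ let $\mathsf D_\alpha(P\|Q)=\frac1{\alpha-1}\log\int (dP/dQ)^\alpha\,dQ$ (and $+\infty$ if $P\not\ll Q$). Let $f(w,z)$ be a real-valued loss, $w\in\mathbb R^d$, with gradient $\nabla f(w,z)$ in $w$ (read as $0$ at points where it does not exist), and $\mathsf{CP}(g,c)=g\cdot\min\{1,c/\|g\|_2\}$. Fix a clipping threshold $c>0$, a sampling rate $q\in[0,1]$, a step size $\eta>0$, a mixing threshold $\tau>0$, a noise level $\sigma>0$, initial states $w_{-1},w_0\in\mathbb R^d$ and a number of iterations $T\ge 0$. *DP-SGD with ModelMix* does the following for $k=1,\dots,T$, with fresh independent randomness: 1. draw a minibatch $S_k$ containing each data point of $D$ independently with probability $q$, and put $G_{k-1}=\sum_{z\in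 S_k}\mathsf{CP}(\nabla f(w_{k-1},z),c)$; 2. for each coordinate $j$ with $|w_{k-1}(j)-w_{k-2}(j)|<\tau$, replace first $w_{k-1}(j)$ by $w_{k-1}(j)+\mathrm{sign}(w_{k-1}(j)-w_{k-2}(j))\,\tau/2$ and then $w_{k-2}(j)$ by $w_{k-2}(j)-\mathrm{sign}(w_{k-1}(j)-w_{k-2}(j))\,\tau/2$, where $\mathrm{sign}(0)=1$ (the replaced values are kept in what follows); 3. with $\boldsymbol\alpha_k(j)$ i.i.d. uniform on $[0,1]$ and $\Delta_k\sim\mathcal N(0,\sigma^2 I_d)$, put $w_k(j)=\boldsymbol\alpha_k(j)w_{k-1}(j)+(1-\boldsymbol\alpha_k(j))w_{k-2}(j)-\eta\,(G_{k-1}(j)+\Delta_k(j))$. The output is $w_T$. Let $\mathcal U=\mathcal U[-\tau/(2\eta),\tau/(2\eta)]$ be the uniform distribution, and let $$\mathsf P_0=\mathcal N(0,\sigma)*\mathcal U,\qquad \mathsf P_1=\mathcal N(c,\sigma)*\mathcal U ,$$ where $\sigma$ is the standard deviation and $*$ is convolution. *Theorem.* (i) For every real $\epsilon$ and every $\delta>0$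 with $$\epsilon\ \ge\ \inf_{\alpha\in\mathbb Z,\ \alpha>1}\Big(T\,\mathsf D_\alpha\big((1-q)\mathsf P_0+q\mathsf P_1\,\big\|\,\mathsf P_0\big)+\frac{\log(1/\delta)}{\alpha-1}\Big),$$ $T$ iterations of DP-SGD with ModelMix are $(\epsilon,\delta)$-DP. (ii) (The worst case is a one-hot gradient.) For $v\in\mathbb R^d$ let $\mathsf M_v=\mathcal N(v,\sigma^2I_d)*\mathcal U^{d}$. For every integer $\alpha>1$ and every $v\in\mathbb R^d$ with $\|v\|_2\le c$, $$\mathsf D_\alpha\big((1-q)\mathsf M_0+q\mathsf M_v\,\big\|\,\mathsf M_0\big)\ \le\ \mathsf D_\alpha\big((1-q)\mathsf P_0+q\mathsf P_1\,\big\|\,\mathsf P_0\big),$$ with equality if $v=c\,e_j$ for a standard basis vector $e_j$. -/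

import Mathlib

open MeasureTheory ProbabilityTheory Set
open scoped ENNReal

noncomputable section

/-! ### Rényi divergence and differential privacy -/

/-- The Rényi divergence `D_α(P ‖ Q) = (α - 1)⁻¹ log ∫ (dP/dQ)^α dQ` of order `α > 1`, with the
value `+∞` when `P` is not absolutely continuous with respect to `Q`. -/
def renyiDiv {Ω : Type*} [MeasurableSpace Ω] (α : ℝ) (P Q : Measure Ω) : EReal :=
  open Classical in
  if P ≪ Q then (((α - 1)⁻¹ : ℝ) : EReal) * ENNReal.log (∫⁻ x, (P.rnDeriv Q x) ^ α ∂Q) else ⊤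

/-- Datasets are finite families of data points (repetitions allowed). Two of them are neighbours
if one is the other together with one additional data point. -/
def Neighbors {Z : Type*} (D D' : Multiset Z) : Prop :=
  ∃ s : Z, D = s ::ₘ D' ∨ D' = s ::ₘ D

/-- `(ε, δ)`-differential privacy of a randomized algorithm, given by its output laws. -/
def IsDP {Z Ω : Type*} [MeasurableSpace Ω] (A : Multiset Z → Measure Ω) (ε δ : ℝ) : Prop :=
  ∀ D D' : Multiset Z, Neighbors D D' → ∀ S : Set Ω, MeasurableSet S →
    A D S ≤ ENNReal.ofReal (Real.exp ε) * A D' S + ENNReal.ofReal δ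

/-! ### The distributions -/

/-- The uniform distribution on `[a, b]`, for `a < b`. -/
def uniformLaw (a b : ℝ) : Measure ℝ := ProbabilityTheory.cond volume (Icc a b)

/-- The Gaussian distribution on the line with mean `m` and standard deviation `σ`. -/
def gaussianLaw (m σ : ℝ) : Measure ℝ := gaussianReal m (σ ^ 2).toNNReal

/-- The law of `N(m, σ) * U[-τ/(2η), τ/(2η)]` on the line. -/
def mixedLaw (η τ σ m : ℝ) : Measure ℝ :=
  (gaussianLaw m σ).conv (uniformLaw (-(τ / (2 * η))) (τ / (2 * η)))

/-- The Gaussian distribution `N(m, σ² I_d)`. -/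
def gaussianVec {d : ℕ} (m : EuclideanSpace ℝ (Fin d)) (σ : ℝ) :
    Measure (EuclideanSpace ℝ (Fin d)) :=
  (Measure.pi fun j : Fin d => gaussianLaw (m j) σ).map (WithLp.toLp 2)

/-- The uniform distribution on the cube `[a, b]^d`, for `a < b`. -/
def uniformCube (d : ℕ) (a b : ℝ) : Measure (EuclideanSpace ℝ (Fin d)) :=
  (Measure.pi fun _ : Fin d => uniformLaw a b).map (WithLp.toLp 2)

/-- The law of `N(m, σ² I_d) * U([-τ/(2η), τ/(2η)]^d)`. -/
def mixedVec {d : ℕ} (η τ σ : ℝ) (m : EuclideanSpace ℝ (Fin d)) :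
    Measure (EuclideanSpace ℝ (Fin d)) :=
  (gaussianVec m σ).conv (uniformCube d (-(τ / (2 * η))) (τ / (2 * η)))

/-- The mixture `(1 - q) P + q Q`. -/
def mixture {Ω : Type*} [MeasurableSpace Ω] (q : ℝ) (P Q : Measure Ω) : Measure Ω :=
  ENNReal.ofReal (1 - q) • P + ENNReal.ofReal q • Q

/-! ### DP-SGD with ModelMix -/

/-- Clipping to Euclidean norm at most `c`: `g ↦ g · min {1, c / ‖g‖}`. -/
def clip {d : ℕ} (c : ℝ) (g : EuclideanSpace ℝ (Fin d)) : EuclideanSpace ℝ (Fin d) :=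
  min 1 (c / ‖g‖) • g

/-- The sign, with `sign 0 = 1`, so that two equal coordinates are pushed apart as well. -/
def sgn (x : ℝ) : ℝ := if x < 0 then -1 else 1

/-- Coordinatewise separation of the current state `a` and the previous state `b`, in place: if
`|a - b| < τ`, first `a ← a + sign(a - b) τ/2`, then `b ← b - sign(a - b) τ/2`. -/
def separate (τ a b : ℝ) : ℝ × ℝ :=
  if |a - b| < τ then
    let a' := a + sgn (a - b) * (τ / 2)
    (a', b - sgn (a' - b) * (τ / 2))
  else (a, b)

/-- The deterministic part of one iteration. The input is the pair of states
`(w_{k-1}, w_{k-2})`, the gradient `G`, the mixing coefficients `a` and the noise `Δ`; the output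
is `w_k` together with `w_{k-1}` as it has been overwritten by the separation step. -/
def mixUpdate {d : ℕ} (η τ : ℝ)
    (x : ((EuclideanSpace ℝ (Fin d) × EuclideanSpace ℝ (Fin d)) × EuclideanSpace ℝ (Fin d)) ×
      ((Fin d → ℝ) × EuclideanSpace ℝ (Fin d))) :
    EuclideanSpace ℝ (Fin d) × EuclideanSpace ℝ (Fin d) :=
  let w := x.1.1.1
  let w' := x.1.1.2
  let G := x.1.2
  let a := x.2.1
  let Δ := x.2.2
  (WithLp.toLp 2 fun j =>
      a j * (separate τ (w j) (w' j)).1 + (1 - a j) * (separate τ (w j) (w' j)).2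
        - η * (G j + Δ j),
    WithLp.toLp 2 fun j => (separate τ (w j) (w' j)).1)

theorem measurable_sgn : Measurable sgn := by
  unfold sgn
  exact Measurable.ite measurableSet_Iio measurable_const measurable_const

theorem measurable_separate (τ : ℝ) : Measurable fun p : ℝ × ℝ => separate τ p.1 p.2 := by
  have h := measurable_sgn
  have hs : MeasurableSet {p : ℝ × ℝ | |p.1 - p.2| < τ} :=
    measurableSet_lt (by fun_prop) measurable_const
  unfold separate
  refine Measurable.ite hs ?_ ?_
  · fun_prop
  · fun_prop

theorem measurable_mixUpdate {d : ℕ} (η τ : ℝ) : Measurable (mixUpdate (d := d) η τ) := by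
  have h : ∀ j : Fin d, Measurable fun x : ((EuclideanSpace ℝ (Fin d) ×
      EuclideanSpace ℝ (Fin d)) × EuclideanSpace ℝ (Fin d)) ×
      ((Fin d → ℝ) × EuclideanSpace ℝ (Fin d)) => separate τ (x.1.1.1 j) (x.1.1.2 j) := by
    intro j
    have hp : Measurable fun x : ((EuclideanSpace ℝ (Fin d) ×
        EuclideanSpace ℝ (Fin d)) × EuclideanSpace ℝ (Fin d)) ×
        ((Fin d → ℝ) × EuclideanSpace ℝ (Fin d)) => (x.1.1.1 j, x.1.1.2 j) := by fun_prop
    exact (measurable_separate τ).comp hp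
  unfold mixUpdate
  refine Measurable.prodMk ?_ ?_
  · refine (WithLp.measurable_toLp 2 _).comp (measurable_pi_lambda _ fun j => ?_)
    have := h j
    fun_prop
  · refine (WithLp.measurable_toLp 2 _).comp (measurable_pi_lambda _ fun j => ?_)
    exact (h j).fst

/-- The sum of the clipped individual gradients at `w` over the minibatch `S`, where `f w z` is
the loss of the data point `z` under the parameter `w`. -/
def clippedGrad {Z : Type*} {d : ℕ} (f : EuclideanSpace ℝ (Fin d) → Z → ℝ) (c : ℝ)
    (S : Multiset Z) (w : EuclideanSpace ℝ (Fin d)) : EuclideanSpace ℝ (Fin d) :=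
  (S.map fun z => clip c (gradient (fun u => f u z) w)).sum

theorem measurable_clippedGrad {Z : Type*} {d : ℕ} (f : EuclideanSpace ℝ (Fin d) → Z → ℝ) (c : ℝ)
    (S : Multiset Z) : Measurable (clippedGrad f c S) := by
  have h : ∀ z, Measurable fun w => clip c (gradient (fun u => f u z) w) := by
    intro z
    have hg : Measurable (gradient fun u => f u z) := by
      unfold gradient
      exact (InnerProductSpace.toDual ℝ (EuclideanSpace ℝ (Fin d))).symm.continuous.measurable.comp
        (measurable_fderiv ℝ _)
    unfold clip
    fun_prop
  induction S using Multiset.induction_on with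
  | empty => exact measurable_const
  | cons z S ih =>
    have : clippedGrad f c (z ::ₘ S) =
        fun w => clip c (gradient (fun u => f u z) w) + clippedGrad f c S w := by
      funext w; simp [clippedGrad]
    rw [this]
    exact (h z).add ih

/-- The law of the stochastic gradient: each data point of `D` enters the minibatch `S`
independently with probability `q`, so that `S` is drawn with probability
`q^|S| (1 - q)^(|D| - |S|)`. -/
def batchGrad {Z : Type*} {d : ℕ} (f : EuclideanSpace ℝ (Fin d) → Z → ℝ) (c q : ℝ)
    (D : Multiset Z) : Kernel (EuclideanSpace ℝ (Fin d)) (EuclideanSpace ℝ (Fin d)) where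
  toFun w := (D.powerset.map fun S =>
    (ENNReal.ofReal q ^ S.card * ENNReal.ofReal (1 - q) ^ (D.card - S.card)) •
      Measure.dirac (clippedGrad f c S w)).sum
  measurable' := by
    have h : ∀ M : Multiset (Multiset Z), Measurable fun w => (M.map fun S =>
        (ENNReal.ofReal q ^ S.card * ENNReal.ofReal (1 - q) ^ (D.card - S.card)) •
          Measure.dirac (clippedGrad f c S w)).sum := by
      intro M
      induction M using Multiset.induction_on with
      | empty => simp
      | cons S M ih =>
        simp only [Multiset.map_cons, Multiset.sum_cons]
        refine Measurable.add ?_ ih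
        have hd : Measurable fun w => Measure.dirac (clippedGrad f c S w) :=
          Measure.measurable_dirac.comp (measurable_clippedGrad f c S)
        refine Measure.measurable_of_measurable_coe _ fun s hs => ?_
        simp only [Measure.smul_apply, smul_eq_mul]
        exact ((Measure.measurable_coe hs).comp hd).const_mul _
    exact h _

/-- One iteration, as a Markov kernel `(w_{k-1}, w_{k-2}) ↦ (w_k, w_{k-1})` on pairs of states. The
gradient is taken at `w_{k-1}` before the separation step; the mixing coefficients are uniform on
`[0, 1]` and independent of the minibatch and of the noise `N(0, σ² I_d)`. -/
def mixKernel {Z : Type*} {d : ℕ} (f : EuclideanSpace ℝ (Fin d) → Z → ℝ) (c q η τ σ : ℝ)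
    (D : Multiset Z) : Kernel (EuclideanSpace ℝ (Fin d) × EuclideanSpace ℝ (Fin d))
      (EuclideanSpace ℝ (Fin d) × EuclideanSpace ℝ (Fin d)) :=
  Kernel.deterministic (mixUpdate η τ) (measurable_mixUpdate η τ) ∘ₖ
    ((Kernel.id ×ₖ (batchGrad f c q D).comap Prod.fst measurable_fst) ×ₖ
      Kernel.const _
        ((Measure.pi fun _ : Fin d => uniformLaw 0 1).prod (gaussianVec 0 σ)))

/-- The joint law of the two current states after `T` iterations, started from
`(w_0, w_{-1})`. -/
def mixStates {Z : Type*} {d : ℕ} (f : EuclideanSpace ℝ (Fin d) → Z → ℝ) (c q η τ σ : ℝ)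
    (w₀ wPrev : EuclideanSpace ℝ (Fin d)) (D : Multiset Z) :
    ℕ → Measure (EuclideanSpace ℝ (Fin d) × EuclideanSpace ℝ (Fin d))
  | 0 => Measure.dirac (w₀, wPrev)
  | T + 1 => (mixStates f c q η τ σ w₀ wPrev D T).bind (mixKernel f c q η τ σ D)

/-- The law of the output `w_T` of DP-SGD with ModelMix on the dataset `D`, where `w₀` and `wPrev`
stand for the initial states `w_0` and `w_{-1}`. -/
def modelMix {Z : Type*} {d : ℕ} (f : EuclideanSpace ℝ (Fin d) → Z → ℝ) (c q η τ σ : ℝ)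
    (w₀ wPrev : EuclideanSpace ℝ (Fin d)) (T : ℕ) (D : Multiset Z) :
    Measure (EuclideanSpace ℝ (Fin d)) :=
  (mixStates f c q η τ σ w₀ wPrev D T).map Prod.fst

/-! ### The algorithm defines probability laws -/

theorem sum_weights {Z : Type*} (a b : ℝ≥0∞) (h : a + b = 1) (D : Multiset Z) :
    (D.powerset.map fun S => a ^ S.card * b ^ (D.card - S.card)).sum = 1 := by
  induction D using Multiset.induction_on with
  | empty => simp
  | cons z D ih =>
    have h₁ : (D.powerset.map fun S => a ^ S.card * b ^ ((z ::ₘ D).card - S.card)).sum = b := by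
      rw [Multiset.map_congr rfl (g := fun S => b * (a ^ S.card * b ^ (D.card - S.card))),
        Multiset.sum_map_mul_left, ih, mul_one]
      intro S hS
      have := Multiset.card_le_card (Multiset.mem_powerset.1 hS)
      rw [Multiset.card_cons, Nat.succ_sub this, pow_succ]
      ring
    have h₂ : (D.powerset.map fun S => a ^ (z ::ₘ S).card *
        b ^ ((z ::ₘ D).card - (z ::ₘ S).card)).sum = a := by
      rw [Multiset.map_congr rfl (g := fun S => a * (a ^ S.card * b ^ (D.card - S.card))),
        Multiset.sum_map_mul_left, ih, mul_one]
      intro S _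
      rw [Multiset.card_cons, Multiset.card_cons, Nat.add_sub_add_right, pow_succ]
      ring
    rw [Multiset.powerset_cons, Multiset.map_add, Multiset.sum_add, Multiset.map_map, h₁]
    simp only [Function.comp_def]
    rw [h₂, add_comm, h]

theorem isMarkovKernel_batchGrad {Z : Type*} {d : ℕ} (f : EuclideanSpace ℝ (Fin d) → Z → ℝ)
    (c q : ℝ) (hq₀ : 0 ≤ q) (hq₁ : q ≤ 1) (D : Multiset Z) :
    IsMarkovKernel (batchGrad f c q D) := by
  refine ⟨fun w => ⟨?_⟩⟩
  have h : ∀ M : Multiset (Multiset Z), (M.map fun S =>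
      (ENNReal.ofReal q ^ S.card * ENNReal.ofReal (1 - q) ^ (D.card - S.card)) •
        Measure.dirac (clippedGrad f c S w)).sum univ = (M.map fun S =>
      ENNReal.ofReal q ^ S.card * ENNReal.ofReal (1 - q) ^ (D.card - S.card)).sum := by
    intro M
    induction M using Multiset.induction_on with
    | empty => simp
    | cons S M ih => simp [ih]
  refine (h _).trans (sum_weights _ _ ?_ D)
  rw [← ENNReal.ofReal_add hq₀ (by linarith)]
  simp

theorem isProbabilityMeasure_uniformLaw {a b : ℝ} (h : a < b) :
    IsProbabilityMeasure (uniformLaw a b) := by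
  refine cond_isProbabilityMeasure_of_finite ?_ ?_
  · simp [h]
  · simp

instance isProbabilityMeasure_gaussianLaw (m σ : ℝ) : IsProbabilityMeasure (gaussianLaw m σ) := by
  unfold gaussianLaw
  infer_instance

instance isProbabilityMeasure_gaussianVec {d : ℕ} (m : EuclideanSpace ℝ (Fin d)) (σ : ℝ) :
    IsProbabilityMeasure (gaussianVec m σ) :=
  Measure.isProbabilityMeasure_map (WithLp.measurable_toLp 2 _).aemeasurable

theorem isMarkovKernel_mixKernel {Z : Type*} {d : ℕ} (f : EuclideanSpace ℝ (Fin d) → Z → ℝ)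
    (c q η τ σ : ℝ) (hq₀ : 0 ≤ q) (hq₁ : q ≤ 1) (D : Multiset Z) :
    IsMarkovKernel (mixKernel f c q η τ σ D) := by
  have := isMarkovKernel_batchGrad f c q hq₀ hq₁ D
  have := isProbabilityMeasure_uniformLaw (zero_lt_one (α := ℝ))
  unfold mixKernel
  infer_instance

theorem isProbabilityMeasure_modelMix {Z : Type*} {d : ℕ} (f : EuclideanSpace ℝ (Fin d) → Z → ℝ)
    (c q η τ σ : ℝ) (hq₀ : 0 ≤ q) (hq₁ : q ≤ 1) (w₀ wPrev : EuclideanSpace ℝ (Fin d)) (T : ℕ)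
    (D : Multiset Z) : IsProbabilityMeasure (modelMix f c q η τ σ w₀ wPrev T D) := by
  have h : IsProbabilityMeasure (mixStates f c q η τ σ w₀ wPrev D T) := by
    induction T with
    | zero => unfold mixStates; infer_instance
    | succ T ih =>
      have := isMarkovKernel_mixKernel f c q η τ σ hq₀ hq₁ D
      unfold mixStates
      infer_instance
  exact Measure.isProbabilityMeasure_map measurable_fst.aemeasurable

end

/-! One iteration adds to the gradient sum a Gaussian vector and, because the coefficients are
uniform and the states are separated, an independent uniform vector. Indeed `a w + (1 - a) w' = (w +
w')/2 + (a - 1/2)(w - w')`, and the separated coordinates satisfy `|w - w'| ≥ τ`. Conditionally on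
the states, coordinate `j` of the noise thus has law `N(0, σ) * U[-β j, β j]` with `β j ≥ τ/(2η)`.
An additional data point, present with probability `q`, shifts this law by a clipped gradient `v`,
`‖v‖ ≤ c`. Two facts are needed: the worst `(v, β)` for the Rényi moment is a one-hot shift of
length `c` with every `β j = τ/(2η)`, and the moment bound composes over iterations for both orders
of the two datasets.

For integer order the moment of the mixture expands binomially with nonnegative coefficients, so it
suffices to treat pure shifts. Those moments factor over coordinates into `boxMoment n (v j / σ) (β
j / σ)`, of order `n + 1`. They decrease with the half-width (`boxMoment_antitone`), and their
logarithm grows at least quadratically with the shift (`sq_mul_log_boxMoment_le`). Hence coordinate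
`j` costs at most the share `(v j)² / c²` of the one-hot cost, and the shares add up to at most one
(`prod_boxMoment_le`).

Quadratic growth rests on a shape property of the potential `W = -log p` of the box density `p`.
Here `W'' = 1 - truncVar`, and the variance of a truncated Gaussian decreases with the size of its
tilt (`truncVar_le_of_abs_le`), so `W''` lies in `[0, 1]` and increases with `|x|` (`IsStiffening`).
The exponent of `p(x - a)^(n+1) / p(x)^n`, recentred, exceeds `-W` by `a²` times an average of `W''`
at points moved in the direction of `a`. Enlarging `a` moves these points further, a reflection
argument shows that the average does not drop, and two uses of Jensen's inequality pass to
logarithms (`sq_mul_log_le`). Monotonicity in the width is an integration by parts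
(`integral_boxTilt_mul_le`).

Removing a data point exchanges the arguments of the divergence. The reflection `x ↦ v - x`
exchanges the two shifted laws, and with a pointwise inequality (`inv_pow_add_le`) the exchanged
moment is at most the original one. Composition uses the dual form `∫ f dP ≤ K (∫ f^r dQ)^(1/r)` of
a Rényi bound (`HolderBound`), which passes through kernels by multiplying the constants. Applied to
indicators it yields approximate differential privacy. -/

noncomputable section

/-! ### Exponential tilts of the truncated Gaussian -/

/-- The `j`-th unnormalized moment of the standard Gaussian restricted to `[-b, b]`, tilted by
`exp (x u)`. -/
def truncMoment (b : ℝ) (j : ℕ) (x : ℝ) : ℝ :=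
  ∫ u in (-b)..b, u ^ j * Real.exp (x * u - u ^ 2 / 2)

/-- The mean of the tilted truncated Gaussian. -/
def truncMean (b x : ℝ) : ℝ := truncMoment b 1 x / truncMoment b 0 x

/-- The variance of the tilted truncated Gaussian. -/
def truncVar (b x : ℝ) : ℝ :=
  truncMoment b 2 x / truncMoment b 0 x - truncMean b x ^ 2

theorem hasDerivAt_truncMoment (b : ℝ) (j : ℕ) (x : ℝ) :
    HasDerivAt (truncMoment b j) (truncMoment b (j + 1) x) x := by
  refine (intervalIntegral.hasDerivAt_integral_of_dominated_loc_of_deriv_le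
    (F := fun x u => u ^ j * Real.exp (x * u - u ^ 2 / 2))
    (F' := fun x u => u ^ (j + 1) * Real.exp (x * u - u ^ 2 / 2))
    (bound := fun u => |u| ^ (j + 1) * Real.exp ((|x| + 1) * |u|))
    (Metric.ball_mem_nhds x one_pos) ?_ ?_ ?_ ?_ ?_ ?_).2
  · exact Filter.Eventually.of_forall fun y => by fun_prop
  · exact Continuous.intervalIntegrable (by fun_prop) _ _
  · fun_prop
  · refine Filter.Eventually.of_forall fun u _ y hy => ?_
    rw [norm_mul, norm_pow, Real.norm_eq_abs, Real.norm_eq_abs, Real.abs_exp]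
    gcongr
    have h1 : |y| ≤ |x| + 1 := by
      have := abs_sub_abs_le_abs_sub y x
      rw [Metric.mem_ball, Real.dist_eq] at hy
      linarith
    have h2 : y * u ≤ |y| * |u| := by rw [← abs_mul]; exact le_abs_self _
    have h3 : |y| * |u| ≤ (|x| + 1) * |u| := by gcongr
    nlinarith [sq_nonneg u]
  · exact Continuous.intervalIntegrable (by fun_prop) _ _
  · refine Filter.Eventually.of_forall fun u _ y _ => ?_
    have : HasDerivAt (fun y : ℝ => y * u - u ^ 2 / 2) u y := by
      simpa using ((hasDerivAt_id y).mul_const u).sub_const (u ^ 2 / 2)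
    exact (this.exp.const_mul (u ^ j)).congr_deriv (by ring)

theorem continuous_truncMoment (b : ℝ) (j : ℕ) : Continuous (truncMoment b j) :=
  continuous_iff_continuousAt.2 fun x => (hasDerivAt_truncMoment b j x).continuousAt

theorem truncMoment_zero_pos {b : ℝ} (hb : 0 < b) (x : ℝ) : 0 < truncMoment b 0 x := by
  refine intervalIntegral.intervalIntegral_pos_of_pos
    (Continuous.intervalIntegrable (by fun_prop) _ _) (fun u => ?_) (by linarith)
  positivity

theorem truncMoment_neg (b : ℝ) (j : ℕ) (x : ℝ) :
    truncMoment b j (-x) = (-1) ^ j * truncMoment b j x := by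
  unfold truncMoment
  have := intervalIntegral.integral_comp_neg (a := -b) (b := b)
    (fun u : ℝ => u ^ j * Real.exp (-x * u - u ^ 2 / 2))
  rw [neg_neg] at this
  rw [← this, ← intervalIntegral.integral_const_mul]
  congr 1; ext u
  rw [neg_pow u j]; simp only [even_two, Even.neg_pow]; ring_nf

theorem hasDerivAt_log_truncMoment {b : ℝ} (hb : 0 < b) (x : ℝ) :
    HasDerivAt (fun y => Real.log (truncMoment b 0 y)) (truncMean b x) x :=
  (hasDerivAt_truncMoment b 0 x).log (truncMoment_zero_pos hb x).ne'

theorem hasDerivAt_truncMean {b : ℝ} (hb : 0 < b) (x : ℝ) :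
    HasDerivAt (truncMean b) (truncVar b x) x := by
  have h := (hasDerivAt_truncMoment b 1 x).div (hasDerivAt_truncMoment b 0 x)
    (truncMoment_zero_pos hb x).ne'
  have h0 := (truncMoment_zero_pos hb x).ne'
  refine h.congr_deriv ?_
  unfold truncVar truncMean
  field_simp

theorem continuous_truncVar {b : ℝ} (hb : 0 < b) : Continuous (truncVar b) := by
  unfold truncVar truncMean
  have h := fun j => continuous_truncMoment b j
  exact ((h 2).div (h 0) fun x => (truncMoment_zero_pos hb x).ne').sub
    (((h 1).div (h 0) fun x => (truncMoment_zero_pos hb x).ne').pow 2)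

theorem abs_truncMoment_one_le {b : ℝ} (hb : 0 < b) (x : ℝ) :
    |truncMoment b 1 x| ≤ b * truncMoment b 0 x := by
  unfold truncMoment
  rw [← intervalIntegral.integral_const_mul]
  refine (intervalIntegral.abs_integral_le_integral_abs (by linarith)).trans
    (intervalIntegral.integral_mono_on (by linarith)
      (Continuous.intervalIntegrable (by fun_prop) _ _)
      (Continuous.intervalIntegrable (by fun_prop) _ _) fun u hu => ?_)
  rw [abs_mul, Real.abs_exp, pow_one, pow_zero, one_mul]
  gcongr
  exact abs_le.2 hu

/-- Integration of the derivative of `exp (x u - u²/2)`. The boundary values at `±b` are what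
distinguishes the truncated Gaussian from the full one. -/
theorem truncMoment_one_eq (b x : ℝ) : truncMoment b 1 x = x * truncMoment b 0 x -
    (Real.exp (x * b - b ^ 2 / 2) - Real.exp (-(x * b) - b ^ 2 / 2)) := by
  have h : ∀ u : ℝ, HasDerivAt (fun u => Real.exp (x * u - u ^ 2 / 2))
      ((x - u) * Real.exp (x * u - u ^ 2 / 2)) u := by
    intro u
    have h1 : HasDerivAt (fun u : ℝ => x * u - u ^ 2 / 2) (x - u) u := by
      exact (((hasDerivAt_id u).const_mul x).sub ((hasDerivAt_pow 2 u).div_const 2)).congr_deriv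
        (by simp)
    rw [mul_comm]; exact h1.exp
  have h2 := intervalIntegral.integral_eq_sub_of_hasDerivAt (a := -b) (b := b) (fun u _ => h u)
    (Continuous.intervalIntegrable (by fun_prop) _ _)
  have h3 : ∫ u in (-b)..b, (x - u) * Real.exp (x * u - u ^ 2 / 2) =
      x * truncMoment b 0 x - truncMoment b 1 x := by
    unfold truncMoment
    rw [← intervalIntegral.integral_const_mul, ← intervalIntegral.integral_sub
      (Continuous.intervalIntegrable (by fun_prop) _ _)
      (Continuous.intervalIntegrable (by fun_prop) _ _)]
    congr 1; ext u; ring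
  rw [h3] at h2
  simp only [mul_neg, neg_sq] at h2
  linarith

theorem truncMoment_two_eq (b x : ℝ) : truncMoment b 2 x =
    truncMoment b 0 x + x * truncMoment b 1 x -
    b * (Real.exp (x * b - b ^ 2 / 2) + Real.exp (-(x * b) - b ^ 2 / 2)) := by
  have h : ∀ u : ℝ, HasDerivAt (fun u => u * Real.exp (x * u - u ^ 2 / 2))
      ((1 + x * u - u ^ 2) * Real.exp (x * u - u ^ 2 / 2)) u := by
    intro u
    have h1 : HasDerivAt (fun u : ℝ => x * u - u ^ 2 / 2) (x - u) u := by
      exact (((hasDerivAt_id u).const_mul x).sub ((hasDerivAt_pow 2 u).div_const 2)).congr_deriv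
        (by simp)
    exact ((hasDerivAt_id u).mul h1.exp).congr_deriv (by simp; ring)
  have h2 := intervalIntegral.integral_eq_sub_of_hasDerivAt (a := -b) (b := b) (fun u _ => h u)
    (Continuous.intervalIntegrable (by fun_prop) _ _)
  have h3 : ∫ u in (-b)..b, (1 + x * u - u ^ 2) * Real.exp (x * u - u ^ 2 / 2) =
      truncMoment b 0 x + x * truncMoment b 1 x - truncMoment b 2 x := by
    unfold truncMoment
    rw [← intervalIntegral.integral_const_mul, ← intervalIntegral.integral_add
      (Continuous.intervalIntegrable (by fun_prop) _ _)
      (Continuous.intervalIntegrable (by fun_prop) _ _), ← intervalIntegral.integral_sub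
      (Continuous.intervalIntegrable (by fun_prop) _ _)
      (Continuous.intervalIntegrable (by fun_prop) _ _)]
    congr 1; ext u; ring
  rw [h3] at h2
  simp only [mul_neg, neg_sq] at h2
  linarith

theorem truncVar_le_one {b : ℝ} (hb : 0 < b) (x : ℝ) : truncVar b x ≤ 1 := by
  have h0 := truncMoment_zero_pos hb x
  have h1 := truncMoment_one_eq b x
  have h2 := truncMoment_two_eq b x
  have h3 := abs_le.1 (abs_truncMoment_one_le hb x)
  unfold truncVar truncMean
  set z0 := truncMoment b 0 x
  set z1 := truncMoment b 1 x
  set z2 := truncMoment b 2 x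
  have e1 := Real.exp_pos (x * b - b ^ 2 / 2)
  have e2 := Real.exp_pos (-(x * b) - b ^ 2 / 2)
  set p := Real.exp (x * b - b ^ 2 / 2)
  set q := Real.exp (-(x * b) - b ^ 2 / 2)
  have key : z2 / z0 - (z1 / z0) ^ 2 = (z2 * z0 - z1 ^ 2) / z0 ^ 2 := by field_simp
  rw [key, div_le_one (by positivity)]
  -- Eliminating the second moment leaves a deficit from the boundary terms, nonnegative because the
  -- mean lies in `[-b, b]`.
  have : z2 * z0 - z1 ^ 2 = z0 ^ 2 - ((b * z0 - z1) * p + (b * z0 + z1) * q) := by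
    linear_combination z0 * h2 - z1 * h1
  rw [this]
  nlinarith [mul_nonneg (sub_nonneg.2 h3.2) e1.le, mul_nonneg (by linarith : 0 ≤ b * z0 + z1) e2.le]

/-- Two antisymmetric kernels of opposite signs: the continuous Chebyshev (Andréief) inequality. -/
theorem integral_mul_integral_le_of_opposite {α : Type*} [MeasurableSpace α] {μ : Measure α}
    [SFinite μ] {f g p q : α → ℝ}
    (hfp : Integrable (fun s => f s * p s) μ) (hgq : Integrable (fun s => g s * q s) μ)
    (hfq : Integrable (fun s => f s * q s) μ) (hgp : Integrable (fun s => g s * p s) μ)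
    (h : ∀ s r, (f s * g r - f r * g s) * (p s * q r - p r * q s) ≤ 0) :
    (∫ s, f s * p s ∂μ) * ∫ s, g s * q s ∂μ ≤ (∫ s, f s * q s ∂μ) * ∫ s, g s * p s ∂μ := by
  have i1 := hfp.mul_prod hgq
  have i2 := hgq.mul_prod hfp
  have i3 := hfq.mul_prod hgp
  have i4 := hgp.mul_prod hfq
  have e1 := integral_prod_mul (μ := μ) (ν := μ) (fun s => f s * p s) (fun s => g s * q s)
  have e2 := integral_prod_mul (μ := μ) (ν := μ) (fun s => g s * q s) (fun s => f s * p s)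
  have e3 := integral_prod_mul (μ := μ) (ν := μ) (fun s => f s * q s) (fun s => g s * p s)
  have e4 := integral_prod_mul (μ := μ) (ν := μ) (fun s => g s * p s) (fun s => f s * q s)
  have key : ∫ z, ((f z.1 * p z.1 * (g z.2 * q z.2) + g z.1 * q z.1 * (f z.2 * p z.2)) -
      (f z.1 * q z.1 * (g z.2 * p z.2) + g z.1 * p z.1 * (f z.2 * q z.2))) ∂(μ.prod μ) ≤ 0 := by
    refine integral_nonpos fun z => ?_
    have := h z.1 z.2
    simp only [Pi.zero_apply]
    linarith
  rw [integral_sub (by exact i1.add i2) (by exact i3.add i4), integral_add i1 i2, integral_add i3 i4, e1, e2, e3,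
    e4] at key
  linarith

/-- Total positivity of `cosh (x s)` in `(|x|, |s|)`. Product-to-sum formulas reduce it to `x s + y
r ≤ y s + x r` and `|x s - y r| ≤ y s - x r` for nonnegative arguments. -/
theorem cosh_mul_cosh_le {x y s r : ℝ} (hxy : |x| ≤ |y|) (hrs : |r| ≤ |s|) :
    Real.cosh (x * s) * Real.cosh (y * r) ≤ Real.cosh (y * s) * Real.cosh (x * r) := by
  rw [← Real.cosh_abs (x * s), ← Real.cosh_abs (y * r), ← Real.cosh_abs (y * s),
    ← Real.cosh_abs (x * r), abs_mul, abs_mul, abs_mul, abs_mul]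
  have hx := abs_nonneg x
  have hr := abs_nonneg r
  generalize |x| = x at *
  generalize |y| = y at *
  generalize |s| = s at *
  generalize |r| = r at *
  have a1 : Real.cosh (x * s + y * r) ≤ Real.cosh (y * s + x * r) := by
    rw [Real.cosh_le_cosh, abs_of_nonneg (by nlinarith), abs_of_nonneg (by nlinarith)]
    nlinarith
  have a2 : Real.cosh (x * s - y * r) ≤ Real.cosh (y * s - x * r) := by
    rw [Real.cosh_le_cosh]
    refine le_trans ?_ (le_abs_self _)
    rw [abs_le]
    constructor <;> nlinarith
  rw [Real.cosh_add, Real.cosh_add] at a1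
  rw [Real.cosh_sub, Real.cosh_sub] at a2
  linarith

/-! ### Monotonicity of the variance through the sum and difference of two copies -/

/-- The density of the standard Gaussian restricted to `[-b, b]`, unnormalized. -/
def truncWeight (b u : ℝ) : ℝ := (Icc (-b) b).indicator (fun u => Real.exp (-u ^ 2 / 2)) u

theorem truncMoment_eq_integral_weight {b : ℝ} (hb : 0 < b) (j : ℕ) (x : ℝ) :
    truncMoment b j x = ∫ u, u ^ j * Real.exp (x * u) * truncWeight b u := by
  unfold truncMoment
  rw [intervalIntegral.integral_of_le (by linarith), ← integral_Icc_eq_integral_Ioc,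
    ← integral_indicator measurableSet_Icc]
  congr 1; ext u
  unfold truncWeight
  by_cases hu : u ∈ Icc (-b) b
  · rw [indicator_of_mem hu, indicator_of_mem hu, mul_assoc, ← Real.exp_add]; ring_nf
  · rw [indicator_of_notMem hu, indicator_of_notMem hu, mul_zero]

theorem integrable_pow_mul_exp_mul_weight (b : ℝ) (j : ℕ) (x : ℝ) :
    Integrable fun u => u ^ j * Real.exp (x * u) * truncWeight b u := by
  have h : IntegrableOn (fun u : ℝ => u ^ j * Real.exp (x * u) * Real.exp (-u ^ 2 / 2))
      (Icc (-b) b) := Continuous.integrableOn_Icc (by fun_prop)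
  refine (h.integrable_indicator measurableSet_Icc).congr (Filter.Eventually.of_forall fun u => ?_)
  unfold truncWeight
  by_cases hu : u ∈ Icc (-b) b
  · simp only [indicator_of_mem hu]
  · simp only [indicator_of_notMem hu, mul_zero]

/-- The law of `u - v` conditionally on `s = u + v` for two independent copies: `j`-th moment. -/
def pairMoment (b : ℝ) (j : ℕ) (s : ℝ) : ℝ :=
  ∫ v, (s - 2 * v) ^ j * (truncWeight b (s - v) * truncWeight b v)

/-- In the coordinates `s = u + v`, `t = u - v` the Gaussian factors and the square `[-b, b]²`
becomes `|s| + |t| ≤ 2b`. So `s` influences the law of `t` only through the length of the interval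
of truncation. -/
theorem truncWeight_pair (b s t : ℝ) : truncWeight b ((s + t) / 2) * truncWeight b ((s - t) / 2) =
    Real.exp (-s ^ 2 / 4) *
      (Icc (-(2 * b - |s|)) (2 * b - |s|)).indicator (fun t => Real.exp (-t ^ 2 / 4)) t := by
  unfold truncWeight
  have key : t ∈ Icc (-(2 * b - |s|)) (2 * b - |s|) ↔
      (s + t) / 2 ∈ Icc (-b) b ∧ (s - t) / 2 ∈ Icc (-b) b := by
    simp only [mem_Icc]
    constructor
    · rintro ⟨h1, h2⟩
      have := neg_abs_le s
      have := le_abs_self s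
      refine ⟨⟨?_, ?_⟩, ?_, ?_⟩ <;> linarith
    · rintro ⟨⟨h1, h2⟩, h3, h4⟩
      rcases abs_cases s with ⟨h, -⟩ | ⟨h, -⟩ <;> rw [h] <;> constructor <;> linarith
  by_cases ht : t ∈ Icc (-(2 * b - |s|)) (2 * b - |s|)
  · rw [indicator_of_mem ht, indicator_of_mem (key.1 ht).1, indicator_of_mem (key.1 ht).2,
      ← Real.exp_add, ← Real.exp_add]
    ring_nf
  · rw [indicator_of_notMem ht, mul_zero]
    by_cases h1 : (s + t) / 2 ∈ Icc (-b) b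
    · rw [indicator_of_notMem (s := Icc (-b) b) (a := (s - t) / 2) fun h => ht (key.2 ⟨h1, h⟩),
        mul_zero]
    · rw [indicator_of_notMem h1, zero_mul]

theorem pairMoment_eq (b : ℝ) (j : ℕ) (s : ℝ) : pairMoment b j s =
    Real.exp (-s ^ 2 / 4) / 2 * ∫ t, t ^ j * Real.exp (-t ^ 2 / 4) *
      (Icc (-(2 * b - |s|)) (2 * b - |s|)).indicator 1 t := by
  unfold pairMoment
  set f : ℝ → ℝ := fun v => (s - 2 * v) ^ j * (truncWeight b (s - v) * truncWeight b v) with hf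
  have h1 : ∫ t, f ((s - t) / 2) = 2 * ∫ v, f v := by
    have := integral_sub_left_eq_self (fun t => f (t / 2)) volume s
    rw [this, Measure.integral_comp_div]
    simp
  have h2 : ∀ t, f ((s - t) / 2) = Real.exp (-s ^ 2 / 4) * (t ^ j * Real.exp (-t ^ 2 / 4) *
      (Icc (-(2 * b - |s|)) (2 * b - |s|)).indicator 1 t) := by
    intro t
    simp only [hf]
    rw [show s - (s - t) / 2 = (s + t) / 2 by ring, truncWeight_pair]
    by_cases ht : t ∈ Icc (-(2 * b - |s|)) (2 * b - |s|)
    · simp only [indicator_of_mem ht, Pi.one_apply]; ring_nf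
    · simp only [indicator_of_notMem ht]; ring
  simp_rw [h2] at h1
  rw [integral_const_mul] at h1
  linarith

theorem pairMoment_neg (b : ℝ) {j : ℕ} (s : ℝ) :
    pairMoment b j (-s) = pairMoment b j s := by
  simp [pairMoment_eq]

/-- A larger `|s|` shortens the interval available to `t`, which lowers the conditional mean of
`t²`: the points that are cut off have the largest `t²`. The cross-multiplied form also covers empty
intervals. -/
theorem pairMoment_two_mul_zero_le (b : ℝ) {r s : ℝ} (h : |r| ≤ |s|) :
    pairMoment b 2 s * pairMoment b 0 r ≤ pairMoment b 2 r * pairMoment b 0 s := by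
  have hi : ∀ (j : ℕ) (ρ : ℝ), Integrable fun t : ℝ => t ^ j * Real.exp (-t ^ 2 / 4) *
      (Icc (-ρ) ρ).indicator 1 t := by
    intro j ρ
    have h : IntegrableOn (fun u : ℝ => u ^ j * Real.exp (-u ^ 2 / 4))
      (Icc (-ρ) ρ) := Continuous.integrableOn_Icc (by fun_prop)
    refine (h.integrable_indicator measurableSet_Icc).congr
      (Filter.Eventually.of_forall fun u => ?_)
    by_cases hu : u ∈ Icc (-ρ) ρ
    · simp only [indicator_of_mem hu, Pi.one_apply, mul_one]
    · simp only [indicator_of_notMem hu, mul_zero]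
  have key := integral_mul_integral_le_of_opposite (hi 2 (2 * b - |s|)) (hi 0 (2 * b - |r|))
    (hi 2 (2 * b - |r|)) (hi 0 (2 * b - |s|)) ?_
  · rw [pairMoment_eq, pairMoment_eq, pairMoment_eq, pairMoment_eq]
    have e1 := Real.exp_pos (-s ^ 2 / 4)
    have e2 := Real.exp_pos (-r ^ 2 / 4)
    have := mul_le_mul_of_nonneg_left key
      (by positivity : 0 ≤ Real.exp (-s ^ 2 / 4) / 2 * (Real.exp (-r ^ 2 / 4) / 2))
    linarith
  · intro t t'
    have hsub : Icc (-(2 * b - |s|)) (2 * b - |s|) ⊆ Icc (-(2 * b - |r|)) (2 * b - |r|) :=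
      Icc_subset_Icc (by linarith) (by linarith)
    have e1 := Real.exp_pos (-t ^ 2 / 4)
    have e2 := Real.exp_pos (-t' ^ 2 / 4)
    have aux : ∀ {t t' : ℝ}, t ∈ Icc (-(2 * b - |s|)) (2 * b - |s|) →
        t' ∉ Icc (-(2 * b - |s|)) (2 * b - |s|) → t ^ 2 ≤ t' ^ 2 := by
      intro t t' h1 h2
      rw [mem_Icc, ← abs_le] at h1 h2
      exact sq_le_sq.2 (h1.trans (not_le.1 h2).le)
    have e : (t ^ 2 * Real.exp (-t ^ 2 / 4) * (t' ^ 0 * Real.exp (-t' ^ 2 / 4)) -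
        t' ^ 2 * Real.exp (-t' ^ 2 / 4) * (t ^ 0 * Real.exp (-t ^ 2 / 4))) =
        (t ^ 2 - t' ^ 2) * (Real.exp (-t ^ 2 / 4) * Real.exp (-t' ^ 2 / 4)) := by ring
    rw [e]
    have e3 : 0 < Real.exp (-t ^ 2 / 4) * Real.exp (-t' ^ 2 / 4) := by positivity
    by_cases h1 : t ∈ Icc (-(2 * b - |s|)) (2 * b - |s|) <;>
    by_cases h2 : t' ∈ Icc (-(2 * b - |s|)) (2 * b - |s|)
    · rw [indicator_of_mem h1, indicator_of_mem h2, indicator_of_mem (hsub h1),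
        indicator_of_mem (hsub h2)]
      simp
    · rw [indicator_of_mem h1, indicator_of_notMem h2, indicator_of_mem (hsub h1)]
      have := aux h1 h2
      have h4 : (0:ℝ) ≤ (Icc (-(2 * b - |r|)) (2 * b - |r|)).indicator 1 t' :=
        indicator_nonneg (fun _ _ => zero_le_one) _
      simp only [Pi.one_apply, one_mul, zero_mul, sub_zero]
      exact mul_nonpos_of_nonpos_of_nonneg
        (mul_nonpos_of_nonpos_of_nonneg (by linarith) e3.le) h4
    · rw [indicator_of_mem h2, indicator_of_notMem h1, indicator_of_mem (hsub h2)]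
      have := aux h2 h1
      have h4 : (0:ℝ) ≤ (Icc (-(2 * b - |r|)) (2 * b - |r|)).indicator 1 t :=
        indicator_nonneg (fun _ _ => zero_le_one) _
      simp only [Pi.one_apply, one_mul, zero_mul, zero_sub]
      exact mul_nonpos_of_nonneg_of_nonpos (mul_nonneg (by linarith) e3.le) (by linarith)
    · rw [indicator_of_notMem h1, indicator_of_notMem h2]
      simp

theorem pairMoment_nonneg {j : ℕ} (hj : Even j) (b s : ℝ) : 0 ≤ pairMoment b j s := by
  refine integral_nonneg fun v => ?_
  have h : ∀ u, 0 ≤ truncWeight b u := fun u => indicator_nonneg (fun _ _ => by positivity) _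
  have := hj.pow_nonneg (s - 2 * v)
  exact mul_nonneg this (mul_nonneg (h _) (h _))

/-- Passing to `s = u + v`. -/
theorem integral_exp_mul_pairMoment (b : ℝ) (j : ℕ) (x : ℝ)
    (hG : Integrable (fun z : ℝ × ℝ => (z.2 - z.1) ^ j * Real.exp (x * (z.1 + z.2)) *
      (truncWeight b z.2 * truncWeight b z.1)) (volume.prod volume)) :
    Integrable (fun s => Real.exp (x * s) * pairMoment b j s) ∧
    ∫ s, Real.exp (x * s) * pairMoment b j s =
      ∫ z : ℝ × ℝ, (z.2 - z.1) ^ j * Real.exp (x * (z.1 + z.2)) *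
        (truncWeight b z.2 * truncWeight b z.1) ∂(volume.prod volume) := by
  have hmp : MeasurePreserving (MeasurableEquiv.shearAddRight ℝ) (volume.prod volume)
      (volume.prod volume) := measurePreserving_prod_add volume volume
  set H : ℝ × ℝ → ℝ := fun z => (z.2 - 2 * z.1) ^ j * Real.exp (x * z.2) *
      (truncWeight b (z.2 - z.1) * truncWeight b z.1) with hH
  have hcomp : (fun z : ℝ × ℝ => (z.2 - z.1) ^ j * Real.exp (x * (z.1 + z.2)) *
      (truncWeight b z.2 * truncWeight b z.1)) = H ∘ MeasurableEquiv.shearAddRight ℝ := by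
    ext z
    have : (MeasurableEquiv.shearAddRight ℝ) z = (z.1, z.1 + z.2) := rfl
    simp only [hH, Function.comp_apply, this]
    rw [show z.1 + z.2 - z.1 = z.2 by ring, show z.1 + z.2 - 2 * z.1 = z.2 - z.1 by ring]
  have hHi : Integrable H (volume.prod volume) := by
    rw [hcomp] at hG
    exact (hmp.integrable_comp_emb (MeasurableEquiv.measurableEmbedding _)).1 hG
  have e : ∀ s, ∫ v, H (v, s) = Real.exp (x * s) * pairMoment b j s := by
    intro s
    simp only [hH, pairMoment]
    rw [← integral_const_mul]
    congr 1; ext v; ring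
  constructor
  · exact hHi.integral_prod_right.congr (Filter.Eventually.of_forall e)
  · rw [hcomp]
    have h1 := hmp.integral_comp (MeasurableEquiv.measurableEmbedding _) H
    rw [show ∫ z, (H ∘ MeasurableEquiv.shearAddRight ℝ) z ∂(volume.prod volume) =
      ∫ z, H z ∂(volume.prod volume) from h1, integral_prod_symm _ hHi]
    exact integral_congr_ae (Filter.Eventually.of_forall fun s => (e s).symm)

theorem integral_exp_mul_pairMoment_zero {b : ℝ} (hb : 0 < b) (x : ℝ) :
    Integrable (fun s => Real.exp (x * s) * pairMoment b 0 s) ∧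
    ∫ s, Real.exp (x * s) * pairMoment b 0 s = truncMoment b 0 x ^ 2 := by
  have i0 := integrable_pow_mul_exp_mul_weight b 0 x
  have e : ∀ z : ℝ × ℝ, (z.2 - z.1) ^ 0 * Real.exp (x * (z.1 + z.2)) *
      (truncWeight b z.2 * truncWeight b z.1) =
      (z.1 ^ 0 * Real.exp (x * z.1) * truncWeight b z.1) *
      (z.2 ^ 0 * Real.exp (x * z.2) * truncWeight b z.2) := by
    intro z; rw [mul_add, Real.exp_add]; ring
  have hi := i0.mul_prod i0
  have h := integral_exp_mul_pairMoment b 0 x (hi.congr (Filter.Eventually.of_forall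
    fun z => (e z).symm))
  refine ⟨h.1, h.2.trans ?_⟩
  simp_rw [e]
  rw [integral_prod_mul (fun u => u ^ 0 * Real.exp (x * u) * truncWeight b u)
    (fun u => u ^ 0 * Real.exp (x * u) * truncWeight b u), truncMoment_eq_integral_weight hb, sq]

theorem integral_exp_mul_pairMoment_two {b : ℝ} (hb : 0 < b) (x : ℝ) :
    Integrable (fun s => Real.exp (x * s) * pairMoment b 2 s) ∧
    ∫ s, Real.exp (x * s) * pairMoment b 2 s =
      2 * (truncMoment b 2 x * truncMoment b 0 x - truncMoment b 1 x ^ 2) := by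
  have i := fun j => integrable_pow_mul_exp_mul_weight b j x
  have e : ∀ z : ℝ × ℝ, (z.2 - z.1) ^ 2 * Real.exp (x * (z.1 + z.2)) *
      (truncWeight b z.2 * truncWeight b z.1) =
      ((z.1 ^ 0 * Real.exp (x * z.1) * truncWeight b z.1) *
      (z.2 ^ 2 * Real.exp (x * z.2) * truncWeight b z.2) +
      (z.1 ^ 2 * Real.exp (x * z.1) * truncWeight b z.1) *
      (z.2 ^ 0 * Real.exp (x * z.2) * truncWeight b z.2)) -
      2 * ((z.1 ^ 1 * Real.exp (x * z.1) * truncWeight b z.1) *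
      (z.2 ^ 1 * Real.exp (x * z.2) * truncWeight b z.2)) := by
    intro z; rw [mul_add, Real.exp_add]; ring
  have h02 := (i 0).mul_prod (i 2)
  have h20 := (i 2).mul_prod (i 0)
  have h11 := ((i 1).mul_prod (i 1)).const_mul 2
  have h := integral_exp_mul_pairMoment b 2 x (((h02.add h20).sub h11).congr
    (Filter.Eventually.of_forall fun z => (e z).symm))
  refine ⟨h.1, h.2.trans ?_⟩
  simp_rw [e]
  have m := fun j k => integral_prod_mul (μ := (volume : Measure ℝ)) (ν := (volume : Measure ℝ))
    (fun u => u ^ j * Real.exp (x * u) * truncWeight b u)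
    (fun u => u ^ k * Real.exp (x * u) * truncWeight b u)
  rw [integral_sub (by exact h02.add h20) h11, integral_add h02 h20, integral_const_mul,
    m 0 2, m 2 0, m 1 1]
  simp_rw [truncMoment_eq_integral_weight hb]
  ring

/-- The variance is half the mean square of the difference of two independent copies; the tilt by
`x` acts on the pair through the sum `s` alone. -/
theorem truncVar_eq {b : ℝ} (hb : 0 < b) (x : ℝ) : truncVar b x =
    (∫ s, Real.exp (x * s) * pairMoment b 2 s) /
      (2 * ∫ s, Real.exp (x * s) * pairMoment b 0 s) := by
  rw [(integral_exp_mul_pairMoment_two hb x).2, (integral_exp_mul_pairMoment_zero hb x).2]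
  have := (truncMoment_zero_pos hb x).ne'
  unfold truncVar truncMean
  field_simp

theorem truncVar_nonneg {b : ℝ} (hb : 0 < b) (x : ℝ) : 0 ≤ truncVar b x := by
  rw [truncVar_eq hb]
  have h : ∀ j, Even j → 0 ≤ ∫ s, Real.exp (x * s) * pairMoment b j s := fun j hj =>
    integral_nonneg fun s => mul_nonneg (Real.exp_pos _).le (pairMoment_nonneg hj b s)
  have := h 0 (by simp)
  have := h 2 (by simp)
  positivity

/-- Since `pairMoment` is even in `s`, the tilt may be symmetrized; the hyperbolic cosine depends on
`|s|` only, as the Chebyshev argument requires. -/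
theorem integral_pairMoment_mul_cosh {b x : ℝ} {j : ℕ}
    (h : ∀ x, Integrable fun s => Real.exp (x * s) * pairMoment b j s) :
    Integrable (fun s => pairMoment b j s * Real.cosh (x * s)) ∧
    ∫ s, pairMoment b j s * Real.cosh (x * s) = ∫ s, Real.exp (x * s) * pairMoment b j s := by
  have e : ∀ s, pairMoment b j s * Real.cosh (x * s) =
      2⁻¹ * (Real.exp (x * s) * pairMoment b j s) +
      2⁻¹ * (Real.exp (-x * s) * pairMoment b j s) := by
    intro s; rw [Real.cosh_eq]; ring_nf
  have e2 : ∫ s, Real.exp (-x * s) * pairMoment b j s =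
      ∫ s, Real.exp (x * s) * pairMoment b j s := by
    rw [← integral_neg_eq_self]
    congr 1; ext s
    rw [pairMoment_neg]; ring_nf
  have i1 := (h x).const_mul 2⁻¹
  have i2 := (h (-x)).const_mul 2⁻¹
  refine ⟨(i1.add i2).congr (Filter.Eventually.of_forall fun s => (e s).symm), ?_⟩
  simp_rw [e]
  rw [integral_add i1 i2, integral_const_mul, integral_const_mul, e2]
  ring

/-- The variance of the tilted truncated Gaussian decreases with the size of the tilt. -/
theorem truncVar_le_of_abs_le {b : ℝ} (hb : 0 < b) {x y : ℝ} (hxy : |x| ≤ |y|) :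
    truncVar b y ≤ truncVar b x := by
  have p0 := fun x => (integral_exp_mul_pairMoment_zero hb x).1
  have p2 := fun x => (integral_exp_mul_pairMoment_two hb x).1
  have pos : ∀ x, 0 < ∫ s, Real.exp (x * s) * pairMoment b 0 s := by
    intro x
    rw [(integral_exp_mul_pairMoment_zero hb x).2]
    have := truncMoment_zero_pos hb x
    positivity
  rw [truncVar_eq hb, truncVar_eq hb, div_le_div_iff₀ (by linarith [pos y]) (by linarith [pos x])]
  have c0 := fun x => integral_pairMoment_mul_cosh (x := x) p0
  have c2 := fun x => integral_pairMoment_mul_cosh (x := x) p2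
  -- As functions of `|s|`, the ratio of `pairMoment b 2` to `pairMoment b 0` decreases while `cosh
  -- (y s) / cosh (x s)` increases, so the larger tilt favours the smaller conditional variances.
  have key := integral_mul_integral_le_of_opposite (c2 y).1 (c0 x).1 (c2 x).1 (c0 y).1 ?_
  · rw [(c2 y).2, (c2 x).2, (c0 y).2, (c0 x).2] at key
    linarith
  · intro s r
    rcases le_total |r| |s| with h | h
    · have h1 := pairMoment_two_mul_zero_le b h
      have h2 := cosh_mul_cosh_le hxy h
      exact mul_nonpos_of_nonpos_of_nonneg (by linarith) (by linarith)
    · have h1 := pairMoment_two_mul_zero_le b h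
      have h2 := cosh_mul_cosh_le hxy h
      exact mul_nonpos_of_nonneg_of_nonpos (by linarith) (by linarith)

/-! ### Even convex potentials whose stiffness grows away from the origin -/

/-- An even potential `W` with `W' = W₁`, `W'' = W₂ ∈ [0, 1]`, where `W₂` is nondecreasing in the
distance from the origin. -/
structure IsStiffening (W W₁ W₂ : ℝ → ℝ) : Prop where
  hasDerivAt : ∀ x, HasDerivAt W (W₁ x) x
  hasDerivAt' : ∀ x, HasDerivAt W₁ (W₂ x) x
  even : ∀ x, W (-x) = W x
  nonneg : ∀ x, 0 ≤ W₂ x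
  le_one : ∀ x, W₂ x ≤ 1
  mono : ∀ x y, |x| ≤ |y| → W₂ x ≤ W₂ y
  cont : Continuous W₂
  integrable : Integrable fun x => Real.exp (-W x)

namespace IsStiffening

variable {W W₁ W₂ : ℝ → ℝ}

theorem continuous (h : IsStiffening W W₁ W₂) : Continuous W :=
  continuous_iff_continuousAt.2 fun x => (h.hasDerivAt x).continuousAt

theorem continuous' (h : IsStiffening W W₁ W₂) : Continuous W₁ :=
  continuous_iff_continuousAt.2 fun x => (h.hasDerivAt' x).continuousAt

theorem monotone_deriv (h : IsStiffening W W₁ W₂) : Monotone W₁ :=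
  monotone_of_hasDerivAt_nonneg h.hasDerivAt' h.nonneg

theorem deriv_zero (h : IsStiffening W W₁ W₂) : W₁ 0 = 0 := by
  have h1 : HasDerivAt (fun x => W (-x)) (-W₁ 0) 0 := by
    exact ((h.hasDerivAt (-0)).comp (0 : ℝ) (hasDerivAt_neg (0 : ℝ))).congr_deriv (by simp)
  simp_rw [h.even] at h1
  have := h1.unique (h.hasDerivAt 0)
  linarith

theorem monotoneOn (h : IsStiffening W W₁ W₂) : MonotoneOn W (Ici 0) := by
  refine monotoneOn_of_deriv_nonneg (convex_Ici 0) h.continuous.continuousOn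
    (fun x _ => (h.hasDerivAt x).differentiableAt.differentiableWithinAt) fun x hx => ?_
  rw [(h.hasDerivAt x).deriv, ← h.deriv_zero]
  rw [interior_Ici, mem_Ioi] at hx
  exact h.monotone_deriv hx.le

theorem le_of_abs_le (h : IsStiffening W W₁ W₂) {x y : ℝ} (hxy : |x| ≤ |y|) : W x ≤ W y := by
  have e : ∀ x, W |x| = W x := by
    intro x
    rcases abs_cases x with ⟨h', -⟩ | ⟨h', -⟩ <;> rw [h']
    exact h.even x
  rw [← e x, ← e y]
  exact h.monotoneOn (abs_nonneg x) (abs_nonneg y) hxy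

theorem sub_nonneg_of_nonneg (h : IsStiffening W W₁ W₂) {z m : ℝ} (hz : 0 ≤ z) (hm : 0 ≤ m) :
    0 ≤ W (m + z) - W (m - z) := by
  refine sub_nonneg.2 (h.le_of_abs_le ?_)
  rw [abs_of_nonneg (by linarith : 0 ≤ m + z), abs_le]
  constructor <;> linarith

/-- The second derivative in `m` is `W₂ (m + z) - W₂ (m - z)`, nonnegative because `|m - z| ≤ m +
z`. This is where the growth of the stiffness enters. -/
theorem convexOn_sub (h : IsStiffening W W₁ W₂) {z : ℝ} (hz : 0 ≤ z) :
    ConvexOn ℝ (Ici 0) fun m => W (m + z) - W (m - z) := by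
  have d1 : ∀ m, HasDerivAt (fun m => W (m + z) - W (m - z)) (W₁ (m + z) - W₁ (m - z)) m :=
    fun m => ((h.hasDerivAt _).comp_add_const m z).sub ((h.hasDerivAt _).comp_sub_const m z)
  have d2 : ∀ m, HasDerivAt (fun m => W₁ (m + z) - W₁ (m - z)) (W₂ (m + z) - W₂ (m - z)) m :=
    fun m => ((h.hasDerivAt' _).comp_add_const m z).sub ((h.hasDerivAt' _).comp_sub_const m z)
  have e1 : deriv (fun m => W (m + z) - W (m - z)) = fun m => W₁ (m + z) - W₁ (m - z) :=
    funext fun m => (d1 m).deriv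
  refine convexOn_of_deriv2_nonneg (convex_Ici 0)
    (fun m _ => (d1 m).continuousAt.continuousWithinAt)
    (fun m _ => (d1 m).differentiableAt.differentiableWithinAt)
    (fun m _ => ?_) fun m hm => ?_
  · rw [e1]; exact (d2 m).differentiableAt.differentiableWithinAt
  · rw [Function.iterate_succ, Function.iterate_one, Function.comp_apply, e1, (d2 m).deriv]
    rw [interior_Ici, mem_Ioi] at hm
    refine sub_nonneg.2 (h.mono _ _ ?_)
    rw [abs_of_nonneg (by linarith : 0 ≤ m + z), abs_le]
    constructor <;> linarith

/-- A convex function on `[0, ∞)` vanishing at the origin has nondecreasing slope from the origin;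
the vanishing at `m = 0` is the evenness of `W`. -/
theorem mul_sub_le_mul_sub (h : IsStiffening W W₁ W₂) {z s t : ℝ} (hz : 0 ≤ z) (hs : 0 ≤ s)
    (hst : s ≤ t) : t * (W (s + z) - W (s - z)) ≤ s * (W (t + z) - W (t - z)) := by
  rcases (hs.trans hst).eq_or_lt with ht | ht
  · have : s = 0 := by linarith
    subst this; rw [← ht]
  · have key := (h.convexOn_sub hz).2 (mem_Ici.2 ht.le) (mem_Ici.2 (le_refl (0 : ℝ)))
      (show 0 ≤ s / t by positivity)
      (show 0 ≤ 1 - s / t by rw [sub_nonneg, div_le_one ht]; exact hst) (by ring)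
    simp only [smul_eq_mul, mul_zero, add_zero, zero_add, zero_sub, h.even, sub_self] at key
    rw [div_mul_cancel₀ _ ht.ne', div_mul_eq_mul_div, le_div_iff₀ ht] at key
    linarith

theorem sub_reflect (h : IsStiffening W W₁ W₂) (z m : ℝ) :
    W (-m + z) - W (-m - z) = -(W (m + z) - W (m - z)) := by
  rw [← h.even (-m + z), ← h.even (-m - z), neg_sub]
  ring_nf

/-- Let `D m = W (m + z) - W (m - z)`, an odd function with `D m / m` nondecreasing for `m > 0`. For
`M ≥ a` this gives `M D(M - a) ≤ (M - a) D(M)`, and `(n + 1)(M - a) ≤ n M` is exactly the hypothesis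
on `M`. For smaller `M` the signs and the monotonicity of `D` suffice. The result says that the
weight is larger on the right than at the reflected point on the left. -/
theorem weight_comparison (h : IsStiffening W W₁ W₂) {n a M z : ℝ} (hn : 0 ≤ n) (ha : 0 ≤ a)
    (hz : 0 ≤ z) (hM : M ≤ (n + 1) * a) :
    (n + 1) * (W (M - a + z) - W (M - a - z)) ≤ n * (W (M + z) - W (M - z)) := by
  rcases lt_or_ge M 0 with hM0 | hM0
  · have h1 := h.mul_sub_le_mul_sub hz (s := -M) (t := a - M) (by linarith) (by linarith)
    have e1 := h.sub_reflect z (-M)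
    have e2 := h.sub_reflect z (a - M)
    have h2 := h.sub_nonneg_of_nonneg hz (m := -M) (by linarith)
    have h3 := h.sub_nonneg_of_nonneg hz (m := a - M) (by linarith)
    rw [neg_neg] at e1
    rw [neg_sub] at e2
    rw [e1, e2]
    set p := W (-M + z) - W (-M - z)
    set q := W (a - M + z) - W (a - M - z)
    have hpq : p ≤ q := by
      by_contra hlt
      push Not at hlt
      nlinarith
    nlinarith
  · rcases lt_or_ge M a with hMa | hMa
    · have e2 := h.sub_reflect z (a - M)
      have h2 := h.sub_nonneg_of_nonneg hz hM0
      have h3 := h.sub_nonneg_of_nonneg hz (m := a - M) (by linarith)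
      rw [neg_sub] at e2
      rw [e2]
      nlinarith [mul_nonneg hn h2]
    · have h1 := h.mul_sub_le_mul_sub hz (s := M - a) (t := M) (by linarith) (by linarith)
      have h2 := h.sub_nonneg_of_nonneg hz hM0
      rcases hM0.eq_or_lt with h0 | h0
      · have : a = 0 := by linarith
        subst this; rw [← h0]; simp [h.even]
      · set p := W (M - a + z) - W (M - a - z)
        set q := W (M + z) - W (M - z)
        have : M * ((n + 1) * p) ≤ M * (n * q) := by nlinarith
        exact le_of_mul_le_mul_left this h0

/-! ### Integral form of the exponent and its growth in the shift -/

/-- The increment of the exponent of the weight below, relative to `a = 0`. -/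
def increment (W : ℝ → ℝ) (n a y : ℝ) : ℝ := n * W (y + (n + 1) * a) - (n + 1) * W (y + n * a) + W y

/-- The weight `exp (n W(x) - (n+1) W(x - a))` in the coordinate `y = x - (n+1) a`. -/
def weight (W : ℝ → ℝ) (n a y : ℝ) : ℝ :=
  Real.exp (n * W (y + (n + 1) * a) - (n + 1) * W (y + n * a))

theorem continuous_increment (h : IsStiffening W W₁ W₂) (n a : ℝ) :
    Continuous (increment W n a) := by
  have := h.continuous
  unfold increment
  fun_prop

theorem continuous_weight (h : IsStiffening W W₁ W₂) (n a : ℝ) :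
    Continuous (weight W n a) := by
  have := h.continuous
  unfold weight
  fun_prop

/-- The measure on the parameters `(t, r)` in the integral formula for the increment. -/
def parMeasure (n : ℝ) : Measure (ℝ × ℝ) :=
  (volume.restrict (Ioc (0 : ℝ) 1)).prod (volume.restrict (Ioc n (n + 1)))

instance (n : ℝ) : IsFiniteMeasure (parMeasure n) := by
  unfold parMeasure; infer_instance

theorem ae_parMeasure (n : ℝ) : ∀ᵐ z ∂parMeasure n, z ∈ Ioc (0 : ℝ) 1 ×ˢ Ioc n (n + 1) := by
  unfold parMeasure
  rw [Measure.prod_restrict]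
  exact ae_restrict_mem (measurableSet_Ioc.prod measurableSet_Ioc)

theorem integrable_parMeasure (h : IsStiffening W W₁ W₂) (n a y : ℝ) :
    Integrable (fun z : ℝ × ℝ => z.1 * W₂ (y + z.2 * z.1 * a)) (parMeasure n) := by
  have hc := h.cont
  refine (integrable_const (1 : ℝ)).mono' (Continuous.aestronglyMeasurable (by fun_prop)) ?_
  filter_upwards [ae_parMeasure n] with z hz
  rw [Real.norm_eq_abs, abs_mul, abs_of_nonneg (h.nonneg _), abs_of_nonneg hz.1.1.le]
  exact mul_le_one₀ hz.1.2 (h.nonneg _) (h.le_one _)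

/-- The coefficients `n`, `-(n+1)`, `1` at `y + (n+1)a`, `y + n a`, `y` annihilate affine functions,
so only `W''` remains. In this form a scaling of `a` produces its square as a factor and otherwise
only moves the points at which `W''` is read. -/
theorem increment_eq (h : IsStiffening W W₁ W₂) (n a y : ℝ) : increment W n a y =
    n * (n + 1) * a ^ 2 * ∫ z, z.1 * W₂ (y + z.2 * z.1 * a) ∂parMeasure n := by
  have hi := h.integrable_parMeasure n a y
  have hc := h.cont
  have hc' := h.continuous'
  have inner : ∀ t : ℝ, a * ∫ r in n..(n + 1), t * W₂ (y + r * t * a) =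
      W₁ (y + (n + 1) * t * a) - W₁ (y + n * t * a) := by
    intro t
    have hd : ∀ r, HasDerivAt (fun r => W₁ (y + r * t * a)) (a * (t * W₂ (y + r * t * a))) r := by
      intro r
      have h1 : HasDerivAt (fun r : ℝ => y + r * t * a) (t * a) r := by
        simpa using (((hasDerivAt_id r).mul_const t).mul_const a).const_add y
      exact ((h.hasDerivAt' _).comp r h1).congr_deriv (by ring)
    rw [← intervalIntegral.integral_const_mul]
    exact intervalIntegral.integral_eq_sub_of_hasDerivAt (fun r _ => hd r)
      (Continuous.intervalIntegrable (by fun_prop) _ _)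
  have outer : ∫ t in (0 : ℝ)..1, n * (n + 1) * a *
      (W₁ (y + (n + 1) * t * a) - W₁ (y + n * t * a)) = increment W n a y := by
    have hd : ∀ t, HasDerivAt (fun t => n * W (y + (n + 1) * t * a) - (n + 1) * W (y + n * t * a))
        (n * (n + 1) * a * (W₁ (y + (n + 1) * t * a) - W₁ (y + n * t * a))) t := by
      intro t
      have h1 : ∀ c : ℝ, HasDerivAt (fun t : ℝ => y + c * t * a) (c * a) t := by
        intro c
        simpa using (((hasDerivAt_id t).const_mul c).mul_const a).const_add y
      exact ((((h.hasDerivAt _).comp t (h1 (n + 1))).const_mul n).sub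
        (((h.hasDerivAt _).comp t (h1 n)).const_mul (n + 1))).congr_deriv (by ring)
    rw [intervalIntegral.integral_eq_sub_of_hasDerivAt (fun r _ => hd r)
      (Continuous.intervalIntegrable (by fun_prop) _ _)]
    unfold increment
    simp only [mul_one, mul_zero, zero_mul, add_zero]
    ring
  rw [← outer, parMeasure, integral_prod _ hi, intervalIntegral.integral_of_le zero_le_one,
    integral_const_mul, show n * (n + 1) * a ^ 2 = n * (n + 1) * a * a by ring,
    mul_assoc (n * (n + 1) * a) a, ← integral_const_mul a]
  congr 1
  refine integral_congr_ae (Filter.Eventually.of_forall fun t => ?_)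
  simp only
  rw [← inner t, intervalIntegral.integral_of_le (by linarith)]

theorem increment_nonneg (h : IsStiffening W W₁ W₂) {n : ℝ} (hn : 0 ≤ n) (a y : ℝ) :
    0 ≤ increment W n a y := by
  rw [h.increment_eq]
  refine mul_nonneg (by positivity) (integral_nonneg_of_ae ?_)
  filter_upwards [ae_parMeasure n] with z hz
  exact mul_nonneg hz.1.1.le (h.nonneg _)

theorem increment_le (h : IsStiffening W W₁ W₂) {n : ℝ} (hn : 0 ≤ n) (a y : ℝ) :
    increment W n a y ≤ n * (n + 1) * a ^ 2 := by
  rw [h.increment_eq]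
  refine mul_le_of_le_one_right (by positivity) ?_
  have : ∫ z, z.1 * W₂ (y + z.2 * z.1 * a) ∂parMeasure n ≤ ∫ _, (1 : ℝ) ∂parMeasure n := by
    refine integral_mono_ae (h.integrable_parMeasure n a y) (integrable_const _) ?_
    filter_upwards [ae_parMeasure n] with z hz
    exact mul_le_one₀ hz.1.2 (h.nonneg _) (h.le_one _)
  refine this.trans ?_
  rw [integral_const, parMeasure, Measure.real, ← univ_prod_univ, Measure.prod_prod]
  simp

theorem weight_eq (n a y : ℝ) : weight W n a y = Real.exp (-W y) * Real.exp (increment W n a y) := by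
  unfold weight increment
  rw [← Real.exp_add]
  ring_nf

theorem integrable_weight_mul (h : IsStiffening W W₁ W₂) {n : ℝ} (hn : 0 ≤ n) (a : ℝ)
    {g : ℝ → ℝ} (hg : Continuous g) {C : ℝ} (hC : ∀ y, |g y| ≤ C) :
    Integrable fun y => weight W n a y * g y := by
  have hw := h.continuous_weight n a
  refine (h.integrable.mul_const (Real.exp (n * (n + 1) * a ^ 2) * C)).mono'
    (Continuous.aestronglyMeasurable (by fun_prop)) (Filter.Eventually.of_forall fun y => ?_)
  rw [norm_mul, Real.norm_eq_abs, Real.norm_eq_abs, weight_eq, abs_mul, Real.abs_exp, Real.abs_exp,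
    mul_assoc]
  have := h.increment_le hn a y
  have := hC y
  gcongr

theorem integrable_weight (h : IsStiffening W W₁ W₂) {n : ℝ} (hn : 0 ≤ n) (a : ℝ) :
    Integrable (weight W n a) := by
  simpa using h.integrable_weight_mul hn a (continuous_const (y := (1 : ℝ))) (C := 1) (by simp)

theorem integral_weight_pos (h : IsStiffening W W₁ W₂) {n : ℝ} (hn : 0 ≤ n) (a : ℝ) :
    0 < ∫ y, weight W n a y := by
  refine (integral_pos_iff_support_of_nonneg (fun y => (Real.exp_pos _).le)
    (h.integrable_weight hn a)).2 ?_
  rw [Function.support_eq_univ fun y => (Real.exp_pos _).ne']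
  simp

/-- Under the weight, the stiffness increases along the direction of the shift. -/
theorem integral_weight_mul_sub_nonneg (h : IsStiffening W W₁ W₂) {n a β β' : ℝ} (hn : 0 ≤ n)
    (ha : 0 ≤ a) (hβ : β ≤ β') (hββ : 0 ≤ β + β') :
    0 ≤ ∫ y, weight W n a y * (W₂ (y + β') - W₂ (y + β)) := by
  -- About the midpoint `y₀` the difference of the two values of `W₂` is odd and nonnegative on the
  -- right half-line. It remains to compare the weight at reflected points.
  set δ := (β' - β) / 2 with hδ
  set y₀ := -(β + β') / 2 with hy₀
  have hδ0 : 0 ≤ δ := by rw [hδ]; linarith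
  set g : ℝ → ℝ := fun z => weight W n a (z + y₀) * (W₂ (z + δ) - W₂ (z - δ)) with hg
  have hc := h.cont
  have even2 : ∀ x, W₂ (-x) = W₂ x := fun x =>
    le_antisymm (h.mono _ _ (abs_neg x).le) (h.mono _ _ (abs_neg x).ge)
  have e1 : ∫ y, weight W n a y * (W₂ (y + β') - W₂ (y + β)) = ∫ z, g z := by
    rw [← integral_add_right_eq_self _ y₀]
    congr 1; ext z
    simp only [hg]
    rw [show z + y₀ + β' = z + δ by rw [hy₀, hδ]; ring, show z + y₀ + β = z - δ by
      rw [hy₀, hδ]; ring]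
  have gi : Integrable g := by
    have := h.integrable_weight_mul hn a (g := fun y => W₂ (y + β') - W₂ (y + β)) (by fun_prop)
      (C := 1) (fun y => abs_le.2 ⟨by linarith [h.nonneg (y + β'), h.le_one (y + β)],
        by linarith [h.le_one (y + β'), h.nonneg (y + β)]⟩)
    have := this.comp_add_right y₀
    refine this.congr (Filter.Eventually.of_forall fun z => ?_)
    simp only [hg]
    rw [show z + y₀ + β' = z + δ by rw [hy₀, hδ]; ring, show z + y₀ + β = z - δ by
      rw [hy₀, hδ]; ring]
  have odd : ∀ z, W₂ (-z + δ) - W₂ (-z - δ) = -(W₂ (z + δ) - W₂ (z - δ)) := by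
    intro z
    rw [← even2 (-z + δ), ← even2 (-z - δ)]
    ring_nf
  have cmp : ∀ z, 0 ≤ z → weight W n a (-z + y₀) ≤ weight W n a (z + y₀) := by
    intro z hz
    -- The condition `M ≤ (n + 1) * a` for this `M` says `y₀ ≤ 0`, that is, `0 ≤ β + β'`.
    have := h.weight_comparison hn ha hz (M := y₀ + (n + 1) * a) (by rw [hy₀]; linarith)
    unfold weight
    refine Real.exp_le_exp.2 ?_
    rw [show y₀ + (n + 1) * a - a + z = z + y₀ + n * a by ring,
      show y₀ + (n + 1) * a - a - z = -z + y₀ + n * a by ring,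
      show y₀ + (n + 1) * a + z = z + y₀ + (n + 1) * a by ring,
      show y₀ + (n + 1) * a - z = -z + y₀ + (n + 1) * a by ring] at this
    linarith
  have sgnδ : ∀ z, 0 ≤ z → 0 ≤ W₂ (z + δ) - W₂ (z - δ) := by
    intro z hz
    refine sub_nonneg.2 (h.mono _ _ ?_)
    rw [abs_of_nonneg (by linarith : 0 ≤ z + δ), abs_le]
    constructor <;> linarith
  have main : ∀ z, 0 ≤ z → 0 ≤ g z + g (-z) := by
    intro z hz
    simp only [hg]
    rw [odd]
    nlinarith [mul_nonneg (sub_nonneg.2 (cmp z hz)) (sgnδ z hz)]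
  have e2 : ∫ z, g z + g (-z) = 2 * ∫ z, g z := by
    rw [integral_add gi gi.comp_neg, integral_neg_eq_self]
    ring
  have : 0 ≤ ∫ z, g z + g (-z) := by
    refine integral_nonneg fun z => ?_
    rcases le_total 0 z with hz | hz
    · exact main z hz
    · have := main (-z) (by linarith)
      rw [neg_neg] at this
      simp only [Pi.zero_apply]
      linarith
  rw [e1]
  linarith

/-- The factor `l²` cancels against the prefactor in `increment_eq`. By Fubini what is left is, for
each `(t, r)`, the weighted mean of `W₂` at a shift `l r t a` minus that at `r t a`. -/
theorem integral_weight_mul_increment_le (h : IsStiffening W W₁ W₂) {n a l : ℝ} (hn : 0 ≤ n)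
    (ha : 0 ≤ a) (hl : 1 ≤ l) :
    l ^ 2 * ∫ y, weight W n a y * increment W n a y ≤
      ∫ y, weight W n a y * increment W n (l * a) y := by
  have hc := h.cont
  have hw := h.continuous_weight n a
  have bd : ∀ a y, |increment W n a y| ≤ n * (n + 1) * a ^ 2 := fun a y => by
    rw [abs_of_nonneg (h.increment_nonneg hn a y)]; exact h.increment_le hn a y
  have i1 := h.integrable_weight_mul hn a (h.continuous_increment n a) (bd a)
  have i2 := h.integrable_weight_mul hn a (h.continuous_increment n (l * a)) (bd (l * a))
  have hprod : Integrable (Function.uncurry fun (y : ℝ) (z : ℝ × ℝ) => weight W n a y *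
      (z.1 * (W₂ (y + z.2 * z.1 * (l * a)) - W₂ (y + z.2 * z.1 * a))))
      (volume.prod (parMeasure n)) := by
    refine ((h.integrable_weight hn a).mul_prod (integrable_const (1 : ℝ))).mono'
      (Continuous.aestronglyMeasurable (by unfold Function.uncurry; fun_prop)) ?_
    have : ∀ᵐ p : ℝ × ℝ × ℝ ∂(volume.prod (parMeasure n)), p.2 ∈ Ioc (0 : ℝ) 1 ×ˢ Ioc n (n + 1) :=
      Measure.quasiMeasurePreserving_snd.ae (ae_parMeasure n)
    filter_upwards [this] with p hp
    have w0 : 0 ≤ weight W n a p.1 := (Real.exp_pos _).le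
    simp only [Function.uncurry, norm_mul, Real.norm_eq_abs]
    rw [abs_of_nonneg w0, abs_of_nonneg hp.1.1.le]
    refine mul_le_mul_of_nonneg_left (mul_le_one₀ hp.1.2 (abs_nonneg _) ?_) w0
    have n1 := h.nonneg (p.1 + p.2.2 * p.2.1 * (l * a))
    have n2 := h.nonneg (p.1 + p.2.2 * p.2.1 * a)
    have l1 := h.le_one (p.1 + p.2.2 * p.2.1 * (l * a))
    have l2 := h.le_one (p.1 + p.2.2 * p.2.1 * a)
    exact abs_le.2 ⟨by linarith, by linarith⟩
  rw [← sub_nonneg, ← integral_const_mul, ← integral_sub i2 (i1.const_mul _)]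
  have e : ∀ y, weight W n a y * increment W n (l * a) y -
      l ^ 2 * (weight W n a y * increment W n a y) = (n * (n + 1) * (l * a) ^ 2) *
      ∫ z, weight W n a y *
        (z.1 * (W₂ (y + z.2 * z.1 * (l * a)) - W₂ (y + z.2 * z.1 * a))) ∂parMeasure n := by
    intro y
    rw [h.increment_eq, h.increment_eq, integral_const_mul]
    simp_rw [mul_sub]
    rw [integral_sub (h.integrable_parMeasure n (l * a) y) (h.integrable_parMeasure n a y)]
    ring
  simp_rw [e]
  rw [integral_const_mul, integral_integral_swap hprod]
  refine mul_nonneg (by positivity) (integral_nonneg_of_ae ?_)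
  filter_upwards [ae_parMeasure n] with z hz
  have hz2 : 0 ≤ z.2 * z.1 * a := mul_nonneg (mul_nonneg (hn.trans hz.2.1.le) hz.1.1.le) ha
  have key := h.integral_weight_mul_sub_nonneg hn ha (β := z.2 * z.1 * a)
    (β' := z.2 * z.1 * (l * a)) (by nlinarith) (by nlinarith)
  have e2 : ∀ y, weight W n a y *
      (z.1 * (W₂ (y + z.2 * z.1 * (l * a)) - W₂ (y + z.2 * z.1 * a))) = z.1 *
      (weight W n a y * (W₂ (y + z.2 * z.1 * (l * a)) - W₂ (y + z.2 * z.1 * a))) :=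
    fun y => by ring
  simp only [Pi.zero_apply]
  simp_rw [e2]
  rw [integral_const_mul]
  exact mul_nonneg hz.1.1.le key

/-- Jensen's inequality for the exponential and an unnormalized weight. -/
theorem integral_mul_exp_integral_div_le {α : Type*} [MeasurableSpace α] {μ : Measure α}
    {w t : α → ℝ} (hw0 : ∀ y, 0 ≤ w y) (hw : Integrable w μ)
    (hpos : 0 < ∫ y, w y ∂μ) (hwt : Integrable (fun y => w y * t y) μ)
    (hwe : Integrable (fun y => w y * Real.exp (t y)) μ) :
    (∫ y, w y * t y ∂μ) / (∫ y, w y ∂μ) ≤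
      Real.log (∫ y, w y * Real.exp (t y) ∂μ) - Real.log (∫ y, w y ∂μ) := by
  set I := ∫ y, w y ∂μ
  set m := (∫ y, w y * t y ∂μ) / I with hm
  have key : I * Real.exp m ≤ ∫ y, w y * Real.exp (t y) ∂μ := by
    have h1 : ∫ y, Real.exp m * ((1 - m) * w y + w y * t y) ∂μ ≤
        ∫ y, w y * Real.exp (t y) ∂μ := by
      refine integral_mono (((hw.const_mul _).add hwt).const_mul _) hwe fun y => ?_
      have h2 : t y - m + 1 ≤ Real.exp (t y - m) := Real.add_one_le_exp _
      have h3 : Real.exp (t y) = Real.exp m * Real.exp (t y - m) := by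
        rw [← Real.exp_add]; ring_nf
      simp only
      rw [h3]
      have := mul_le_mul_of_nonneg_left h2 (mul_nonneg (hw0 y) (Real.exp_pos m).le)
      linarith
    rw [integral_const_mul, integral_add (hw.const_mul _) hwt, integral_const_mul] at h1
    have h4 : ∫ y, w y * t y ∂μ = m * I := by rw [hm, div_mul_cancel₀ _ hpos.ne']
    rw [h4] at h1
    linarith
  have := Real.log_le_log (by positivity) key
  rw [Real.log_mul hpos.ne' (Real.exp_pos _).ne', Real.log_exp] at this
  linarith

/-- The logarithm of the integral of the weight grows at least quadratically in the shift. -/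
theorem sq_mul_log_le (h : IsStiffening W W₁ W₂) {n a l : ℝ} (hn : 0 ≤ n)
    (ha : 0 ≤ a) (hl : 1 ≤ l) :
    l ^ 2 * (Real.log (∫ y, weight W n a y) - Real.log (∫ y, Real.exp (-W y))) ≤
      Real.log (∫ y, weight W n (l * a) y) - Real.log (∫ y, Real.exp (-W y)) := by
  have bd : ∀ a y, |increment W n a y| ≤ n * (n + 1) * a ^ 2 := fun a y => by
    rw [abs_of_nonneg (h.increment_nonneg hn a y)]; exact h.increment_le hn a y
  have ci := fun a => h.continuous_increment n a
  have i1 := h.integrable_weight_mul hn a (ci a) (bd a)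
  have i2 := h.integrable_weight_mul hn a (ci (l * a)) (bd (l * a))
  have w0 : ∀ y, 0 ≤ weight W n a y := fun y => (Real.exp_pos _).le
  have hI := h.integral_weight_pos hn a
  have e1 : ∀ y, weight W n a y * Real.exp (increment W n (l * a) y - increment W n a y) =
      weight W n (l * a) y := by
    intro y; rw [weight_eq, weight_eq, mul_assoc, ← Real.exp_add]; ring_nf
  have e2 : ∀ y, weight W n a y * Real.exp (-increment W n a y) = Real.exp (-W y) := by
    intro y; rw [weight_eq, mul_assoc, ← Real.exp_add]; simp
  -- Jensen's inequality under the weight at `a`, in two directions: towards `l * a` it bounds the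
  -- gain in the logarithm from below, and back towards `a = 0` it bounds the logarithm at `a` from
  -- above by the mean `q` of the increment. With `p ≥ l² q`, the gain is at least `(l² - 1) q`.
  have j1 := integral_mul_exp_integral_div_le (t := fun y => increment W n (l * a) y -
    increment W n a y) w0 (h.integrable_weight hn a) hI
    ((i2.sub i1).congr (Filter.Eventually.of_forall fun y => by simp; ring))
    ((h.integrable_weight hn (l * a)).congr (Filter.Eventually.of_forall fun y => (e1 y).symm))
  have j2 := integral_mul_exp_integral_div_le (t := fun y => -increment W n a y)
    w0 (h.integrable_weight hn a) hI
    (i1.neg.congr (Filter.Eventually.of_forall fun y => by simp))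
    (h.integrable.congr (Filter.Eventually.of_forall fun y => (e2 y).symm))
  have k := h.integral_weight_mul_increment_le hn ha hl
  simp_rw [e1, mul_sub] at j1
  simp_rw [e2, mul_neg] at j2
  rw [integral_sub i2 i1, sub_div] at j1
  rw [integral_neg, neg_div] at j2
  have k2 := div_le_div_of_nonneg_right k hI.le
  rw [mul_div_assoc] at k2
  set q := (∫ y, weight W n a y * increment W n a y) / ∫ y, weight W n a y
  set p := (∫ y, weight W n a y * increment W n (l * a) y) / ∫ y, weight W n a y
  have : 0 ≤ l ^ 2 - 1 := by nlinarith
  nlinarith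

end IsStiffening

/-! ### The Gaussian convolved with the uniform law on an interval -/

/-- The convolution of `exp (-x² / 2)` with the indicator of `[-b, b]`. -/
def boxDensity (b x : ℝ) : ℝ := ∫ u in (-b)..b, Real.exp (-(x - u) ^ 2 / 2)

/-- Minus the logarithm of `boxDensity`. -/
def boxPotential (b x : ℝ) : ℝ := x ^ 2 / 2 - Real.log (truncMoment b 0 x)

theorem boxDensity_eq (b x : ℝ) : boxDensity b x = Real.exp (-x ^ 2 / 2) * truncMoment b 0 x := by
  unfold boxDensity truncMoment
  rw [← intervalIntegral.integral_const_mul]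
  congr 1; ext u
  rw [pow_zero, one_mul, ← Real.exp_add]
  ring_nf

theorem exp_neg_boxPotential {b : ℝ} (hb : 0 < b) (x : ℝ) :
    Real.exp (-boxPotential b x) = boxDensity b x := by
  unfold boxPotential
  rw [boxDensity_eq, neg_sub, sub_eq_add_neg, Real.exp_add, Real.exp_log (truncMoment_zero_pos hb x),
    mul_comm]
  ring_nf

theorem boxDensity_pos {b : ℝ} (hb : 0 < b) (x : ℝ) : 0 < boxDensity b x := by
  rw [← exp_neg_boxPotential hb]; positivity

theorem integrable_exp_abs_sub_sq (K : ℝ) :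
    Integrable fun x : ℝ => Real.exp (K * |x| - x ^ 2 / 2) := by
  refine ((integrable_exp_neg_mul_sq (b := 1 / 4) (by norm_num)).const_mul
    (Real.exp (K ^ 2))).mono' (Continuous.aestronglyMeasurable (by fun_prop))
    (Filter.Eventually.of_forall fun x => ?_)
  rw [Real.norm_eq_abs, Real.abs_exp, ← Real.exp_add, Real.exp_le_exp]
  nlinarith [sq_nonneg (K - |x| / 2), sq_abs x]

theorem integrable_linear_mul_exp (c₁ c₂ K : ℝ) :
    Integrable fun x : ℝ => (c₁ + c₂ * |x|) * Real.exp (K * |x| - x ^ 2 / 2) := by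
  have h : Integrable fun x : ℝ => |x| * Real.exp (K * |x| - x ^ 2 / 2) := by
    refine (integrable_exp_abs_sub_sq (K + 1)).mono'
      (Continuous.aestronglyMeasurable (by fun_prop)) (Filter.Eventually.of_forall fun x => ?_)
    rw [norm_mul, Real.norm_eq_abs, Real.norm_eq_abs, abs_abs, Real.abs_exp,
      show (K + 1) * |x| - x ^ 2 / 2 = |x| + (K * |x| - x ^ 2 / 2) by ring, Real.exp_add]
    gcongr
    linarith [Real.add_one_le_exp |x|]
  refine (((integrable_exp_abs_sub_sq K).const_mul c₁).add (h.const_mul c₂)).congr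
    (Filter.Eventually.of_forall fun x => ?_)
  simp only [Pi.add_apply]; ring

theorem truncMoment_zero_le {b : ℝ} (hb : 0 < b) (x : ℝ) :
    truncMoment b 0 x ≤ 2 * b * Real.exp (b * |x|) := by
  have h : truncMoment b 0 x ≤ ∫ _ in (-b)..b, Real.exp (b * |x|) := by
    refine intervalIntegral.integral_mono_on (by linarith)
      (Continuous.intervalIntegrable (by fun_prop) _ _) (by simp) fun u hu => ?_
    rw [pow_zero, one_mul, Real.exp_le_exp]
    have h1 : x * u ≤ |x| * |u| := by rw [← abs_mul]; exact le_abs_self _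
    have h2 : |x| * |u| ≤ |x| * b := mul_le_mul_of_nonneg_left (abs_le.2 hu) (abs_nonneg x)
    nlinarith [sq_nonneg u]
  refine h.trans (le_of_eq ?_)
  rw [intervalIntegral.integral_const, smul_eq_mul]; ring

theorem boxDensity_le {b : ℝ} (hb : 0 < b) (x : ℝ) :
    boxDensity b x ≤ 2 * b * Real.exp (b * |x| - x ^ 2 / 2) := by
  rw [boxDensity_eq, show b * |x| - x ^ 2 / 2 = -x ^ 2 / 2 + b * |x| by ring, Real.exp_add]
  nlinarith [truncMoment_zero_le hb x, Real.exp_pos (-x ^ 2 / 2)]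

theorem continuous_boxDensity (b : ℝ) : Continuous (boxDensity b) := by
  have : boxDensity b = fun x => Real.exp (-x ^ 2 / 2) * truncMoment b 0 x :=
    funext fun x => boxDensity_eq b x
  rw [this]
  have := continuous_truncMoment b 0
  fun_prop

theorem boxDensity_neg (b x : ℝ) : boxDensity b (-x) = boxDensity b x := by
  rw [boxDensity_eq, boxDensity_eq, truncMoment_neg]
  simp

theorem integrable_boxDensity {b : ℝ} (hb : 0 < b) : Integrable (boxDensity b) := by
  refine ((integrable_exp_abs_sub_sq b).const_mul (2 * b)).mono'
    (continuous_boxDensity b).aestronglyMeasurable (Filter.Eventually.of_forall fun x => ?_)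
  rw [Real.norm_eq_abs, abs_of_pos (boxDensity_pos hb x)]
  exact boxDensity_le hb x

theorem isStiffening_boxPotential {b : ℝ} (hb : 0 < b) :
    IsStiffening (boxPotential b) (fun x => x - truncMean b x) (fun x => 1 - truncVar b x) where
  hasDerivAt x := by
    refine (((hasDerivAt_pow 2 x).div_const 2).sub (hasDerivAt_log_truncMoment hb x)).congr_deriv ?_
    simp
  hasDerivAt' x := (hasDerivAt_id x).sub (hasDerivAt_truncMean hb x)
  even x := by simp [boxPotential, truncMoment_neg]
  nonneg x := sub_nonneg.2 (truncVar_le_one hb x)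
  le_one x := by linarith [truncVar_nonneg hb x]
  mono x y h := by linarith [truncVar_le_of_abs_le hb h]
  cont := continuous_const.sub (continuous_truncVar hb)
  integrable := by
    simp_rw [exp_neg_boxPotential hb]
    exact integrable_boxDensity hb

theorem integral_boxDensity {b : ℝ} (hb : 0 < b) :
    ∫ x, boxDensity b x = 2 * b * √(2 * Real.pi) := by
  have hg : Integrable (fun z : ℝ => Real.exp (-z ^ 2 / 2)) := by
    refine (integrable_exp_neg_mul_sq (b := 1 / 2) (by norm_num)).congr
      (Filter.Eventually.of_forall fun x => ?_)
    ring_nf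
  have hi : ∫ z : ℝ, Real.exp (-z ^ 2 / 2) = √(2 * Real.pi) := by
    have := integral_gaussian (1 / 2)
    rw [show Real.pi / (1 / 2) = 2 * Real.pi by ring] at this
    rw [← this]
    congr 1; ext z; ring_nf
  unfold boxDensity
  simp_rw [intervalIntegral.integral_of_le (by linarith : -b ≤ b)]
  have hint : Integrable (Function.uncurry fun x u : ℝ => Real.exp (-(x - u) ^ 2 / 2))
      (volume.prod (volume.restrict (Ioc (-b) b))) := by
    rw [integrable_prod_iff' (Continuous.aestronglyMeasurable
      (by unfold Function.uncurry; fun_prop))]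
    constructor
    · exact Filter.Eventually.of_forall fun u => hg.comp_sub_right u
    · have : ∀ u : ℝ, ∫ x : ℝ, ‖Real.exp (-(x - u) ^ 2 / 2)‖ = √(2 * Real.pi) := by
        intro u
        simp_rw [Real.norm_eq_abs, Real.abs_exp]
        rw [integral_sub_right_eq_self (fun x : ℝ => Real.exp (-x ^ 2 / 2)), hi]
      simp only [Function.uncurry, this]
      exact integrable_const _
  rw [integral_integral_swap hint]
  have : ∀ u : ℝ, ∫ x : ℝ, Real.exp (-(x - u) ^ 2 / 2) = √(2 * Real.pi) := fun u => by
    rw [integral_sub_right_eq_self (fun x : ℝ => Real.exp (-x ^ 2 / 2)), hi]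
  simp_rw [this]
  rw [setIntegral_const, Measure.real, Real.volume_Ioc, ENNReal.toReal_ofReal (by linarith),
    smul_eq_mul]
  ring

/-! ### Dependence of the moments on the half-width -/

/-- The derivative of `boxDensity b x` in `b`. -/
def boxEdge (b x : ℝ) : ℝ := Real.exp (-(x - b) ^ 2 / 2) + Real.exp (-(x + b) ^ 2 / 2)

theorem hasDerivAt_boxDensity_width (b x : ℝ) :
    HasDerivAt (fun b => boxDensity b x) (boxEdge b x) b := by
  have hc : Continuous fun u : ℝ => Real.exp (-(x - u) ^ 2 / 2) := by fun_prop
  have h : ∀ c, HasDerivAt (fun c => ∫ u in (0 : ℝ)..c, Real.exp (-(x - u) ^ 2 / 2))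
      (Real.exp (-(x - c) ^ 2 / 2)) c := fun c =>
    intervalIntegral.integral_hasDerivAt_right (hc.intervalIntegrable _ _)
      (hc.stronglyMeasurableAtFilter _ _) hc.continuousAt
  have e : (fun b => boxDensity b x) = fun b =>
      (∫ u in (0 : ℝ)..b, Real.exp (-(x - u) ^ 2 / 2)) -
      ∫ u in (0 : ℝ)..(-b), Real.exp (-(x - u) ^ 2 / 2) := by
    funext b
    unfold boxDensity
    rw [intervalIntegral.integral_interval_sub_left (hc.intervalIntegrable _ _)
      (hc.intervalIntegrable _ _)]
  rw [e]
  refine ((h b).sub ((h (-b)).comp b (hasDerivAt_neg b))).congr_deriv ?_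
  unfold boxEdge
  rw [sub_neg_eq_add]
  ring

/-- The boundary term of `truncMoment_two_eq` is the edge term up to a Gaussian factor. This turns
differentiation in `b` into quantities that can be integrated by parts in `x`. -/
theorem mul_boxEdge_div {b : ℝ} (hb : 0 < b) (x : ℝ) : b * (boxEdge b x / boxDensity b x) =
    1 - truncVar b x + truncMean b x * (x - truncMean b x) := by
  have h0 := (truncMoment_zero_pos hb x).ne'
  have h1 := truncMoment_one_eq b x
  have h2 := truncMoment_two_eq b x
  have he := (Real.exp_pos (-x ^ 2 / 2)).ne'
  have e : boxEdge b x = Real.exp (-x ^ 2 / 2) *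
      (Real.exp (x * b - b ^ 2 / 2) + Real.exp (-(x * b) - b ^ 2 / 2)) := by
    unfold boxEdge
    rw [mul_add, ← Real.exp_add, ← Real.exp_add]
    ring_nf
  rw [e, boxDensity_eq, mul_div_mul_left _ _ he]
  unfold truncVar truncMean
  generalize Real.exp (x * b - b ^ 2 / 2) = p at *
  generalize Real.exp (-(x * b) - b ^ 2 / 2) = q at *
  field_simp
  linear_combination truncMoment b 0 x * h2

theorem abs_truncMean_le {b : ℝ} (hb : 0 < b) (x : ℝ) : |truncMean b x| ≤ b := by
  unfold truncMean
  rw [abs_div, abs_of_pos (truncMoment_zero_pos hb x), div_le_iff₀ (truncMoment_zero_pos hb x)]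
  exact abs_truncMoment_one_le hb x

theorem boxEdge_div_nonneg {b : ℝ} (hb : 0 < b) (x : ℝ) : 0 ≤ boxEdge b x / boxDensity b x := by
  have := boxDensity_pos hb x
  unfold boxEdge
  positivity

theorem boxEdge_div_le {b : ℝ} (hb : 0 < b) (x : ℝ) :
    boxEdge b x / boxDensity b x ≤ (1 + b * (|x| + b)) / b := by
  rw [le_div_iff₀ hb, mul_comm, mul_boxEdge_div hb]
  have h1 := truncVar_nonneg hb x
  have h2 : truncMean b x * (x - truncMean b x) ≤ |truncMean b x| * |x - truncMean b x| := by
    rw [← abs_mul]; exact le_abs_self _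
  have h3 := abs_truncMean_le hb x
  have h4 : |x - truncMean b x| ≤ |x| + b := (abs_sub _ _).trans (by linarith)
  have h5 : |truncMean b x| * |x - truncMean b x| ≤ b * (|x| + b) :=
    mul_le_mul h3 h4 (abs_nonneg _) hb.le
  linarith

/-- The integrand `p(x - a)^(n+1) / p(x)^n` for the box density `p`. -/
def boxTilt (n a b x : ℝ) : ℝ :=
  Real.exp (n * boxPotential b x - (n + 1) * boxPotential b (x - a))

theorem boxPotential_sub_le {b : ℝ} (hb : 0 < b) {a : ℝ} (ha : 0 ≤ a) (x : ℝ) :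
    boxPotential b x - boxPotential b (x - a) ≤ a * (|x| + b) := by
  have h := isStiffening_boxPotential hb
  rcases ha.eq_or_lt with h0 | h0
  · rw [← h0]; simp
  · obtain ⟨y, hy, hy2⟩ := exists_hasDerivAt_eq_slope (boxPotential b)
      (fun y => y - truncMean b y) (show x - a < x by linarith) h.continuous.continuousOn
      fun y _ => h.hasDerivAt y
    rw [sub_sub_cancel, eq_div_iff h0.ne'] at hy2
    rw [← hy2, mul_comm]
    have h1 := abs_le.1 (abs_truncMean_le hb y)
    have h2 := le_abs_self x
    exact mul_le_mul_of_nonneg_left (by linarith [hy.2]) ha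

theorem boxTilt_le {b : ℝ} (hb : 0 < b) {n a : ℝ} (hn : 0 ≤ n) (ha : 0 ≤ a) (x : ℝ) :
    boxTilt n a b x ≤ 2 * b * Real.exp ((n + 1) * a * b) *
      Real.exp ((b + (n + 1) * a) * |x| - x ^ 2 / 2) := by
  have e : boxTilt n a b x = Real.exp ((n + 1) * (boxPotential b x - boxPotential b (x - a))) *
      boxDensity b x := by
    rw [← exp_neg_boxPotential hb, ← Real.exp_add]
    unfold boxTilt
    ring_nf
  have h1 : Real.exp ((n + 1) * (boxPotential b x - boxPotential b (x - a))) ≤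
      Real.exp ((n + 1) * (a * (|x| + b))) := by
    have := boxPotential_sub_le hb ha x
    gcongr
  have h2 := boxDensity_le hb x
  rw [e]
  refine (mul_le_mul h1 h2 (boxDensity_pos hb x).le (Real.exp_pos _).le).trans (le_of_eq ?_)
  rw [show (b + (n + 1) * a) * |x| - x ^ 2 / 2 = (n + 1) * a * |x| + (b * |x| - x ^ 2 / 2) by ring,
    Real.exp_add, show (n + 1) * (a * (|x| + b)) = (n + 1) * a * b + (n + 1) * a * |x| by ring,
    Real.exp_add]
  ring

theorem continuous_boxTilt {b : ℝ} (hb : 0 < b) (n a : ℝ) : Continuous (boxTilt n a b) := by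
  have := (isStiffening_boxPotential hb).continuous
  unfold boxTilt
  fun_prop

theorem integrable_boxTilt_mul {b : ℝ} (hb : 0 < b) {n a : ℝ} (hn : 0 ≤ n) (ha : 0 ≤ a)
    {g : ℝ → ℝ} (hg : Measurable g) {c₁ c₂ : ℝ} (hc : ∀ x, |g x| ≤ c₁ + c₂ * |x|) :
    Integrable fun x => boxTilt n a b x * g x := by
  refine ((integrable_linear_mul_exp c₁ c₂ (b + (n + 1) * a)).const_mul
    (2 * b * Real.exp ((n + 1) * a * b))).mono'
    ((continuous_boxTilt hb n a).measurable.mul hg).aestronglyMeasurable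
    (Filter.Eventually.of_forall fun x => ?_)
  have h0 : 0 ≤ boxTilt n a b x := (Real.exp_pos _).le
  rw [norm_mul, Real.norm_eq_abs, Real.norm_eq_abs, abs_of_nonneg h0]
  refine (mul_le_mul (boxTilt_le hb hn ha x) (hc x) (abs_nonneg _) (by positivity)).trans
    (le_of_eq ?_)
  ring

theorem integrable_boxTilt {b : ℝ} (hb : 0 < b) {n a : ℝ} (hn : 0 ≤ n) (ha : 0 ≤ a) :
    Integrable (boxTilt n a b) := by
  simpa using integrable_boxTilt_mul hb hn ha (measurable_const (a := (1 : ℝ))) (c₁ := 1)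
    (c₂ := 0) (by simp)

theorem hasDerivAt_boxTilt_width {b : ℝ} (hb : 0 < b) (n a x : ℝ) :
    HasDerivAt (fun b => boxTilt n a b x) (boxTilt n a b x *
      ((n + 1) * (boxEdge b (x - a) / boxDensity b (x - a)) -
        n * (boxEdge b x / boxDensity b x))) b := by
  have hp : ∀ y, HasDerivAt (fun b => boxPotential b y) (-(boxEdge b y / boxDensity b y)) b := by
    intro y
    have h1 := ((hasDerivAt_boxDensity_width b y).log (boxDensity_pos hb y).ne').neg
    refine h1.congr_of_eventuallyEq ?_
    filter_upwards [Ioi_mem_nhds hb] with c hc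
    rw [Pi.neg_apply, ← exp_neg_boxPotential hc, Real.log_exp, neg_neg]
  refine ((((hp x).const_mul n).sub ((hp (x - a)).const_mul (n + 1))).exp).congr_deriv ?_
  unfold boxTilt
  simp only [Pi.sub_apply]
  ring

theorem measurable_boxEdge_div (b : ℝ) : Measurable fun x => boxEdge b x / boxDensity b x := by
  have := (continuous_boxDensity b).measurable
  unfold boxEdge
  fun_prop

/-- Bound for the logarithmic derivative of `boxTilt` in the width. -/
theorem abs_boxEdge_combination_le {b : ℝ} (hb : 0 < b) {n a : ℝ} (hn : 0 ≤ n) (ha : 0 ≤ a)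
    (x : ℝ) : |(n + 1) * (boxEdge b (x - a) / boxDensity b (x - a)) -
      n * (boxEdge b x / boxDensity b x)| ≤
      (n + 1) * (1 + b * (a + b)) / b + (n + 1) * |x| := by
  have h1 := boxEdge_div_nonneg hb (x - a)
  have h2 := boxEdge_div_nonneg hb x
  have h3 := boxEdge_div_le hb (x - a)
  have h4 := boxEdge_div_le hb x
  have h5 : |x - a| ≤ |x| + a := (abs_sub _ _).trans (by rw [abs_of_nonneg ha])
  have h6 : (1 + b * (|x - a| + b)) / b ≤ (1 + b * (a + b)) / b + |x| := by
    rw [div_add' _ _ _ hb.ne']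
    refine div_le_div_of_nonneg_right ?_ hb.le
    nlinarith
  have h7 : (1 + b * (|x| + b)) / b ≤ (1 + b * (a + b)) / b + |x| := by
    rw [div_add' _ _ _ hb.ne']
    refine div_le_div_of_nonneg_right ?_ hb.le
    nlinarith
  set p := boxEdge b (x - a) / boxDensity b (x - a)
  set q := boxEdge b x / boxDensity b x
  set B := (1 + b * (a + b)) / b + |x| with hB
  have e : (n + 1) * (1 + b * (a + b)) / b + (n + 1) * |x| = (n + 1) * B := by rw [hB]; ring
  rw [e, abs_le]
  constructor <;> nlinarith

/-- The derivative of `boxTilt * ((n+1) m(x - a) - n m(x))`, with `m` the truncated mean, integrates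
to zero. It equals `boxTilt` times `1 + n(n+1) R - b D`, where `D` is the logarithmic derivative in
the width and `R ≤ 0`. -/
theorem integral_boxTilt_mul_le {b : ℝ} (hb : 0 < b) {n a : ℝ} (hn : 0 ≤ n) (ha : 0 ≤ a) :
    b * ∫ x, boxTilt n a b x * ((n + 1) * (boxEdge b (x - a) / boxDensity b (x - a)) -
        n * (boxEdge b x / boxDensity b x)) ≤ ∫ x, boxTilt n a b x := by
  have h := isStiffening_boxPotential hb
  have hmc : Continuous (truncMean b) :=
    continuous_iff_continuousAt.2 fun x => (hasDerivAt_truncMean hb x).continuousAt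
  set D : ℝ → ℝ := fun x => (n + 1) * (boxEdge b (x - a) / boxDensity b (x - a)) -
        n * (boxEdge b x / boxDensity b x) with hD
  set R : ℝ → ℝ := fun x => (x - truncMean b x - (x - a - truncMean b (x - a))) *
    (truncMean b (x - a) - truncMean b x) with hR
  have hDm : Measurable D := by
    have := measurable_boxEdge_div b
    exact ((this.comp (measurable_id.sub_const a)).const_mul _).sub (this.const_mul _)
  have iD : Integrable fun x => boxTilt n a b x * D x :=
    integrable_boxTilt_mul hb hn ha hDm (abs_boxEdge_combination_le hb hn ha)
  -- `R` is minus the product of the increments over `[x - a, x]` of `W'` and of the truncated mean.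
  -- Both are nondecreasing, since the variance lies in `[0, 1]`.
  have hR0 : ∀ x, R x ≤ 0 := by
    intro x
    have h1 : x - a - truncMean b (x - a) ≤ x - truncMean b x := h.monotone_deriv (by linarith)
    have h2 : truncMean b (x - a) ≤ truncMean b x :=
      monotone_of_hasDerivAt_nonneg (hasDerivAt_truncMean hb) (truncVar_nonneg hb) (by linarith)
    exact mul_nonpos_of_nonneg_of_nonpos (by linarith) (by linarith)
  have iR : Integrable fun x => boxTilt n a b x * R x := by
    refine integrable_boxTilt_mul hb hn ha (Continuous.measurable (by fun_prop))
      (c₁ := (a + 2 * b) * (2 * b)) (c₂ := 0) fun x => ?_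
    have h1 := abs_le.1 (abs_truncMean_le hb x)
    have h2 := abs_le.1 (abs_truncMean_le hb (x - a))
    rw [hR, abs_mul, zero_mul, add_zero]
    refine mul_le_mul (abs_le.2 ⟨?_, ?_⟩) (abs_le.2 ⟨?_, ?_⟩) (abs_nonneg _) (by positivity) <;>
    linarith
  have iT := integrable_boxTilt hb hn ha
  have hQ : ∀ x, HasDerivAt (fun x => boxTilt n a b x *
      ((n + 1) * truncMean b (x - a) - n * truncMean b x))
      (boxTilt n a b x + n * (n + 1) * (boxTilt n a b x * R x) - b * (boxTilt n a b x * D x)) x := by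
    intro x
    have d1 : HasDerivAt (fun x => boxTilt n a b x) _ x :=
      (((h.hasDerivAt x).const_mul n).sub
        (((h.hasDerivAt (x - a)).comp_sub_const x a).const_mul (n + 1))).exp
    have d2 := (((hasDerivAt_truncMean hb (x - a)).comp_sub_const x a).const_mul (n + 1)).sub
      ((hasDerivAt_truncMean hb x).const_mul n)
    refine (d1.mul d2).congr_deriv ?_
    have k1 := mul_boxEdge_div hb x
    have k2 := mul_boxEdge_div hb (x - a)
    have e : ∀ y z : ℝ, b * (boxTilt n a b x * ((n + 1) * y - n * z)) =
        boxTilt n a b x * ((n + 1) * (b * y) - n * (b * z)) := fun y z => by ring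
    simp only [hD, hR, Pi.sub_apply]
    rw [e, k1, k2]
    unfold boxTilt
    ring
  have iQ' := (iT.add (iR.const_mul (n * (n + 1)))).sub (iD.const_mul b)
  have iQ : Integrable fun x => boxTilt n a b x *
      ((n + 1) * truncMean b (x - a) - n * truncMean b x) := by
    refine integrable_boxTilt_mul hb hn ha (Continuous.measurable (by fun_prop))
      (c₁ := (2 * n + 1) * b) (c₂ := 0) fun x => ?_
    have h1 := abs_le.1 (abs_truncMean_le hb x)
    have h2 := abs_le.1 (abs_truncMean_le hb (x - a))
    rw [zero_mul, add_zero, abs_le]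
    constructor <;> nlinarith
  have key := integral_eq_zero_of_hasDerivAt_of_integrable hQ iQ' iQ
  rw [integral_sub (by exact iT.add (iR.const_mul _)) (iD.const_mul b),
    integral_add iT (iR.const_mul _), integral_const_mul, integral_const_mul] at key
  have hneg : ∫ x, boxTilt n a b x * R x ≤ 0 :=
    integral_nonpos fun x => mul_nonpos_of_nonneg_of_nonpos (Real.exp_pos _).le (hR0 x)
  have : n * (n + 1) * ∫ x, boxTilt n a b x * R x ≤ 0 :=
    mul_nonpos_of_nonneg_of_nonpos (by positivity) hneg
  linarith

theorem hasDerivAt_integral_boxTilt {b : ℝ} (hb : 0 < b) {n a : ℝ} (hn : 0 ≤ n) (ha : 0 ≤ a) :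
    HasDerivAt (fun b => ∫ x, boxTilt n a b x)
      (∫ x, boxTilt n a b x * ((n + 1) * (boxEdge b (x - a) / boxDensity b (x - a)) -
        n * (boxEdge b x / boxDensity b x))) b := by
  have hDm : ∀ b, Measurable fun x => (n + 1) * (boxEdge b (x - a) / boxDensity b (x - a)) -
        n * (boxEdge b x / boxDensity b x) := by
    intro b
    have := measurable_boxEdge_div b
    exact ((this.comp (measurable_id.sub_const a)).const_mul _).sub (this.const_mul _)
  -- On the window `(b/2, 2b)` the dominating function takes the upper end where the bound grows
  -- with the width and the lower end in the denominator.
  set β := 2 * b with hβ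
  have hs : Ioo (b / 2) β ∈ nhds b := Ioo_mem_nhds (by linarith) (by linarith)
  refine (hasDerivAt_integral_of_dominated_loc_of_deriv_le (F := fun b x => boxTilt n a b x)
    (F' := fun b x => boxTilt n a b x *
      ((n + 1) * (boxEdge b (x - a) / boxDensity b (x - a)) - n * (boxEdge b x / boxDensity b x)))
    (bound := fun x => 2 * β * Real.exp ((n + 1) * a * β) *
      (((n + 1) * (1 + β * (a + β)) / (b / 2) + (n + 1) * |x|) *
      Real.exp ((β + (n + 1) * a) * |x| - x ^ 2 / 2))) hs ?_ ?_ ?_ ?_ ?_ ?_).2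
  · filter_upwards [hs] with c hc
    exact (continuous_boxTilt (by linarith [hc.1]) n a).aestronglyMeasurable
  · exact integrable_boxTilt hb hn ha
  · exact ((continuous_boxTilt hb n a).measurable.mul (hDm b)).aestronglyMeasurable
  · refine Filter.Eventually.of_forall fun x c hc => ?_
    have hc0 : 0 < c := by linarith [hc.1]
    have hcb : c ≤ β := hc.2.le
    have h0 : 0 ≤ boxTilt n a c x := (Real.exp_pos _).le
    have h1 := boxTilt_le hc0 hn ha x
    have h2 := abs_boxEdge_combination_le hc0 hn ha x
    rw [norm_mul, Real.norm_eq_abs, Real.norm_eq_abs, abs_of_nonneg h0]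
    have h3 : 2 * c * Real.exp ((n + 1) * a * c) *
      Real.exp ((c + (n + 1) * a) * |x| - x ^ 2 / 2) ≤ 2 * β * Real.exp ((n + 1) * a * β) *
      Real.exp ((β + (n + 1) * a) * |x| - x ^ 2 / 2) := by gcongr
    have h4 : (n + 1) * (1 + c * (a + c)) / c + (n + 1) * |x| ≤
        (n + 1) * (1 + β * (a + β)) / (b / 2) + (n + 1) * |x| := by
      have := hc.1.le
      gcongr
    refine (mul_le_mul (h1.trans h3) (h2.trans h4) (abs_nonneg _) (by positivity)).trans
      (le_of_eq (by ring))
  · exact (integrable_linear_mul_exp _ _ _).const_mul _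
  · exact Filter.Eventually.of_forall fun x c hc =>
      hasDerivAt_boxTilt_width (by linarith [hc.1]) n a x

/-- The total mass of `boxDensity b` is proportional to `b`, so dividing by `b` normalizes up to a
constant. The numerator in the quotient rule is `b I' - I`, bounded by `integral_boxTilt_mul_le`. -/
theorem antitoneOn_integral_boxTilt_div {n a : ℝ} (hn : 0 ≤ n) (ha : 0 ≤ a) :
    AntitoneOn (fun b => (∫ x, boxTilt n a b x) / b) (Ioi 0) := by
  have hd : ∀ b, 0 < b → HasDerivAt (fun b => (∫ x, boxTilt n a b x) / b) _ b := fun b hb =>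
    (hasDerivAt_integral_boxTilt hb hn ha).div (hasDerivAt_id b) hb.ne'
  refine antitoneOn_of_deriv_nonpos (convex_Ioi 0)
    (fun b hb => (hd b hb).continuousAt.continuousWithinAt) (fun b hb => ?_) fun b hb => ?_
  · rw [interior_Ioi] at hb
    exact (hd b hb).differentiableAt.differentiableWithinAt
  · rw [interior_Ioi] at hb
    rw [(hd b hb).deriv]
    have := integral_boxTilt_mul_le hb hn ha
    refine div_nonpos_of_nonpos_of_nonneg ?_ (by positivity)
    linarith

/-! ### Normalized moments and the one-hot worst case -/

/-- The normalized moment `∫ (p(x - a) / p(x))^(n+1) dp` for the box law `p`. -/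
def boxMoment (n a b : ℝ) : ℝ := (∫ x, boxTilt n a b x) / ∫ x, boxDensity b x

theorem boxMoment_antitone {n a b b' : ℝ} (hn : 0 ≤ n) (ha : 0 ≤ a) (hb : 0 < b) (hbb : b ≤ b') :
    boxMoment n a b' ≤ boxMoment n a b := by
  have hb' : 0 < b' := hb.trans_le hbb
  have h := antitoneOn_integral_boxTilt_div hn ha (mem_Ioi.2 hb) (mem_Ioi.2 hb') hbb
  unfold boxMoment
  rw [integral_boxDensity hb, integral_boxDensity hb']
  have e : ∀ I c : ℝ, I / (2 * c * √(2 * Real.pi)) = I / c * (2 * √(2 * Real.pi))⁻¹ := by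
    intro I c; rw [← div_eq_mul_inv, div_div]; ring_nf
  rw [e, e]
  exact mul_le_mul_of_nonneg_right h (by positivity)

theorem integral_boxTilt_eq_weight {n a b : ℝ} :
    ∫ x, boxTilt n a b x = ∫ y, IsStiffening.weight (boxPotential b) n a y := by
  rw [← integral_add_right_eq_self (boxTilt n a b) ((n + 1) * a)]
  congr 1; ext y
  unfold boxTilt IsStiffening.weight
  rw [show y + (n + 1) * a - a = y + n * a by ring]

theorem boxMoment_pos {b : ℝ} (hb : 0 < b) {n : ℝ} (hn : 0 ≤ n) (a : ℝ) :
    0 < boxMoment n a b := by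
  unfold boxMoment
  rw [integral_boxTilt_eq_weight, integral_boxDensity hb]
  have := (isStiffening_boxPotential hb).integral_weight_pos hn a
  positivity

theorem log_boxMoment {b : ℝ} (hb : 0 < b) {n : ℝ} (hn : 0 ≤ n) (a : ℝ) :
    Real.log (boxMoment n a b) =
      Real.log (∫ y, IsStiffening.weight (boxPotential b) n a y) -
        Real.log (∫ y, Real.exp (-boxPotential b y)) := by
  have h := (isStiffening_boxPotential hb).integral_weight_pos hn a
  have h0 : 0 < ∫ x, boxDensity b x := by rw [integral_boxDensity hb]; positivity
  simp_rw [exp_neg_boxPotential hb]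
  rw [boxMoment, Real.log_div (by rw [integral_boxTilt_eq_weight]; exact h.ne') h0.ne',
    integral_boxTilt_eq_weight]

theorem sq_mul_log_boxMoment_le {n a b l : ℝ} (hn : 0 ≤ n) (ha : 0 ≤ a) (hb : 0 < b)
    (hl : 1 ≤ l) : l ^ 2 * Real.log (boxMoment n a b) ≤ Real.log (boxMoment n (l * a) b) := by
  rw [log_boxMoment hb hn, log_boxMoment hb hn]
  exact (isStiffening_boxPotential hb).sq_mul_log_le hn ha hl

theorem boxMoment_zero {b : ℝ} (hb : 0 < b) (n : ℝ) : boxMoment n 0 b = 1 := by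
  have h0 : 0 < ∫ x, boxDensity b x := by rw [integral_boxDensity hb]; positivity
  have : ∀ x, boxTilt n 0 b x = boxDensity b x := by
    intro x
    rw [← exp_neg_boxPotential hb, boxTilt, sub_zero]
    ring_nf
  unfold boxMoment
  simp_rw [this]
  exact div_self h0.ne'

theorem boxMoment_neg {b : ℝ} (n a : ℝ) : boxMoment n (-a) b = boxMoment n a b := by
  unfold boxMoment
  congr 1
  rw [← integral_neg_eq_self]
  congr 1; ext x
  have e : ∀ y, boxPotential b (-y) = boxPotential b y := fun y => by
    simp [boxPotential, truncMoment_neg]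
  unfold boxTilt
  rw [e, ← e (-x - -a)]
  ring_nf

/-- After recentring, the weight is `exp (-W)` times the exponential of a nonnegative increment. -/
theorem one_le_boxMoment {n a b : ℝ} (hn : 0 ≤ n) (hb : 0 < b) : 1 ≤ boxMoment n a b := by
  have h := isStiffening_boxPotential hb
  have h0 : 0 < ∫ x, boxDensity b x := by rw [integral_boxDensity hb]; positivity
  rw [boxMoment, integral_boxTilt_eq_weight, one_le_div h0]
  refine integral_mono (integrable_boxDensity hb) (h.integrable_weight hn a) fun y => ?_
  rw [IsStiffening.weight_eq, exp_neg_boxPotential hb]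
  exact le_mul_of_one_le_right (boxDensity_pos hb y).le
    (Real.one_le_exp (h.increment_nonneg hn a y))

/-- The worst case of a vector shift of a given length is a shift along one coordinate. -/
theorem prod_boxMoment_le {ι : Type*} [Fintype ι] {n b c : ℝ} (hn : 0 ≤ n) (hb : 0 < b)
    (hc : 0 < c) (v β : ι → ℝ) (hβ : ∀ i, b ≤ β i) (hv : ∑ i, v i ^ 2 ≤ c ^ 2) :
    ∏ i, boxMoment n (v i) (β i) ≤ boxMoment n c b := by
  have hβ0 : ∀ i, 0 < β i := fun i => hb.trans_le (hβ i)
  have h0 : 0 ≤ Real.log (boxMoment n c b) := Real.log_nonneg (one_le_boxMoment hn hb)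
  have hvi : ∀ i, v i ^ 2 ≤ c ^ 2 := fun i =>
    (Finset.single_le_sum (f := fun i => v i ^ 2) (fun i _ => sq_nonneg _)
      (Finset.mem_univ i)).trans hv
  have key : ∀ i, Real.log (boxMoment n (v i) (β i)) ≤
      v i ^ 2 * (Real.log (boxMoment n c b) / c ^ 2) := by
    intro i
    have e : boxMoment n (v i) (β i) = boxMoment n |v i| (β i) := by
      rcases abs_cases (v i) with ⟨h, -⟩ | ⟨h, -⟩ <;> rw [h]
      rw [boxMoment_neg]
    have h1 : boxMoment n |v i| (β i) ≤ boxMoment n |v i| b :=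
      boxMoment_antitone hn (abs_nonneg _) hb (hβ i)
    rw [e]
    refine (Real.log_le_log (boxMoment_pos (hβ0 i) hn _) h1).trans ?_
    rw [← sq_abs (v i)]
    rcases (abs_nonneg (v i)).eq_or_lt with h2 | h2
    · rw [← h2, boxMoment_zero hb]; simp
    · have h3 : |v i| ≤ c := abs_le_of_sq_le_sq (hvi i) hc.le
      -- Scaling `|v i|` up to `c` uses the factor `l = c / |v i|`, which is at least one.
      have h4 := sq_mul_log_boxMoment_le (b := b) hn h2.le hb ((one_le_div h2).2 h3)
      rw [div_mul_cancel₀ _ h2.ne', div_pow, div_mul_eq_mul_div, div_le_iff₀ (by positivity)] at h4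
      rw [← mul_div_assoc, le_div_iff₀ (by positivity)]
      linarith
  rw [← Real.log_le_log_iff (Finset.prod_pos fun i _ => boxMoment_pos (hβ0 i) hn _)
    (boxMoment_pos hb hn _), Real.log_prod fun i _ => (boxMoment_pos (hβ0 i) hn _).ne']
  refine (Finset.sum_le_sum fun i _ => key i).trans ?_
  rw [← Finset.sum_mul]
  calc (∑ i, v i ^ 2) * (Real.log (boxMoment n c b) / c ^ 2)
      ≤ c ^ 2 * (Real.log (boxMoment n c b) / c ^ 2) :=
        mul_le_mul_of_nonneg_right hv (by positivity)
    _ = _ := by field_simp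

/-! ### The law of a Gaussian plus an independent uniform variable -/

/-- The law `N(m, σ) * U[-B, B]`. -/
def boxLaw (σ B m : ℝ) : Measure ℝ := (gaussianLaw m σ).conv (uniformLaw (-B) B)

theorem mixedLaw_eq_boxLaw (η τ σ m : ℝ) : mixedLaw η τ σ m = boxLaw σ (τ / (2 * η)) m := rfl

theorem isProbabilityMeasure_boxLaw {σ B : ℝ} (hB : 0 < B) (m : ℝ) :
    IsProbabilityMeasure (boxLaw σ B m) := by
  have := isProbabilityMeasure_uniformLaw (show -B < B by linarith)
  unfold boxLaw
  infer_instance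

/-- The probability density of `boxLaw`. -/
def boxPDF (σ B m x : ℝ) : ℝ := (2 * B * √(2 * Real.pi))⁻¹ * boxDensity (B / σ) ((x - m) / σ)

theorem uniformLaw_eq_withDensity (a b : ℝ) :
    uniformLaw a b = volume.withDensity ((Icc a b).indicator fun _ => (volume (Icc a b))⁻¹) := by
  rw [withDensity_indicator measurableSet_Icc, withDensity_const]
  rfl

theorem boxPDF_eq_integral {σ B : ℝ} (hσ : 0 < σ) (m x : ℝ) : boxPDF σ B m x =
    (2 * B)⁻¹ * ∫ y in (-B)..B, (√(2 * Real.pi * σ ^ 2))⁻¹ *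
      Real.exp (-(-y + x - m) ^ 2 / (2 * σ ^ 2)) := by
  have h := intervalIntegral.integral_comp_div (a := -B) (b := B)
    (fun u : ℝ => Real.exp (-((x - m) / σ - u) ^ 2 / 2)) hσ.ne'
  have e : ∀ y : ℝ, Real.exp (-(-y + x - m) ^ 2 / (2 * σ ^ 2)) =
      Real.exp (-((x - m) / σ - y / σ) ^ 2 / 2) := by
    intro y; congr 1; field_simp; ring
  simp_rw [e]
  rw [intervalIntegral.integral_const_mul, h, Real.sqrt_mul (by positivity), Real.sqrt_sq hσ.le,
    smul_eq_mul, neg_div]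
  unfold boxPDF boxDensity
  field_simp

theorem boxLaw_eq_withDensity {σ B : ℝ} (hσ : 0 < σ) (hB : 0 < B) (m : ℝ) :
    boxLaw σ B m = volume.withDensity fun x => ENNReal.ofReal (boxPDF σ B m x) := by
  have hv : (σ ^ 2).toNNReal ≠ 0 := by
    rw [Ne, Real.toNNReal_eq_zero, not_le]; positivity
  have := isProbabilityMeasure_uniformLaw (show -B < B by linarith)
  rw [boxLaw, Measure.conv_comm, uniformLaw_eq_withDensity, gaussianLaw,
    gaussianReal_of_var_ne_zero _ hv, conv_withDensity_eq_lconvolution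
    (measurable_const.indicator measurableSet_Icc) (measurable_gaussianPDF _ _)]
  congr 1; ext x
  rw [lconvolution_def, boxPDF_eq_integral hσ]
  have hc : Continuous fun y : ℝ => (√(2 * Real.pi * σ ^ 2))⁻¹ *
      Real.exp (-(-y + x - m) ^ 2 / (2 * σ ^ 2)) := by fun_prop
  have e : ∀ y, (Icc (-B) B).indicator (fun _ => (volume (Icc (-B) B))⁻¹) y *
      gaussianPDF m (σ ^ 2).toNNReal (-y + x) =
      (Icc (-B) B).indicator (fun y => (volume (Icc (-B) B))⁻¹ *
        ENNReal.ofReal ((√(2 * Real.pi * σ ^ 2))⁻¹ *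
          Real.exp (-(-y + x - m) ^ 2 / (2 * σ ^ 2)))) y := by
    intro y
    rw [indicator_apply, indicator_apply]
    split_ifs
    · rw [gaussianPDF, gaussianPDFReal, Real.coe_toNNReal _ (by positivity)]
    · rw [zero_mul]
  simp_rw [e]
  rw [lintegral_indicator measurableSet_Icc, lintegral_const_mul _ (by fun_prop),
    ← ofReal_integral_eq_lintegral_ofReal (Continuous.integrableOn_Icc hc)
      (Filter.Eventually.of_forall fun y => by positivity), Real.volume_Icc,
    ← ENNReal.ofReal_inv_of_pos (by linarith), ← ENNReal.ofReal_mul (by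
      rw [inv_nonneg]; linarith), integral_Icc_eq_integral_Ioc,
    ← intervalIntegral.integral_of_le (by linarith)]
  congr 2
  ring

theorem boxPDF_pos {σ B : ℝ} (hσ : 0 < σ) (hB : 0 < B) (m x : ℝ) : 0 < boxPDF σ B m x := by
  have := boxDensity_pos (div_pos hB hσ) ((x - m) / σ)
  unfold boxPDF
  positivity

theorem measurable_boxPDF (σ B m : ℝ) : Measurable (boxPDF σ B m) := by
  have := (continuous_boxDensity (B / σ)).measurable
  unfold boxPDF
  fun_prop

theorem lintegral_boxLaw {σ B : ℝ} (hσ : 0 < σ) (hB : 0 < B) (m : ℝ) {f : ℝ → ℝ≥0∞}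
    (hf : Measurable f) :
    ∫⁻ x, f x ∂boxLaw σ B m = ∫⁻ x, ENNReal.ofReal (boxPDF σ B m x) * f x := by
  rw [boxLaw_eq_withDensity hσ hB, lintegral_withDensity_eq_lintegral_mul _
    (measurable_boxPDF σ B m).ennreal_ofReal hf]
  rfl

theorem map_add_boxLaw {σ B : ℝ} (hσ : 0 < σ) (hB : 0 < B) (m : ℝ) :
    (boxLaw σ B 0).map (fun x => x + m) = boxLaw σ B m := by
  refine Measure.ext_of_lintegral _ fun f hf => ?_
  rw [lintegral_map hf (by fun_prop), lintegral_boxLaw hσ hB 0 (by fun_prop),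
    lintegral_boxLaw hσ hB m hf,
    ← lintegral_add_right_eq_self (fun x => ENNReal.ofReal (boxPDF σ B m x) * f x) m]
  refine lintegral_congr fun x => ?_
  simp [boxPDF]

theorem map_sub_left_boxLaw {σ B : ℝ} (hσ : 0 < σ) (hB : 0 < B) (m : ℝ) :
    (boxLaw σ B 0).map (fun x => m - x) = boxLaw σ B m := by
  refine Measure.ext_of_lintegral _ fun f hf => ?_
  rw [lintegral_map hf (by fun_prop), lintegral_boxLaw hσ hB 0 (by fun_prop),
    lintegral_boxLaw hσ hB m hf, ← lintegral_sub_left_eq_self _ m]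
  refine lintegral_congr fun x => ?_
  have e : boxDensity (B / σ) ((m - x) / σ) = boxDensity (B / σ) ((x - m) / σ) := by
    rw [← neg_sub x m, neg_div, boxDensity_neg]
  simp [boxPDF, e]

/-- The density of `boxLaw σ B m` with respect to `boxLaw σ B 0`. -/
def boxRatio (σ B m x : ℝ) : ℝ := boxPDF σ B m x / boxPDF σ B 0 x

theorem boxRatio_pos {σ B : ℝ} (hσ : 0 < σ) (hB : 0 < B) (m x : ℝ) : 0 < boxRatio σ B m x :=
  div_pos (boxPDF_pos hσ hB m x) (boxPDF_pos hσ hB 0 x)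

theorem measurable_boxRatio (σ B m : ℝ) : Measurable (boxRatio σ B m) :=
  (measurable_boxPDF σ B m).div (measurable_boxPDF σ B 0)

/-- The reflection about `m / 2` exchanges the densities centred at `0` and at `m`. -/
theorem boxRatio_sub_left {σ B : ℝ} (m x : ℝ) :
    boxRatio σ B m (m - x) = (boxRatio σ B m x)⁻¹ := by
  unfold boxRatio boxPDF
  rw [inv_div, sub_zero, sub_zero, show m - x - m = -x by ring, neg_div, boxDensity_neg,
    ← neg_sub x m, neg_div, boxDensity_neg]

theorem boxLaw_eq_withDensity_ratio {σ B : ℝ} (hσ : 0 < σ) (hB : 0 < B) (m : ℝ) :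
    boxLaw σ B m = (boxLaw σ B 0).withDensity fun x => ENNReal.ofReal (boxRatio σ B m x) := by
  rw [boxLaw_eq_withDensity hσ hB 0, ← withDensity_mul _
    (measurable_boxPDF σ B 0).ennreal_ofReal (measurable_boxRatio σ B m).ennreal_ofReal,
    boxLaw_eq_withDensity hσ hB m]
  congr 1; ext x
  rw [Pi.mul_apply, ← ENNReal.ofReal_mul (boxPDF_pos hσ hB 0 x).le]
  congr 1
  have := (boxPDF_pos hσ hB 0 x).ne'
  unfold boxRatio
  field_simp

theorem integrable_boxTilt_of_pos {b : ℝ} (hb : 0 < b) {n : ℝ} (hn : 0 ≤ n) (a : ℝ) :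
    Integrable (boxTilt n a b) := by
  have h := ((isStiffening_boxPotential hb).integrable_weight hn a).comp_sub_right ((n + 1) * a)
  refine h.congr (Filter.Eventually.of_forall fun x => ?_)
  unfold boxTilt IsStiffening.weight
  simp only
  ring_nf

theorem boxDensity_mul_pow {b : ℝ} (hb : 0 < b) (n : ℕ) (a y : ℝ) :
    boxDensity b y * (boxDensity b (y - a) / boxDensity b y) ^ (n + 1) = boxTilt n a b y := by
  rw [← exp_neg_boxPotential hb, ← exp_neg_boxPotential hb, ← Real.exp_sub, ← Real.exp_nat_mul,
    ← Real.exp_add, boxTilt]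
  push_cast
  ring_nf

theorem lintegral_boxRatio_pow {σ B : ℝ} (hσ : 0 < σ) (hB : 0 < B) (m : ℝ) (n : ℕ) :
    ∫⁻ x, ENNReal.ofReal (boxRatio σ B m x) ^ (n + 1) ∂boxLaw σ B 0 =
      ENNReal.ofReal (boxMoment n (m / σ) (B / σ)) := by
  have hb : 0 < B / σ := div_pos hB hσ
  have hr := measurable_boxRatio σ B m
  have hn : (0 : ℝ) ≤ n := n.cast_nonneg
  rw [lintegral_boxLaw hσ hB 0 (by fun_prop)]
  have e : ∀ x, ENNReal.ofReal (boxPDF σ B 0 x) * ENNReal.ofReal (boxRatio σ B m x) ^ (n + 1) =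
      ENNReal.ofReal ((2 * B * √(2 * Real.pi))⁻¹ * boxTilt n (m / σ) (B / σ) (x / σ)) := by
    intro x
    rw [← ENNReal.ofReal_pow (boxRatio_pos hσ hB m x).le,
      ← ENNReal.ofReal_mul (boxPDF_pos hσ hB 0 x).le, ← boxDensity_mul_pow hb]
    congr 1
    have : (2 * B * √(2 * Real.pi))⁻¹ ≠ 0 := by positivity
    unfold boxRatio boxPDF
    rw [sub_zero, mul_div_mul_left _ _ this, sub_div]
    ring
  simp_rw [e]
  have hi := (integrable_boxTilt_of_pos hb hn (m / σ)).comp_div hσ.ne'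
  rw [← ofReal_integral_eq_lintegral_ofReal (hi.const_mul _)
    (Filter.Eventually.of_forall fun x => mul_nonneg (by positivity) (Real.exp_pos _).le),
    integral_const_mul, Measure.integral_comp_div, boxMoment, integral_boxDensity hb,
    abs_of_pos hσ, smul_eq_mul]
  congr 1
  field_simp

/-! ### Product measures -/

theorem lintegral_pi_prod {ι : Type*} [Fintype ι] {Ω : ι → Type*} [∀ i, MeasurableSpace (Ω i)]
    (μ : ∀ i, Measure (Ω i)) [∀ i, IsProbabilityMeasure (μ i)] {f : ∀ i, Ω i → ℝ≥0∞}
    (hf : ∀ i, Measurable (f i)) :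
    ∫⁻ x, ∏ i, f i (x i) ∂Measure.pi μ = ∏ i, ∫⁻ x, f i x ∂μ i := by
  refine (lintegral_prod_eq_prod_lintegral_of_indepFun Finset.univ
    (fun i (x : ∀ i, Ω i) => f i (x i)) (iIndepFun_pi fun i => (hf i).aemeasurable)
    fun i => (hf i).comp (measurable_pi_apply i)).trans ?_
  exact Finset.prod_congr rfl fun i _ => (measurePreserving_eval μ i).lintegral_comp (hf i)

theorem pi_withDensity {ι : Type*} [Fintype ι] {Ω : ι → Type*} [∀ i, MeasurableSpace (Ω i)]
    (μ : ∀ i, Measure (Ω i)) [∀ i, IsProbabilityMeasure (μ i)] {f : ∀ i, Ω i → ℝ≥0∞}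
    (hf : ∀ i, Measurable (f i)) [∀ i, SigmaFinite ((μ i).withDensity (f i))] :
    Measure.pi (fun i => (μ i).withDensity (f i)) =
      (Measure.pi μ).withDensity fun x => ∏ i, f i (x i) := by
  refine Measure.pi_eq fun s hs => ?_
  rw [withDensity_apply _ (MeasurableSet.univ_pi hs),
    ← lintegral_indicator (MeasurableSet.univ_pi hs)]
  have e : ∀ x, (univ.pi s).indicator (fun x => ∏ i, f i (x i)) x =
      ∏ i, (s i).indicator (f i) (x i) := by
    intro x
    by_cases hx : x ∈ univ.pi s
    · rw [indicator_of_mem hx]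
      exact Finset.prod_congr rfl fun i _ => (indicator_of_mem (hx i (mem_univ i)) _).symm
    · rw [indicator_of_notMem hx]
      simp only [mem_pi, mem_univ, true_imp_iff, not_forall] at hx
      obtain ⟨i, hi⟩ := hx
      exact (Finset.prod_eq_zero (Finset.mem_univ i) (indicator_of_notMem hi _)).symm
  simp_rw [e]
  rw [lintegral_pi_prod μ fun i => (hf i).indicator (hs i)]
  exact Finset.prod_congr rfl fun i _ => by
    rw [withDensity_apply _ (hs i), lintegral_indicator (hs i)]

theorem lintegral_add_mul_pow {Ω : Type*} [MeasurableSpace Ω] (μ : Measure Ω) (s t : ℝ≥0∞)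
    {g : Ω → ℝ≥0∞} (hg : Measurable g) (N : ℕ) :
    ∫⁻ x, (s + t * g x) ^ N ∂μ =
      ∑ k ∈ Finset.range (N + 1), t ^ k * s ^ (N - k) * N.choose k * ∫⁻ x, g x ^ k ∂μ := by
  have e : ∀ x, (s + t * g x) ^ N =
      ∑ k ∈ Finset.range (N + 1), t ^ k * s ^ (N - k) * N.choose k * g x ^ k := by
    intro x
    rw [add_comm, add_pow]
    exact Finset.sum_congr rfl fun k _ => by rw [mul_pow]; ring
  simp_rw [e]
  rw [lintegral_finsetSum _ fun k _ => by fun_prop]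
  exact Finset.sum_congr rfl fun k _ => lintegral_const_mul _ (by fun_prop)

/-! ### Vector laws and subsampled moments -/

/-- The law of a vector with independent coordinates `N(m j, σ) * U[-β j, β j]`. -/
def boxVec {d : ℕ} (σ : ℝ) (β m : Fin d → ℝ) : Measure (Fin d → ℝ) :=
  Measure.pi fun j => boxLaw σ (β j) (m j)

/-- The density of `boxVec σ β m` with respect to `boxVec σ β 0`. -/
def boxVecRatio {d : ℕ} (σ : ℝ) (β m x : Fin d → ℝ) : ℝ := ∏ j, boxRatio σ (β j) (m j) (x j)

theorem isProbabilityMeasure_boxVec {d : ℕ} {σ : ℝ} {β : Fin d → ℝ} (hβ : ∀ j, 0 < β j)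
    (m : Fin d → ℝ) : IsProbabilityMeasure (boxVec σ β m) := by
  have := fun j => isProbabilityMeasure_boxLaw (σ := σ) (hβ j) (m j)
  unfold boxVec
  infer_instance

theorem measurable_boxVecRatio {d : ℕ} (σ : ℝ) (β m : Fin d → ℝ) :
    Measurable (boxVecRatio σ β m) :=
  Finset.measurable_fun_prod _ fun j _ => (measurable_boxRatio σ (β j) (m j)).comp
    (measurable_pi_apply j)

theorem boxVecRatio_pos {d : ℕ} {σ : ℝ} (hσ : 0 < σ) {β : Fin d → ℝ} (hβ : ∀ j, 0 < β j)
    (m x : Fin d → ℝ) : 0 < boxVecRatio σ β m x :=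
  Finset.prod_pos fun j _ => boxRatio_pos hσ (hβ j) _ _

theorem ofReal_boxVecRatio {d : ℕ} {σ : ℝ} (hσ : 0 < σ) {β : Fin d → ℝ} (hβ : ∀ j, 0 < β j)
    (m x : Fin d → ℝ) : ENNReal.ofReal (boxVecRatio σ β m x) =
      ∏ j, ENNReal.ofReal (boxRatio σ (β j) (m j) (x j)) :=
  ENNReal.ofReal_prod_of_nonneg fun j _ => (boxRatio_pos hσ (hβ j) _ _).le

theorem boxVec_eq_withDensity {d : ℕ} {σ : ℝ} (hσ : 0 < σ) {β : Fin d → ℝ} (hβ : ∀ j, 0 < β j)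
    (m : Fin d → ℝ) : boxVec σ β m =
      (boxVec σ β 0).withDensity fun x => ENNReal.ofReal (boxVecRatio σ β m x) := by
  have hp := fun m j => isProbabilityMeasure_boxLaw (σ := σ) (hβ j) m
  have e := fun j => boxLaw_eq_withDensity_ratio hσ (hβ j) (m j)
  have hs : ∀ j, SigmaFinite ((boxLaw σ (β j) 0).withDensity
      fun x => ENNReal.ofReal (boxRatio σ (β j) (m j) x)) := by
    intro j
    rw [← e j]
    have := hp (m j) j
    infer_instance
  have := hp 0
  simp_rw [ofReal_boxVecRatio hσ hβ]
  rw [boxVec, boxVec]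
  simp_rw [e]
  exact pi_withDensity (fun j => boxLaw σ (β j) ((0 : Fin d → ℝ) j))
    fun j => (measurable_boxRatio σ (β j) (m j)).ennreal_ofReal

theorem lintegral_boxVecRatio_pow {d : ℕ} {σ : ℝ} (hσ : 0 < σ) {β : Fin d → ℝ}
    (hβ : ∀ j, 0 < β j) (m : Fin d → ℝ) (n : ℕ) :
    ∫⁻ x, ENNReal.ofReal (boxVecRatio σ β m x) ^ (n + 1) ∂boxVec σ β 0 =
      ENNReal.ofReal (∏ j, boxMoment n (m j / σ) (β j / σ)) := by
  have := fun j => isProbabilityMeasure_boxLaw (σ := σ) (hβ j) 0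
  simp_rw [ofReal_boxVecRatio hσ hβ, ← Finset.prod_pow]
  rw [boxVec, ENNReal.ofReal_prod_of_nonneg fun j _ =>
    (boxMoment_pos (div_pos (hβ j) hσ) n.cast_nonneg _).le]
  refine (lintegral_pi_prod (fun j => boxLaw σ (β j) ((0 : Fin d → ℝ) j))
    (f := fun j x => ENNReal.ofReal (boxRatio σ (β j) (m j) x) ^ (n + 1)) fun j => ?_).trans ?_
  · exact (measurable_boxRatio σ (β j) (m j)).ennreal_ofReal.pow_const _
  · exact Finset.prod_congr rfl fun j _ => lintegral_boxRatio_pow hσ (hβ j) (m j) n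

/-- The Rényi moment of the subsampled law in dimension one. -/
def renyiMoment (q σ B c : ℝ) (N : ℕ) : ℝ≥0∞ :=
  ∫⁻ x, (ENNReal.ofReal (1 - q) + ENNReal.ofReal q * ENNReal.ofReal (boxRatio σ B c x)) ^ N
    ∂boxLaw σ B 0

/-- The Rényi moment of the subsampled law of vectors. -/
def renyiMomentVec {d : ℕ} (q σ : ℝ) (β m : Fin d → ℝ) (N : ℕ) : ℝ≥0∞ :=
  ∫⁻ x, (ENNReal.ofReal (1 - q) + ENNReal.ofReal q * ENNReal.ofReal (boxVecRatio σ β m x)) ^ N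
    ∂boxVec σ β 0

/-- The integer order makes a binomial expansion available, and its coefficients are nonnegative.
The comparison therefore holds term by term, each term being a pure-shift moment covered by
`prod_boxMoment_le`. -/
theorem renyiMomentVec_le {d : ℕ} {q σ B c : ℝ} (hσ : 0 < σ) (hB : 0 < B) (hc : 0 < c)
    {β m : Fin d → ℝ} (hβ : ∀ j, B ≤ β j) (hm : ∑ j, m j ^ 2 ≤ c ^ 2) (N : ℕ) :
    renyiMomentVec q σ β m N ≤ renyiMoment q σ B c N := by
  have hβ0 : ∀ j, 0 < β j := fun j => hB.trans_le (hβ j)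
  have := isProbabilityMeasure_boxLaw (σ := σ) hB 0
  have := isProbabilityMeasure_boxVec (σ := σ) hβ0 0
  unfold renyiMomentVec renyiMoment
  rw [lintegral_add_mul_pow _ _ _ (measurable_boxVecRatio σ β m).ennreal_ofReal,
    lintegral_add_mul_pow _ _ _ (measurable_boxRatio σ B c).ennreal_ofReal]
  refine Finset.sum_le_sum fun k _ => mul_le_mul_right ?_ _
  rcases k with _ | n
  · simp
  · rw [lintegral_boxVecRatio_pow hσ hβ0, lintegral_boxRatio_pow hσ hB]
    refine ENNReal.ofReal_le_ofReal (prod_boxMoment_le n.cast_nonneg (div_pos hB hσ)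
      (div_pos hc hσ) _ _ (fun j => div_le_div_of_nonneg_right (hβ j) hσ.le) ?_)
    simp_rw [div_pow]
    rw [← Finset.sum_div]
    exact div_le_div_of_nonneg_right hm (by positivity)

theorem renyiMomentVec_single {d : ℕ} {q σ B c : ℝ} (hσ : 0 < σ) (hB : 0 < B) (j : Fin d)
    (N : ℕ) : renyiMomentVec q σ (fun _ => B) (Pi.single j c) N = renyiMoment q σ B c N := by
  have := isProbabilityMeasure_boxLaw (σ := σ) hB 0
  have := isProbabilityMeasure_boxVec (σ := σ) (fun _ : Fin d => hB) 0
  unfold renyiMomentVec renyiMoment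
  rw [lintegral_add_mul_pow _ _ _ (measurable_boxVecRatio σ _ _).ennreal_ofReal,
    lintegral_add_mul_pow _ _ _ (measurable_boxRatio σ B c).ennreal_ofReal]
  refine Finset.sum_congr rfl fun k _ => ?_
  rcases k with _ | n
  · simp
  · rw [lintegral_boxVecRatio_pow hσ fun _ => hB, lintegral_boxRatio_pow hσ hB,
      Finset.prod_eq_single j]
    · simp
    · intro i _ hij
      rw [Pi.single_eq_of_ne hij, zero_div, boxMoment_zero (div_pos hB hσ)]
    · simp

/-! ### Rényi divergence of a subsampled mixture -/

theorem mixture_withDensity {Ω : Type*} [MeasurableSpace Ω] (q : ℝ) (μ : Measure Ω)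
    {g : Ω → ℝ≥0∞} (hg : Measurable g) : mixture q μ (μ.withDensity g) =
      μ.withDensity fun x => ENNReal.ofReal (1 - q) + ENNReal.ofReal q * g x := by
  rw [mixture, show (fun x => ENNReal.ofReal (1 - q) + ENNReal.ofReal q * g x) =
    (fun _ => ENNReal.ofReal (1 - q)) + ENNReal.ofReal q • g from rfl,
    withDensity_add_left measurable_const, withDensity_const, withDensity_smul _ hg]

theorem renyiDiv_withDensity {Ω : Type*} [MeasurableSpace Ω] (μ : Measure Ω) [SigmaFinite μ]
    {g : Ω → ℝ≥0∞} (hg : Measurable g) (N : ℕ) :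
    renyiDiv N (μ.withDensity g) μ =
      ((((N : ℝ) - 1)⁻¹ : ℝ) : EReal) * ENNReal.log (∫⁻ x, g x ^ N ∂μ) := by
  rw [renyiDiv, if_pos (withDensity_absolutelyContinuous μ g)]
  congr 2
  refine lintegral_congr_ae ?_
  filter_upwards [Measure.rnDeriv_withDensity μ hg] with x hx
  rw [hx, ENNReal.rpow_natCast]

theorem renyiDiv_boxLaw {q σ B : ℝ} (hσ : 0 < σ) (hB : 0 < B) (c : ℝ) (N : ℕ) :
    renyiDiv N (mixture q (boxLaw σ B 0) (boxLaw σ B c)) (boxLaw σ B 0) =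
      ((((N : ℝ) - 1)⁻¹ : ℝ) : EReal) * ENNReal.log (renyiMoment q σ B c N) := by
  have := isProbabilityMeasure_boxLaw (σ := σ) hB 0
  have hm := (measurable_boxRatio σ B c).ennreal_ofReal
  rw [boxLaw_eq_withDensity_ratio hσ hB c, mixture_withDensity q _ hm,
    renyiDiv_withDensity _ (by fun_prop)]
  rfl

/-- Regrouping a pair of vectors into a vector of pairs makes the sum act coordinate by coordinate.
-/
theorem pi_conv {ι : Type*} [Fintype ι] (μ ν : ι → Measure ℝ) [∀ i, IsProbabilityMeasure (μ i)]
    [∀ i, IsProbabilityMeasure (ν i)] :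
    (Measure.pi μ).conv (Measure.pi ν) = Measure.pi fun i => (μ i).conv (ν i) := by
  have h := (measurePreserving_arrowProdEquivProdArrow ℝ ℝ ι μ ν).map_eq
  unfold Measure.conv
  rw [← h, Measure.map_map (by fun_prop) (MeasurableEquiv.measurable _)]
  exact Measure.pi_map_pi (μ := fun i => (μ i).prod (ν i)) (f := fun _ p => p.1 + p.2)
    fun i => (measurable_fst.add measurable_snd).aemeasurable

theorem mixedVec_eq_map {d : ℕ} {η τ σ : ℝ} (hη : 0 < η) (hτ : 0 < τ)
    (v : EuclideanSpace ℝ (Fin d)) : mixedVec η τ σ v =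
      (boxVec σ (fun _ => τ / (2 * η)) v.ofLp).map (WithLp.toLp 2) := by
  have := isProbabilityMeasure_uniformLaw
    (show -(τ / (2 * η)) < τ / (2 * η) by linarith [div_pos hτ (mul_pos two_pos hη)])
  have hm := WithLp.measurable_toLp 2 (Fin d → ℝ)
  unfold mixedVec gaussianVec uniformCube boxVec boxLaw
  rw [← pi_conv]
  unfold Measure.conv
  rw [Measure.map_prod_map _ _ hm hm, Measure.map_map (by fun_prop) (hm.prodMap hm),
    Measure.map_map hm (by fun_prop)]
  rfl

theorem map_withDensity_toLp {d : ℕ} (μ : Measure (Fin d → ℝ)) {g : (Fin d → ℝ) → ℝ≥0∞}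
    (hg : Measurable g) : (μ.withDensity g).map (WithLp.toLp 2) =
      (μ.map (WithLp.toLp 2)).withDensity
        fun x : EuclideanSpace ℝ (Fin d) => g x.ofLp := by
  have hm := WithLp.measurable_toLp 2 (Fin d → ℝ)
  have hm' := WithLp.measurable_ofLp 2 (Fin d → ℝ)
  have hg' := hg.comp hm'
  refine Measure.ext_of_lintegral _ fun f hf => ?_
  rw [lintegral_map hf hm]
  refine (lintegral_withDensity_eq_lintegral_mul _ hg (hf.comp hm)).trans ?_
  refine Eq.trans ?_ (lintegral_withDensity_eq_lintegral_mul _ hg' hf).symm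
  rw [lintegral_map (hg'.mul hf) hm]
  rfl

theorem renyiDiv_mixedVec {d : ℕ} {q η τ σ : ℝ} (hη : 0 < η) (hτ : 0 < τ) (hσ : 0 < σ)
    (v : EuclideanSpace ℝ (Fin d)) (N : ℕ) :
    renyiDiv N (mixture q (mixedVec η τ σ 0) (mixedVec η τ σ v)) (mixedVec η τ σ 0) =
      ((((N : ℝ) - 1)⁻¹ : ℝ) : EReal) *
        ENNReal.log (renyiMomentVec q σ (fun _ => τ / (2 * η)) v.ofLp N) := by
  have hB : 0 < τ / (2 * η) := by positivity
  have := isProbabilityMeasure_boxVec (σ := σ) (fun _ : Fin d => hB) 0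
  have hm := WithLp.measurable_toLp 2 (Fin d → ℝ)
  have hm' := WithLp.measurable_ofLp 2 (Fin d → ℝ)
  have hr := (measurable_boxVecRatio σ (fun _ => τ / (2 * η)) v.ofLp).ennreal_ofReal
  have hr' : Measurable fun x : EuclideanSpace ℝ (Fin d) =>
      ENNReal.ofReal (boxVecRatio σ (fun _ => τ / (2 * η)) v.ofLp x.ofLp) := hr.comp hm'
  rw [mixedVec_eq_map hη hτ v, mixedVec_eq_map hη hτ 0,
    boxVec_eq_withDensity hσ (fun _ => hB) v.ofLp, WithLp.ofLp_zero, map_withDensity_toLp _ hr,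
    mixture_withDensity q _ hr']
  have := Measure.isProbabilityMeasure_map
    (μ := boxVec σ (fun _ : Fin d => τ / (2 * η)) 0) hm.aemeasurable
  rw [renyiDiv_withDensity _ ((hr'.const_mul _).const_add _),
    lintegral_map (((hr'.const_mul _).const_add _).pow_const N) hm]
  rfl

theorem EReal_coe_mul_log_mono {x : ℝ} (hx : 0 ≤ x) {a b : ℝ≥0∞} (hab : a ≤ b) :
    (x : EReal) * ENNReal.log a ≤ (x : EReal) * ENNReal.log b :=
  mul_le_mul_of_nonneg_left (ENNReal.log_monotone hab) (EReal.coe_nonneg.2 hx)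

/-! ### Reversing the arguments of the divergence -/

/-- The function `t + 1/t` depends on `|log t|` only and increases with it; the hypotheses say that
`y` is at least as far from `1` as `x` on the logarithmic scale. -/
theorem pow_add_inv_pow_le {x y : ℝ} (hy : 1 ≤ y) (hx : 0 < x) (h1 : x ≤ 1) (hxy : 1 ≤ x * y)
    (m : ℕ) : x ^ m + (x ^ m)⁻¹ ≤ y ^ m + (y ^ m)⁻¹ := by
  have hy0 : 0 < y := by linarith
  have a1 : 1 ≤ y ^ m := one_le_pow₀ hy
  have a2 : 0 < x ^ m := pow_pos hx m
  have a3 : x ^ m ≤ 1 := pow_le_one₀ hx.le h1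
  have a4 : 1 ≤ x ^ m * y ^ m := by rw [← mul_pow]; exact one_le_pow₀ hxy
  set X := x ^ m
  set Y := y ^ m
  have hY : 0 < Y := by linarith
  rw [← sub_nonneg]
  have : Y + Y⁻¹ - (X + X⁻¹) = (Y - X) * (X * Y - 1) / (X * Y) := by field_simp; ring
  rw [this]
  exact div_nonneg (mul_nonneg (by linarith) (by linarith)) (by positivity)

/-- Put `u = 1 - q + q R` and `w = 1 - q + q / R`. Equality holds at `n = 0`. Since `R (w - 1) = -(u
- 1)`, passing from `n` to `n + 1` changes the difference of the sides by `(u - 1)(g(u) - g(w))`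
with `g(x) = x^(n+1) + x^(-(n+1))`. As `u w ≥ 1` with `u`, `w` on opposite sides of `1`, this has a
sign. -/
theorem inv_pow_add_le {q R : ℝ} (hq₀ : 0 ≤ q) (hq₁ : q ≤ 1) (hR : 0 < R) (n : ℕ) :
    ((1 - q + q * R) ^ n)⁻¹ + R * ((1 - q + q * R⁻¹) ^ n)⁻¹ ≤
      (1 - q + q * R) ^ (n + 1) + R * (1 - q + q * R⁻¹) ^ (n + 1) := by
  have hRi : 0 < R⁻¹ := inv_pos.2 hR
  have hpos : ∀ r : ℝ, 0 < r → 0 < 1 - q + q * r := by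
    intro r hr
    rcases hq₀.eq_or_lt with h | h
    · rw [← h]; norm_num
    · have := mul_pos h hr; linarith
  have hu := hpos R hR
  have hw := hpos R⁻¹ hRi
  have hRR : R * R⁻¹ = 1 := mul_inv_cancel₀ hR.ne'
  have hsum : 2 ≤ R + R⁻¹ := by nlinarith [sq_nonneg (R - 1), sq_nonneg (R⁻¹ - 1)]
  have huw : 1 ≤ (1 - q + q * R) * (1 - q + q * R⁻¹) := by
    have : (1 - q + q * R) * (1 - q + q * R⁻¹) = 1 + q * (1 - q) * (R + R⁻¹ - 2) := by
      linear_combination q ^ 2 * hRR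
    rw [this]
    have := mul_nonneg (mul_nonneg hq₀ (sub_nonneg.2 hq₁)) (sub_nonneg.2 hsum)
    linarith
  have hrel : R * (1 - q + q * R⁻¹ - 1) = -(1 - q + q * R - 1) := by
    linear_combination q * hRR
  have hsign : (1 ≤ 1 - q + q * R ∧ 1 - q + q * R⁻¹ ≤ 1) ∨
      (1 - q + q * R ≤ 1 ∧ 1 ≤ 1 - q + q * R⁻¹) := by
    rcases le_total 1 R with h | h
    · have := inv_le_one_of_one_le₀ h
      left; constructor <;> nlinarith
    · have := (one_le_inv₀ hR).2 h
      right; constructor <;> nlinarith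
  set u := 1 - q + q * R
  set w := 1 - q + q * R⁻¹
  have step : ∀ m : ℕ, 0 ≤ (u - 1) * (u ^ m + (u ^ m)⁻¹ - (w ^ m + (w ^ m)⁻¹)) := by
    intro m
    rcases hsign with ⟨h1, h2⟩ | ⟨h1, h2⟩
    · have := pow_add_inv_pow_le h1 hw h2 (by rwa [mul_comm]) m
      exact mul_nonneg (by linarith) (by linarith)
    · have := pow_add_inv_pow_le h2 hu h1 huw m
      exact mul_nonneg_of_nonpos_of_nonpos (by linarith) (by linarith)
  induction n with
  | zero => simp only [pow_zero, inv_one, zero_add, pow_one]; linarith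
  | succ n ih =>
    have s := step (n + 1)
    have e : ∀ x : ℝ, 0 < x → x ^ (n + 1 + 1) - (x ^ (n + 1))⁻¹ - (x ^ (n + 1) - (x ^ n)⁻¹) =
        (x - 1) * (x ^ (n + 1) + (x ^ (n + 1))⁻¹) := by
      intro x hx
      have : x ^ n ≠ 0 := (pow_pos hx n).ne'
      rw [pow_succ x (n + 1), pow_succ x n]
      field_simp
      ring
    have eu := e u hu
    have ew := e w hw
    have : R * ((w - 1) * (w ^ (n + 1) + (w ^ (n + 1))⁻¹)) =
        -((u - 1) * (w ^ (n + 1) + (w ^ (n + 1))⁻¹)) := by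
      rw [← mul_assoc, hrel]; ring
    rw [← ew] at this
    linarith

/-- If a reflection exchanges `μ` and `R μ`, the Rényi moment of the subsampled mixture
dominates the moment with exchanged arguments. -/
theorem lintegral_inv_pow_le_of_reflection {Ω : Type*} [MeasurableSpace Ω] {μ : Measure Ω}
    {R : Ω → ℝ} (hR : Measurable R) (hR0 : ∀ x, 0 < R x) {θ : Ω → Ω} (hθ : Measurable θ)
    (hRθ : ∀ x, R (θ x) = (R x)⁻¹)
    (hμ : μ.map θ = μ.withDensity fun x => ENNReal.ofReal (R x)) {q : ℝ} (hq₀ : 0 ≤ q)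
    (hq₁ : q ≤ 1) (n : ℕ) :
    ∫⁻ x, ENNReal.ofReal ((1 - q + q * R x) ^ n)⁻¹ ∂μ ≤
      ∫⁻ x, ENNReal.ofReal ((1 - q + q * R x) ^ (n + 1)) ∂μ := by
  -- Adding the integral to its image under `θ` pairs the values at `R` and at `1 / R`. The
  -- inequality of moments fails pointwise in general and holds for this symmetrized integrand.
  have sym : ∀ h : ℝ → ℝ, Measurable h →
      2 * ∫⁻ x, ENNReal.ofReal (h (R x)) ∂μ = ∫⁻ x, (ENNReal.ofReal (h (R x)) +
        ENNReal.ofReal (R x) * ENNReal.ofReal (h (R x)⁻¹)) ∂μ := by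
    intro h hh
    have m1 : Measurable fun x => ENNReal.ofReal (h (R x)) := (hh.comp hR).ennreal_ofReal
    have m2 : Measurable fun x => ENNReal.ofReal (h (R x)⁻¹) := (hh.comp hR.inv).ennreal_ofReal
    rw [lintegral_add_left m1, two_mul]
    congr 1
    have e := lintegral_withDensity_eq_lintegral_mul μ hR.ennreal_ofReal m2
    rw [← hμ, lintegral_map m2 hθ] at e
    simp_rw [hRθ, inv_inv] at e
    exact e
  have key : 2 * ∫⁻ x, ENNReal.ofReal ((1 - q + q * R x) ^ n)⁻¹ ∂μ ≤
      2 * ∫⁻ x, ENNReal.ofReal ((1 - q + q * R x) ^ (n + 1)) ∂μ := by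
    rw [sym (fun r => ((1 - q + q * r) ^ n)⁻¹) (by fun_prop),
      sym (fun r => (1 - q + q * r) ^ (n + 1)) (by fun_prop)]
    refine lintegral_mono fun x => ?_
    have h1 := hR0 x
    have hp : ∀ r : ℝ, 0 < r → 0 ≤ 1 - q + q * r := fun r hr => by
      have := mul_nonneg hq₀ hr.le; linarith
    have h2 := hp _ h1
    have h3 := hp _ (inv_pos.2 h1)
    rw [← ENNReal.ofReal_mul h1.le, ← ENNReal.ofReal_mul h1.le,
      ← ENNReal.ofReal_add (by positivity) (by positivity),
      ← ENNReal.ofReal_add (by positivity) (by positivity)]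
    exact ENNReal.ofReal_le_ofReal (inv_pow_add_le hq₀ hq₁ h1 n)
  exact (ENNReal.mul_le_mul_iff_right two_ne_zero ENNReal.ofNat_ne_top).1 key

theorem map_sub_left_boxVec {d : ℕ} {σ : ℝ} (hσ : 0 < σ) {β : Fin d → ℝ} (hβ : ∀ j, 0 < β j)
    (m : Fin d → ℝ) : (boxVec σ β 0).map (fun x => m - x) = boxVec σ β m := by
  have := fun m j => isProbabilityMeasure_boxLaw (σ := σ) (hβ j) m
  have h := fun j => map_sub_left_boxLaw hσ (hβ j) (m j)
  unfold boxVec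
  simp_rw [← h]
  exact Measure.pi_map_pi (μ := fun j => boxLaw σ (β j) 0) (f := fun j x => m j - x)
    fun j => by fun_prop

theorem map_add_boxVec {d : ℕ} {σ : ℝ} (hσ : 0 < σ) {β : Fin d → ℝ} (hβ : ∀ j, 0 < β j)
    (m : Fin d → ℝ) : (boxVec σ β 0).map (fun x => x + m) = boxVec σ β m := by
  have := fun m j => isProbabilityMeasure_boxLaw (σ := σ) (hβ j) m
  have h := fun j => map_add_boxLaw hσ (hβ j) (m j)
  unfold boxVec
  simp_rw [← h]
  exact Measure.pi_map_pi (μ := fun j => boxLaw σ (β j) 0) (f := fun j x => x + m j)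
    fun j => by fun_prop

theorem boxVecRatio_sub_left {d : ℕ} (σ : ℝ) (β m x : Fin d → ℝ) :
    boxVecRatio σ β m (m - x) = (boxVecRatio σ β m x)⁻¹ := by
  unfold boxVecRatio
  rw [← Finset.prod_inv_distrib]
  exact Finset.prod_congr rfl fun j _ => boxRatio_sub_left _ _

theorem lintegral_inv_pow_le_renyiMomentVec {d : ℕ} {q σ : ℝ} (hq₀ : 0 ≤ q) (hq₁ : q ≤ 1)
    (hσ : 0 < σ) {β : Fin d → ℝ} (hβ : ∀ j, 0 < β j) (m : Fin d → ℝ) (n : ℕ) :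
    ∫⁻ x, ENNReal.ofReal ((1 - q + q * boxVecRatio σ β m x) ^ n)⁻¹ ∂boxVec σ β 0 ≤
      renyiMomentVec q σ β m (n + 1) := by
  refine (lintegral_inv_pow_le_of_reflection (measurable_boxVecRatio σ β m)
    (boxVecRatio_pos hσ hβ m) (θ := fun x => m - x) (by fun_prop)
    (boxVecRatio_sub_left σ β m) ?_ hq₀ hq₁ n).trans (le_of_eq ?_)
  · rw [map_sub_left_boxVec hσ hβ, boxVec_eq_withDensity hσ hβ]
  · refine lintegral_congr fun x => ?_
    have h := boxVecRatio_pos hσ hβ m x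
    rw [← ENNReal.ofReal_mul hq₀, ← ENNReal.ofReal_add (by linarith) (by positivity),
      ENNReal.ofReal_pow]
    have := mul_nonneg hq₀ h.le
    linarith

/-! ### Rényi divergence in Hölder form -/

/-- The functional form of a bound for the Rényi divergence of order `p`, where `r` is conjugate
to `p`: all integrals against `P` are bounded by `L^r` norms with respect to `Q`. -/
def HolderBound {Ω : Type*} [MeasurableSpace Ω] (r : ℝ) (K : ℝ≥0∞) (P Q : Measure Ω) : Prop :=
  ∀ f : Ω → ℝ≥0∞, Measurable f → ∫⁻ x, f x ∂P ≤ K * (∫⁻ x, f x ^ r ∂Q) ^ (1 / r)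

theorem HolderBound.mono {Ω : Type*} [MeasurableSpace Ω] {r : ℝ} {K K' : ℝ≥0∞} {P Q : Measure Ω}
    (h : HolderBound r K P Q) (hK : K ≤ K') : HolderBound r K' P Q :=
  fun f hf => (h f hf).trans (mul_le_mul_left hK _)

theorem holderBound_withDensity {Ω : Type*} [MeasurableSpace Ω] {p r : ℝ}
    (hpr : p.HolderConjugate r) (Q : Measure Ω) {g : Ω → ℝ≥0∞} (hg : Measurable g) :
    HolderBound r ((∫⁻ x, g x ^ p ∂Q) ^ (1 / p)) (Q.withDensity g) Q := by
  intro f hf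
  rw [lintegral_withDensity_eq_lintegral_mul _ hg hf]
  exact ENNReal.lintegral_mul_le_Lp_mul_Lq Q hpr hg.aemeasurable hf.aemeasurable

/-- Concavity of the power `1 / r`, as Hölder's inequality against the constant `1`. It averages
over randomness shared by both algorithms without enlarging the constant. -/
theorem lintegral_le_of_forall_le_rpow {Ω : Type*} [MeasurableSpace Ω] {p r : ℝ}
    (hpr : p.HolderConjugate r) {π : Measure Ω} [IsProbabilityMeasure π] {φ ψ : Ω → ℝ≥0∞}
    (hψ : Measurable ψ) {K : ℝ≥0∞} (h : ∀ x, φ x ≤ K * ψ x ^ (1 / r)) :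
    ∫⁻ x, φ x ∂π ≤ K * (∫⁻ x, ψ x ∂π) ^ (1 / r) := by
  refine (lintegral_mono h).trans ?_
  rw [lintegral_const_mul _ (hψ.pow_const _)]
  refine mul_le_mul_right ?_ K
  have key := ENNReal.lintegral_mul_le_Lp_mul_Lq π hpr (f := fun _ => 1)
    (g := fun x => ψ x ^ (1 / r)) aemeasurable_const (hψ.pow_const _).aemeasurable
  simp_rw [Pi.mul_apply, one_mul, ENNReal.one_rpow, ← ENNReal.rpow_mul,
    one_div_mul_cancel hpr.symm.ne_zero, ENNReal.rpow_one] at key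
  simpa using key

/-- Adaptive composition: the bound for the kernels is inserted under the integral, raised to the
power `r`, and then the bound for the initial laws applies. No joint density is needed. -/
theorem HolderBound.bind {Ω Ω' : Type*} [MeasurableSpace Ω] [MeasurableSpace Ω'] {r : ℝ}
    (hr : 0 < r) {K K' : ℝ≥0∞} {P Q : Measure Ω} {κ κ' : Kernel Ω Ω'} (h : HolderBound r K P Q)
    (hκ : ∀ x, HolderBound r K' (κ x) (κ' x)) :
    HolderBound r (K * K') (P.bind κ) (Q.bind κ') := by
  intro f hf
  rw [Measure.lintegral_bind κ.measurable.aemeasurable hf.aemeasurable,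
    Measure.lintegral_bind κ'.measurable.aemeasurable (hf.pow_const r).aemeasurable]
  have hm : Measurable fun x => ∫⁻ y, f y ∂κ x := hf.lintegral_kernel
  have hm' : Measurable fun x => ∫⁻ y, f y ^ r ∂κ' x := (hf.pow_const r).lintegral_kernel
  refine (h _ hm).trans ?_
  have h1 : ∫⁻ x, (∫⁻ y, f y ∂κ x) ^ r ∂Q ≤ K' ^ r * ∫⁻ x, ∫⁻ y, f y ^ r ∂κ' x ∂Q := by
    rw [← lintegral_const_mul _ hm']
    refine lintegral_mono fun x => ?_
    refine (ENNReal.rpow_le_rpow (hκ x f hf) hr.le).trans (le_of_eq ?_)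
    rw [ENNReal.mul_rpow_of_nonneg _ _ hr.le, ← ENNReal.rpow_mul, one_div_mul_cancel hr.ne',
      ENNReal.rpow_one]
  rw [mul_assoc]
  refine mul_le_mul_right ((ENNReal.rpow_le_rpow h1 (by positivity)).trans (le_of_eq ?_)) K
  rw [ENNReal.mul_rpow_of_nonneg _ _ (by positivity), ← ENNReal.rpow_mul,
    mul_one_div_cancel hr.ne', ENNReal.rpow_one]

theorem lintegral_mixture {Ω : Type*} [MeasurableSpace Ω] (q : ℝ) (P Q : Measure Ω)
    (f : Ω → ℝ≥0∞) : ∫⁻ x, f x ∂mixture q P Q =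
      ENNReal.ofReal (1 - q) * ∫⁻ x, f x ∂P + ENNReal.ofReal q * ∫⁻ x, f x ∂Q := by
  unfold mixture
  rw [lintegral_add_measure, lintegral_smul_measure, lintegral_smul_measure]
  rfl

section Subsampling

variable {d : ℕ} {q σ B c : ℝ} {β m : Fin d → ℝ} {n : ℕ} {r : ℝ}

theorem mixture_boxVec (hq₀ : 0 ≤ q) (hq₁ : q ≤ 1) (hσ : 0 < σ) (hβ : ∀ j, 0 < β j) :
    mixture q (boxVec σ β 0) (boxVec σ β m) = (boxVec σ β 0).withDensity
      fun x => ENNReal.ofReal (1 - q + q * boxVecRatio σ β m x) := by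
  rw [boxVec_eq_withDensity hσ hβ m,
    mixture_withDensity q _ (measurable_boxVecRatio σ β m).ennreal_ofReal]
  congr 1; ext x
  have := mul_nonneg hq₀ (boxVecRatio_pos hσ hβ m x).le
  rw [← ENNReal.ofReal_mul hq₀, ← ENNReal.ofReal_add (by linarith) this]

theorem holderBound_mixture (hq₀ : 0 ≤ q) (hq₁ : q ≤ 1) (hσ : 0 < σ) (hB : 0 < B) (hc : 0 < c)
    (hβ : ∀ j, B ≤ β j) (hm : ∑ j, m j ^ 2 ≤ c ^ 2)
    (hr : ((n + 1 : ℕ) : ℝ).HolderConjugate r) :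
    HolderBound r (renyiMoment q σ B c (n + 1) ^ (1 / ((n + 1 : ℕ) : ℝ)))
      (mixture q (boxVec σ β 0) (boxVec σ β m)) (boxVec σ β 0) := by
  have hβ0 : ∀ j, 0 < β j := fun j => hB.trans_le (hβ j)
  have hg : Measurable fun x => ENNReal.ofReal (1 - q + q * boxVecRatio σ β m x) := by
    have := measurable_boxVecRatio σ β m
    fun_prop
  rw [mixture_boxVec hq₀ hq₁ hσ hβ0]
  refine (holderBound_withDensity hr _ hg).mono (ENNReal.rpow_le_rpow ?_ (by positivity))
  refine le_trans (le_of_eq ?_) (renyiMomentVec_le (q := q) hσ hB hc hβ hm (n + 1))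
  refine lintegral_congr fun x => ?_
  have := mul_nonneg hq₀ (boxVecRatio_pos hσ hβ0 m x).le
  rw [ENNReal.rpow_natCast, ← ENNReal.ofReal_mul hq₀, ← ENNReal.ofReal_add (by linarith) this]

/-- The density with respect to the mixture is the reciprocal of `u = 1 - q + q R`. Its moment of
order `n + 1` against the mixture is the integral of `u^(-n)` against the unshifted law, which the
reflection argument controls. -/
theorem holderBound_mixture_symm (hq₀ : 0 ≤ q) (hq₁ : q ≤ 1) (hσ : 0 < σ) (hB : 0 < B)
    (hc : 0 < c) (hβ : ∀ j, B ≤ β j) (hm : ∑ j, m j ^ 2 ≤ c ^ 2)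
    (hr : ((n + 1 : ℕ) : ℝ).HolderConjugate r) :
    HolderBound r (renyiMoment q σ B c (n + 1) ^ (1 / ((n + 1 : ℕ) : ℝ)))
      (boxVec σ β 0) (mixture q (boxVec σ β 0) (boxVec σ β m)) := by
  have hβ0 : ∀ j, 0 < β j := fun j => hB.trans_le (hβ j)
  have hR := measurable_boxVecRatio σ β m
  have hg : Measurable fun x => ENNReal.ofReal (1 - q + q * boxVecRatio σ β m x) := by fun_prop
  have hg' : Measurable fun x => ENNReal.ofReal (1 - q + q * boxVecRatio σ β m x)⁻¹ := by fun_prop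
  have hpos : ∀ x, 0 < 1 - q + q * boxVecRatio σ β m x := by
    intro x
    have := boxVecRatio_pos hσ hβ0 m x
    rcases hq₀.eq_or_lt with h | h
    · rw [← h]; norm_num
    · have := mul_pos h this; linarith
  have e : (mixture q (boxVec σ β 0) (boxVec σ β m)).withDensity
      (fun x => ENNReal.ofReal (1 - q + q * boxVecRatio σ β m x)⁻¹) = boxVec σ β 0 := by
    rw [mixture_boxVec hq₀ hq₁ hσ hβ0, ← withDensity_mul _ hg hg']
    have : ((fun x => ENNReal.ofReal (1 - q + q * boxVecRatio σ β m x)) *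
        fun x => ENNReal.ofReal (1 - q + q * boxVecRatio σ β m x)⁻¹) = 1 := by
      ext x
      rw [Pi.mul_apply, ← ENNReal.ofReal_mul (hpos x).le, mul_inv_cancel₀ (hpos x).ne',
        ENNReal.ofReal_one, Pi.one_apply]
    rw [this, withDensity_one]
  have key := holderBound_withDensity hr (mixture q (boxVec σ β 0) (boxVec σ β m)) hg'
  rw [e] at key
  refine key.mono (ENNReal.rpow_le_rpow ?_ (by positivity))
  rw [mixture_boxVec hq₀ hq₁ hσ hβ0,
    lintegral_withDensity_eq_lintegral_mul _ hg (hg'.pow_const _)]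
  refine le_trans (le_of_eq ?_) ((lintegral_inv_pow_le_renyiMomentVec hq₀ hq₁ hσ hβ0 m n).trans
    (renyiMomentVec_le (q := q) hσ hB hc hβ hm (n + 1)))
  refine lintegral_congr fun x => ?_
  have h := hpos x
  rw [Pi.mul_apply, ENNReal.rpow_natCast, ← ENNReal.ofReal_pow (by positivity),
    ← ENNReal.ofReal_mul h.le]
  congr 1
  rw [inv_pow, pow_succ]
  field_simp

end Subsampling

/-! ### One iteration -/

section Iteration

variable {Z : Type*} {d : ℕ}

theorem lintegral_multiset_sum_dirac {ι E : Type*} [MeasurableSpace E] (M : Multiset ι)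
    (a : ι → ℝ≥0∞) (x : ι → E) {h : E → ℝ≥0∞} (hh : Measurable h) :
    ∫⁻ G, h G ∂(M.map fun S => a S • Measure.dirac (x S)).sum =
      (M.map fun S => a S * h (x S)).sum := by
  induction M using Multiset.induction_on with
  | empty => simp
  | cons S M ih =>
    rw [Multiset.map_cons, Multiset.sum_cons, Multiset.map_cons, Multiset.sum_cons,
      lintegral_add_measure, lintegral_smul_measure, lintegral_dirac' _ hh, ih, smul_eq_mul]

theorem lintegral_batchGrad (f : EuclideanSpace ℝ (Fin d) → Z → ℝ) (c q : ℝ) (D : Multiset Z)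
    (w : EuclideanSpace ℝ (Fin d)) {h : EuclideanSpace ℝ (Fin d) → ℝ≥0∞} (hh : Measurable h) :
    ∫⁻ G, h G ∂batchGrad f c q D w = (D.powerset.map fun S =>
      (ENNReal.ofReal q ^ S.card * ENNReal.ofReal (1 - q) ^ (D.card - S.card)) *
        h (clippedGrad f c S w)).sum :=
  lintegral_multiset_sum_dirac _ _ _ hh

/-- Conditioning on the sample `S` drawn from `D`, the new point is absent with probability `1 - q`
and otherwise adds its clipped gradient. -/
theorem lintegral_batchGrad_cons (f : EuclideanSpace ℝ (Fin d) → Z → ℝ) (c q : ℝ) (z : Z)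
    (D : Multiset Z) (w : EuclideanSpace ℝ (Fin d)) {h : EuclideanSpace ℝ (Fin d) → ℝ≥0∞}
    (hh : Measurable h) : ∫⁻ G, h G ∂batchGrad f c q (z ::ₘ D) w =
      ∫⁻ G, (ENNReal.ofReal (1 - q) * h G + ENNReal.ofReal q *
        h (G + clip c (gradient (fun u => f u z) w))) ∂batchGrad f c q D w := by
  rw [lintegral_batchGrad f c q _ w hh, lintegral_batchGrad f c q D w (by fun_prop),
    Multiset.powerset_cons, Multiset.map_add, Multiset.sum_add, Multiset.map_map,
    ← Multiset.sum_map_add]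
  congr 1
  refine Multiset.map_congr rfl fun S hS => ?_
  have hcard := Multiset.card_le_card (Multiset.mem_powerset.1 hS)
  have e : clippedGrad f c (z ::ₘ S) w =
      clippedGrad f c S w + clip c (gradient (fun u => f u z) w) := by
    simp [clippedGrad, add_comm]
  simp only [Function.comp_apply]
  rw [e, Multiset.card_cons, Multiset.card_cons, Nat.succ_sub hcard, Nat.add_sub_add_right,
    pow_succ, pow_succ]
  ring

theorem lintegral_mixKernel (f : EuclideanSpace ℝ (Fin d) → Z → ℝ) {c q : ℝ} (η τ σ : ℝ)
    (hq₀ : 0 ≤ q) (hq₁ : q ≤ 1) (D : Multiset Z)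
    (x : EuclideanSpace ℝ (Fin d) × EuclideanSpace ℝ (Fin d))
    {F : EuclideanSpace ℝ (Fin d) × EuclideanSpace ℝ (Fin d) → ℝ≥0∞} (hF : Measurable F) :
    ∫⁻ y, F y ∂mixKernel f c q η τ σ D x =
      ∫⁻ G, ∫⁻ p, F (mixUpdate η τ ((x, G), p))
        ∂((Measure.pi fun _ : Fin d => uniformLaw 0 1).prod (gaussianVec 0 σ))
        ∂batchGrad f c q D x.1 := by
  have := isMarkovKernel_batchGrad f c q hq₀ hq₁ D
  have := isProbabilityMeasure_uniformLaw (zero_lt_one (α := ℝ))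
  have hFm : Measurable fun y => F (mixUpdate η τ y) := hF.comp (measurable_mixUpdate η τ)
  unfold mixKernel
  rw [Kernel.lintegral_comp _ _ _ hF]
  simp_rw [Kernel.lintegral_deterministic' (measurable_mixUpdate η τ) hF]
  rw [Kernel.lintegral_prod _ _ _ hFm]
  simp_rw [Kernel.const_apply]
  rw [Kernel.lintegral_id_prod (by exact hFm.lintegral_prod_right'), Kernel.comap_apply]

/-- The second sign is evaluated after the first coordinate has moved, but that move is away from
`b` and preserves the sign. The convention at `0` covers equal coordinates. -/
theorem separate_sub_le {τ : ℝ} (hτ : 0 < τ) (a b : ℝ) :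
    τ ≤ |(separate τ a b).1 - (separate τ a b).2| := by
  unfold separate
  split_ifs with h
  · simp only
    rcases lt_or_ge (a - b) 0 with h1 | h1
    · have e1 : sgn (a - b) = -1 := if_pos h1
      have e2 : sgn (a + -1 * (τ / 2) - b) = -1 := if_pos (by linarith)
      rw [e1, e2, abs_of_neg (by linarith)]
      linarith
    · have e1 : sgn (a - b) = 1 := if_neg (not_lt.2 h1)
      have e2 : sgn (a + 1 * (τ / 2) - b) = 1 := if_neg (by linarith)
      rw [e1, e2, abs_of_nonneg (by linarith)]
      linarith
  · exact not_lt.1 h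

theorem map_affine_uniformLaw {s t a b : ℝ} (hs : s ≠ 0) (hab : a < b)
    (h : (fun x => s * x + t) ⁻¹' Icc a b = Icc 0 1) :
    (uniformLaw 0 1).map (fun x => s * x + t) = uniformLaw a b := by
  have hm : Measurable fun x : ℝ => s * x + t := by fun_prop
  have e1 : (volume : Measure ℝ).map (fun x => s * x + t) = ENNReal.ofReal |s⁻¹| • volume := by
    have : (fun x : ℝ => s * x + t) = (fun x => x + t) ∘ (fun x => s * x) := rfl
    rw [this, ← Measure.map_map (by fun_prop) (by fun_prop), Real.map_volume_mul_left hs,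
      Measure.map_smul, map_add_right_eq_self]
  have e2 : ((volume : Measure ℝ).restrict (Icc 0 1)).map (fun x => s * x + t) =
      ENNReal.ofReal |s⁻¹| • volume.restrict (Icc a b) := by
    rw [← h, ← Measure.restrict_map hm measurableSet_Icc, e1, Measure.restrict_smul]
  have p1 := isProbabilityMeasure_uniformLaw (zero_lt_one (α := ℝ))
  have p2 := isProbabilityMeasure_uniformLaw hab
  have e3 : (uniformLaw 0 1).map (fun x => s * x + t) =
      (ENNReal.ofReal |s⁻¹| * volume (Icc a b)) • uniformLaw a b := by
    have v0 : volume (Icc a b) ≠ 0 := by simp [hab]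
    have v1 : volume (Icc a b) ≠ ⊤ := by simp
    unfold uniformLaw ProbabilityTheory.cond
    rw [Measure.map_smul, e2, smul_smul, smul_smul, mul_assoc, ENNReal.mul_inv_cancel v0 v1]
    simp
  -- The image is a multiple of the target law; comparing total masses shows that the factor is one.
  have p3 : IsProbabilityMeasure ((uniformLaw 0 1).map (fun x => s * x + t)) :=
    Measure.isProbabilityMeasure_map hm.aemeasurable
  have hu := p3.measure_univ
  rw [e3, Measure.smul_apply, measure_univ, smul_eq_mul, mul_one] at hu
  rw [e3, hu, one_smul]

theorem map_uniform_prod_gaussian {σ η l : ℝ} (hη : 0 < η) (hl : l ≠ 0) :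
    ((uniformLaw 0 1).prod (gaussianLaw 0 σ)).map (fun p => p.2 - (p.1 - 1 / 2) * l / η) =
      boxLaw σ (|l| / (2 * η)) 0 := by
  have hl' : 0 < |l| := abs_pos.2 hl
  have hB : 0 < |l| / (2 * η) := by positivity
  have p1 := isProbabilityMeasure_uniformLaw (zero_lt_one (α := ℝ))
  have p2 := isProbabilityMeasure_uniformLaw (show -(|l| / (2 * η)) < |l| / (2 * η) by linarith)
  have hs : -(l / η) ≠ 0 := neg_ne_zero.2 (div_ne_zero hl hη.ne')
  have hu := map_affine_uniformLaw (s := -(l / η)) (t := l / (2 * η)) hs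
    (show -(|l| / (2 * η)) < |l| / (2 * η) by linarith) ?_
  · rw [boxLaw, Measure.conv_comm, ← hu]
    unfold Measure.conv
    have hid : gaussianLaw 0 σ = (gaussianLaw 0 σ).map id := Measure.map_id.symm
    conv_rhs => rw [hid]
    rw [Measure.map_prod_map _ _ (by fun_prop) measurable_id, Measure.map_map (by fun_prop)
      (by fun_prop)]
    congr 1; ext p
    change p.2 - (p.1 - 1 / 2) * l / η = -(l / η) * p.1 + l / (2 * η) + p.2
    field_simp
    ring
  · ext x
    have e : -(l / η) * x + l / (2 * η) = (l * (1 - 2 * x)) / (2 * η) := by field_simp; ring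
    simp only [mem_preimage, mem_Icc]
    rw [← abs_le, e, abs_div, abs_of_pos (by positivity : 0 < 2 * η),
      div_le_div_iff_of_pos_right (by positivity), abs_mul, mul_le_iff_le_one_right hl', abs_le]
    constructor <;> rintro ⟨h1, h2⟩ <;> constructor <;> linarith

/-- The half-width of the uniform noise equivalent to the mixing of the separated states. -/
def mixWidth (η τ : ℝ) (x : EuclideanSpace ℝ (Fin d) × EuclideanSpace ℝ (Fin d)) (j : Fin d) : ℝ :=
  |(separate τ (x.1 j) (x.2 j)).1 - (separate τ (x.1 j) (x.2 j)).2| / (2 * η)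

/-- The result of an iteration as a function of the total of gradient, noise and mixing. -/
def mixOutput (η τ : ℝ) (x : EuclideanSpace ℝ (Fin d) × EuclideanSpace ℝ (Fin d))
    (y : Fin d → ℝ) : EuclideanSpace ℝ (Fin d) × EuclideanSpace ℝ (Fin d) :=
  (WithLp.toLp 2 fun j => ((separate τ (x.1 j) (x.2 j)).1 + (separate τ (x.1 j) (x.2 j)).2) / 2 -
    η * y j, WithLp.toLp 2 fun j => (separate τ (x.1 j) (x.2 j)).1)

theorem measurable_mixOutput (η τ : ℝ)
    (x : EuclideanSpace ℝ (Fin d) × EuclideanSpace ℝ (Fin d)) : Measurable (mixOutput η τ x) := by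
  unfold mixOutput
  exact ((WithLp.measurable_toLp 2 _).comp (by fun_prop)).prodMk measurable_const

theorem le_mixWidth {η τ : ℝ} (hη : 0 < η) (hτ : 0 < τ)
    (x : EuclideanSpace ℝ (Fin d) × EuclideanSpace ℝ (Fin d)) (j : Fin d) :
    τ / (2 * η) ≤ mixWidth η τ x j :=
  div_le_div_of_nonneg_right (separate_sub_le hτ _ _) (by positivity)

/-- Writing the convex combination as midpoint plus `(a j - 1/2)` times the gap lets the mixing be
absorbed, after division by `-η`, into the noise. The overwritten previous state is a function of
`x` alone and reveals nothing about the minibatch drawn in this iteration. -/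
theorem lintegral_mixUpdate {η τ : ℝ} (σ : ℝ) (hη : 0 < η) (hτ : 0 < τ)
    (x : EuclideanSpace ℝ (Fin d) × EuclideanSpace ℝ (Fin d)) (G : EuclideanSpace ℝ (Fin d))
    {F : EuclideanSpace ℝ (Fin d) × EuclideanSpace ℝ (Fin d) → ℝ≥0∞} (hF : Measurable F) :
    ∫⁻ p, F (mixUpdate η τ ((x, G), p))
        ∂((Measure.pi fun _ : Fin d => uniformLaw 0 1).prod (gaussianVec 0 σ)) =
      ∫⁻ y, F (mixOutput η τ x (G.ofLp + y)) ∂boxVec σ (mixWidth η τ x) 0 := by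
  have p1 := isProbabilityMeasure_uniformLaw (zero_lt_one (α := ℝ))
  set l : Fin d → ℝ := fun j =>
    (separate τ (x.1 j) (x.2 j)).1 - (separate τ (x.1 j) (x.2 j)).2 with hl
  have hl0 : ∀ j, l j ≠ 0 := fun j => abs_pos.1 (hτ.trans_le (separate_sub_le hτ _ _))
  have hm := WithLp.measurable_toLp 2 (Fin d → ℝ)
  have hFo : Measurable fun y => F (mixOutput η τ x (G.ofLp + y)) :=
    hF.comp ((measurable_mixOutput η τ x).comp (by fun_prop))
  have e1 : (Measure.pi fun _ : Fin d => uniformLaw 0 1).prod (gaussianVec 0 σ) =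
      (Measure.pi fun _ : Fin d => (uniformLaw 0 1).prod (gaussianLaw 0 σ)).map
        fun ω => ((fun j => (ω j).1), WithLp.toLp 2 fun j => (ω j).2) := by
    have h := (measurePreserving_arrowProdEquivProdArrow ℝ ℝ (Fin d)
      (fun _ => uniformLaw 0 1) (fun _ => gaussianLaw 0 σ)).map_eq
    have hid : (Measure.pi fun _ : Fin d => uniformLaw 0 1) =
      (Measure.pi fun _ : Fin d => uniformLaw 0 1).map id := Measure.map_id.symm
    unfold gaussianVec
    conv_lhs => rw [hid]
    rw [Measure.map_prod_map _ _ measurable_id hm]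
    simp only [PiLp.zero_apply]
    rw [← h, Measure.map_map (measurable_id.prodMap hm) (MeasurableEquiv.measurable _)]
    rfl
  have e2 : boxVec σ (mixWidth η τ x) 0 =
      (Measure.pi fun _ : Fin d => (uniformLaw 0 1).prod (gaussianLaw 0 σ)).map
        fun ω j => (ω j).2 - ((ω j).1 - 1 / 2) * l j / η := by
    have := fun j => map_uniform_prod_gaussian (σ := σ) hη (hl0 j)
    rw [boxVec]
    refine Eq.trans ?_ (Measure.pi_map_pi
      (μ := fun _ : Fin d => (uniformLaw 0 1).prod (gaussianLaw 0 σ))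
      (f := fun j (p : ℝ × ℝ) => p.2 - (p.1 - 1 / 2) * l j / η)
      fun j => by fun_prop).symm
    simp_rw [this]
    rfl
  have hu : Measurable fun p : (Fin d → ℝ) × EuclideanSpace ℝ (Fin d) =>
      F (mixUpdate η τ ((x, G), p)) :=
    hF.comp ((measurable_mixUpdate η τ).comp (by fun_prop))
  have hm2 : Measurable fun ω : Fin d → ℝ × ℝ =>
      ((fun j => (ω j).1), WithLp.toLp 2 fun j => (ω j).2) :=
    Measurable.prodMk (by fun_prop) (hm.comp (by fun_prop))
  rw [e1, e2, lintegral_map hu hm2, lintegral_map hFo (by fun_prop)]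
  refine lintegral_congr fun ω => ?_
  congr 1
  unfold mixUpdate mixOutput
  refine Prod.ext ?_ rfl
  simp only
  congr 1; ext j
  simp only [hl, Pi.add_apply]
  field_simp
  ring

theorem norm_clip_le {c : ℝ} (hc : 0 < c) (g : EuclideanSpace ℝ (Fin d)) : ‖clip c g‖ ≤ c := by
  unfold clip
  rw [norm_smul, Real.norm_eq_abs, abs_of_nonneg (by positivity)]
  rcases (norm_nonneg g).eq_or_lt with h | h
  · rw [← h, mul_zero]; exact hc.le
  · calc min 1 (c / ‖g‖) * ‖g‖ ≤ c / ‖g‖ * ‖g‖ := by gcongr; exact min_le_right _ _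
      _ = c := div_mul_cancel₀ _ h.ne'

theorem sum_sq_clip_le {c : ℝ} (hc : 0 < c) (g : EuclideanSpace ℝ (Fin d)) :
    ∑ j, (clip c g).ofLp j ^ 2 ≤ c ^ 2 := by
  rw [← EuclideanSpace.real_norm_sq_eq]
  exact pow_le_pow_left₀ (norm_nonneg _) (norm_clip_le hc g) 2

end Iteration

/-! ### The whole algorithm -/

section Composition

variable {Z : Type*} {d n : ℕ} {c q η τ σ r : ℝ}

theorem sFinite_mixture {Ω : Type*} [MeasurableSpace Ω] (q : ℝ) (P Q : Measure Ω) [SFinite P]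
    [SFinite Q] : SFinite (mixture q P Q) := by
  unfold mixture
  infer_instance

theorem measurable_lintegral_mixOutput (η τ : ℝ)
    (x : EuclideanSpace ℝ (Fin d) × EuclideanSpace ℝ (Fin d)) (μ : Measure (Fin d → ℝ)) [SFinite μ]
    {F : EuclideanSpace ℝ (Fin d) × EuclideanSpace ℝ (Fin d) → ℝ≥0∞} (hF : Measurable F) :
    Measurable fun G : EuclideanSpace ℝ (Fin d) =>
      ∫⁻ y, F (mixOutput η τ x (G.ofLp + y)) ∂μ := by
  have : Measurable fun p : EuclideanSpace ℝ (Fin d) × (Fin d → ℝ) =>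
      F (mixOutput η τ x (p.1.ofLp + p.2)) :=
    hF.comp ((measurable_mixOutput η τ x).comp (by fun_prop))
  exact this.lintegral_prod_right'

theorem lintegral_mixKernel_eq (f : EuclideanSpace ℝ (Fin d) → Z → ℝ) (hq₀ : 0 ≤ q) (hq₁ : q ≤ 1)
    (hη : 0 < η) (hτ : 0 < τ) (D : Multiset Z)
    (x : EuclideanSpace ℝ (Fin d) × EuclideanSpace ℝ (Fin d))
    {F : EuclideanSpace ℝ (Fin d) × EuclideanSpace ℝ (Fin d) → ℝ≥0∞} (hF : Measurable F) :
    ∫⁻ y, F y ∂mixKernel f c q η τ σ D x =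
      ∫⁻ G, ∫⁻ y, F (mixOutput η τ x (G.ofLp + y)) ∂boxVec σ (mixWidth η τ x) 0
        ∂batchGrad f c q D x.1 := by
  rw [lintegral_mixKernel f η τ σ hq₀ hq₁ D x hF]
  exact lintegral_congr fun G => lintegral_mixUpdate σ hη hτ x G hF

/-- The gradient sum `G` of the other points keeps the same law with and without `z`, so all effect
of `z` is moved into the noise, as a mixture of shifted and unshifted laws. -/
theorem lintegral_mixKernel_cons (f : EuclideanSpace ℝ (Fin d) → Z → ℝ) (hq₀ : 0 ≤ q)
    (hq₁ : q ≤ 1) (hη : 0 < η) (hτ : 0 < τ) (hσ : 0 < σ) (z : Z) (D : Multiset Z)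
    (x : EuclideanSpace ℝ (Fin d) × EuclideanSpace ℝ (Fin d))
    {F : EuclideanSpace ℝ (Fin d) × EuclideanSpace ℝ (Fin d) → ℝ≥0∞} (hF : Measurable F) :
    ∫⁻ y, F y ∂mixKernel f c q η τ σ (z ::ₘ D) x =
      ∫⁻ G, ∫⁻ y, F (mixOutput η τ x (G.ofLp + y))
        ∂mixture q (boxVec σ (mixWidth η τ x) 0)
          (boxVec σ (mixWidth η τ x) (clip c (gradient (fun u => f u z) x.1)).ofLp)
        ∂batchGrad f c q D x.1 := by
  have hβ : ∀ j, 0 < mixWidth η τ x j := fun j =>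
    (show 0 < τ / (2 * η) by positivity).trans_le (le_mixWidth hη hτ x j)
  have := isProbabilityMeasure_boxVec (σ := σ) hβ 0
  rw [lintegral_mixKernel_eq f hq₀ hq₁ hη hτ _ x hF,
    lintegral_batchGrad_cons f c q z D x.1 (measurable_lintegral_mixOutput η τ x _ hF)]
  refine lintegral_congr fun G => ?_
  have hFG : Measurable fun y => F (mixOutput η τ x (G.ofLp + y)) :=
    hF.comp ((measurable_mixOutput η τ x).comp (by fun_prop))
  rw [lintegral_mixture, ← map_add_boxVec hσ hβ (clip c (gradient (fun u => f u z) x.1)).ofLp,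
    lintegral_map hFG (by fun_prop)]
  congr 2
  refine lintegral_congr fun y => ?_
  rw [WithLp.ofLp_add, add_assoc, add_comm y]

theorem HolderBound.lintegral_mixOutput {K : ℝ≥0∞} {μ ν : Measure (Fin d → ℝ)} [SFinite ν]
    (h : HolderBound r K μ ν) (hr : ((n + 1 : ℕ) : ℝ).HolderConjugate r)
    (x : EuclideanSpace ℝ (Fin d) × EuclideanSpace ℝ (Fin d))
    (π : Measure (EuclideanSpace ℝ (Fin d))) [IsProbabilityMeasure π]
    {F : EuclideanSpace ℝ (Fin d) × EuclideanSpace ℝ (Fin d) → ℝ≥0∞} (hF : Measurable F) :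
    ∫⁻ G, ∫⁻ y, F (mixOutput η τ x (G.ofLp + y)) ∂μ ∂π ≤
      K * (∫⁻ G, ∫⁻ y, F (mixOutput η τ x (G.ofLp + y)) ^ r ∂ν ∂π) ^ (1 / r) :=
  lintegral_le_of_forall_le_rpow hr
    (measurable_lintegral_mixOutput η τ x ν (hF.pow_const r))
    fun _ => h _ (hF.comp ((measurable_mixOutput η τ x).comp (by fun_prop)))

theorem holderBound_mixKernel_cons (f : EuclideanSpace ℝ (Fin d) → Z → ℝ) (hc : 0 < c)
    (hq₀ : 0 ≤ q) (hq₁ : q ≤ 1) (hη : 0 < η) (hτ : 0 < τ) (hσ : 0 < σ)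
    (hr : ((n + 1 : ℕ) : ℝ).HolderConjugate r) (z : Z) (D : Multiset Z)
    (x : EuclideanSpace ℝ (Fin d) × EuclideanSpace ℝ (Fin d)) :
    HolderBound r (renyiMoment q σ (τ / (2 * η)) c (n + 1) ^ (1 / ((n + 1 : ℕ) : ℝ)))
      (mixKernel f c q η τ σ (z ::ₘ D) x) (mixKernel f c q η τ σ D x) := by
  have hB : 0 < τ / (2 * η) := by positivity
  have := isMarkovKernel_batchGrad f c q hq₀ hq₁ D
  have := isProbabilityMeasure_boxVec (σ := σ)
    (fun j => hB.trans_le (le_mixWidth hη hτ x j)) 0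
  intro F hF
  rw [lintegral_mixKernel_cons f hq₀ hq₁ hη hτ hσ z D x hF,
    lintegral_mixKernel_eq f hq₀ hq₁ hη hτ D x (hF.pow_const r)]
  exact (holderBound_mixture hq₀ hq₁ hσ hB hc (le_mixWidth hη hτ x)
    (sum_sq_clip_le hc _) hr).lintegral_mixOutput hr x _ hF

theorem holderBound_mixKernel_cons_symm (f : EuclideanSpace ℝ (Fin d) → Z → ℝ) (hc : 0 < c)
    (hq₀ : 0 ≤ q) (hq₁ : q ≤ 1) (hη : 0 < η) (hτ : 0 < τ) (hσ : 0 < σ)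
    (hr : ((n + 1 : ℕ) : ℝ).HolderConjugate r) (z : Z) (D : Multiset Z)
    (x : EuclideanSpace ℝ (Fin d) × EuclideanSpace ℝ (Fin d)) :
    HolderBound r (renyiMoment q σ (τ / (2 * η)) c (n + 1) ^ (1 / ((n + 1 : ℕ) : ℝ)))
      (mixKernel f c q η τ σ D x) (mixKernel f c q η τ σ (z ::ₘ D) x) := by
  have hB : 0 < τ / (2 * η) := by positivity
  have hβ : ∀ j, 0 < mixWidth η τ x j := fun j => hB.trans_le (le_mixWidth hη hτ x j)
  have := isMarkovKernel_batchGrad f c q hq₀ hq₁ D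
  have := fun m => isProbabilityMeasure_boxVec (σ := σ) hβ m
  have := fun m => sFinite_mixture q (boxVec σ (mixWidth η τ x) 0) (boxVec σ (mixWidth η τ x) m)
  intro F hF
  rw [lintegral_mixKernel_cons f hq₀ hq₁ hη hτ hσ z D x (hF.pow_const r),
    lintegral_mixKernel_eq f hq₀ hq₁ hη hτ D x hF]
  exact (holderBound_mixture_symm hq₀ hq₁ hσ hB hc (le_mixWidth hη hτ x)
    (sum_sq_clip_le hc _) hr).lintegral_mixOutput hr x _ hF

theorem holderBound_dirac {Ω : Type*} [MeasurableSpace Ω] (hr : 0 < r) (x : Ω) :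
    HolderBound r 1 (Measure.dirac x) (Measure.dirac x) := by
  intro f hf
  rw [lintegral_dirac' _ hf, lintegral_dirac' _ (hf.pow_const r), ← ENNReal.rpow_mul,
    mul_one_div_cancel hr.ne', ENNReal.rpow_one, one_mul]

theorem HolderBound.map {Ω Ω' : Type*} [MeasurableSpace Ω] [MeasurableSpace Ω'] {K : ℝ≥0∞}
    {P Q : Measure Ω} (h : HolderBound r K P Q) {g : Ω → Ω'} (hg : Measurable g) :
    HolderBound r K (P.map g) (Q.map g) := by
  intro f hf
  rw [lintegral_map hf hg, lintegral_map (hf.pow_const r) hg]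
  exact h _ (hf.comp hg)

theorem holderBound_modelMix (f : EuclideanSpace ℝ (Fin d) → Z → ℝ) (hr : 0 < r) {K : ℝ≥0∞}
    {D D' : Multiset Z}
    (h : ∀ x, HolderBound r K (mixKernel f c q η τ σ D x) (mixKernel f c q η τ σ D' x))
    (w₀ wPrev : EuclideanSpace ℝ (Fin d)) (T : ℕ) :
    HolderBound r (K ^ T) (modelMix f c q η τ σ w₀ wPrev T D)
      (modelMix f c q η τ σ w₀ wPrev T D') := by
  -- The induction runs over the pair of states, which is Markov; projecting to the output costs
  -- nothing.
  refine HolderBound.map ?_ measurable_fst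
  induction T with
  | zero => rw [pow_zero]; exact holderBound_dirac hr _
  | succ T ih => rw [pow_succ]; exact ih.bind hr h

theorem Neighbors.holderBound_modelMix (f : EuclideanSpace ℝ (Fin d) → Z → ℝ) (hc : 0 < c)
    (hq₀ : 0 ≤ q) (hq₁ : q ≤ 1) (hη : 0 < η) (hτ : 0 < τ) (hσ : 0 < σ)
    (hr : ((n + 1 : ℕ) : ℝ).HolderConjugate r) {D D' : Multiset Z} (hD : Neighbors D D')
    (w₀ wPrev : EuclideanSpace ℝ (Fin d)) (T : ℕ) :
    HolderBound r
      ((renyiMoment q σ (τ / (2 * η)) c (n + 1) ^ (1 / ((n + 1 : ℕ) : ℝ))) ^ T)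
      (modelMix f c q η τ σ w₀ wPrev T D) (modelMix f c q η τ σ w₀ wPrev T D') := by
  obtain ⟨z, rfl | rfl⟩ := hD
  · exact _root_.holderBound_modelMix f hr.symm.pos
      (holderBound_mixKernel_cons f hc hq₀ hq₁ hη hτ hσ hr z D') w₀ wPrev T
  · exact _root_.holderBound_modelMix f hr.symm.pos
      (holderBound_mixKernel_cons_symm f hc hq₀ hq₁ hη hτ hσ hr z D) w₀ wPrev T

end Composition

/-! ### From Rényi divergence to approximate differential privacy -/

/-- Split at `y = δ^((n+1)/n)`. Below, the power is at most `δ`; above, `y^(-1/(n+1)) ≤ δ^(-1/n)`,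
and the coefficient of `y` on the right is `δ^(-1/n)`. -/
theorem ENNReal.rpow_le_mul_add {n δ : ℝ} (hn : 0 < n) (hδ : 0 < δ) (y : ℝ≥0∞) :
    y ^ (n / (n + 1)) ≤ ENNReal.ofReal (Real.exp (Real.log (1 / δ) / n)) * y +
      ENNReal.ofReal δ := by
  rcases le_total y (ENNReal.ofReal δ ^ ((n + 1) / n)) with h | h
  · refine le_add_left ((ENNReal.rpow_le_rpow h (by positivity)).trans (le_of_eq ?_))
    rw [← ENNReal.rpow_mul, div_mul_div_cancel₀ hn.ne', div_self (by positivity),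
      ENNReal.rpow_one]
  · refine le_add_right ?_
    have hδ' : ENNReal.ofReal δ ≠ 0 := by simpa using hδ
    have hpos : 0 < y := lt_of_lt_of_le (ENNReal.rpow_pos (pos_iff_ne_zero.2 hδ') (by simp)) h
    rcases eq_or_ne y ⊤ with rfl | hy
    · rw [ENNReal.mul_top (by simpa using Real.exp_pos _)]; exact le_top
    have e1 : y ^ (n / (n + 1)) = y ^ (-(1 / (n + 1))) * y := by
      nth_rw 3 [← ENNReal.rpow_one y]
      rw [← ENNReal.rpow_add _ _ hpos.ne' hy]
      congr 1; field_simp; ring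
    have e2 : ENNReal.ofReal (Real.exp (Real.log (1 / δ) / n)) =
        (ENNReal.ofReal δ ^ ((n + 1) / n)) ^ (-(1 / (n + 1))) := by
      rw [← ENNReal.rpow_mul, ENNReal.ofReal_rpow_of_pos hδ, Real.rpow_def_of_pos hδ, one_div,
        Real.log_inv]
      congr 2; field_simp
    rw [e1, e2, ENNReal.rpow_neg, ENNReal.rpow_neg]
    exact mul_le_mul_left (ENNReal.inv_le_inv.2 (ENNReal.rpow_le_rpow h (by positivity))) y

/-- Tested on an indicator, the bound reads `P S ≤ (e^L Q S)^(n/(n+1))`, because `1 / r = n / (n +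
1)`. -/
theorem HolderBound.measure_le {Ω : Type*} [MeasurableSpace Ω] {P Q : Measure Ω} {n r L δ : ℝ}
    (hn : 0 < n) (hr : (n + 1).HolderConjugate r) (hδ : 0 < δ)
    (h : HolderBound r (ENNReal.ofReal (Real.exp (L * (n / (n + 1))))) P Q) {S : Set Ω}
    (hS : MeasurableSet S) :
    P S ≤ ENNReal.ofReal (Real.exp (L + Real.log (1 / δ) / n)) * Q S + ENNReal.ofReal δ := by
  have hr' : 1 / r = n / (n + 1) := by
    rw [one_div, ← hr.one_sub_inv]; field_simp; ring
  have h1 := h (S.indicator 1) (measurable_one.indicator hS)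
  have e : (fun x => (S.indicator (1 : Ω → ℝ≥0∞) x) ^ r) = S.indicator 1 := by
    ext x
    by_cases hx : x ∈ S <;> simp [hx, hr.symm.pos]
  rw [e, lintegral_indicator_one hS, lintegral_indicator_one hS, hr', Real.exp_mul,
    ← ENNReal.ofReal_rpow_of_pos (Real.exp_pos _),
    ← ENNReal.mul_rpow_of_nonneg _ _ (by positivity)] at h1
  refine (h1.trans (ENNReal.rpow_le_mul_add hn hδ _)).trans (le_of_eq ?_)
  rw [← mul_assoc, ← ENNReal.ofReal_mul (Real.exp_pos _).le, ← Real.exp_add, add_comm L]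

/-- The defining inequality is closed in `ε`. This is needed because the infimum over orders need
not be attained. -/
theorem isDP_of_forall_gt {Z Ω : Type*} [MeasurableSpace Ω] {A : Multiset Z → Measure Ω}
    [∀ D, IsFiniteMeasure (A D)] {ε δ : ℝ} (h : ∀ ε', ε < ε' → IsDP A ε' δ) : IsDP A ε δ := by
  intro D D' hD S hS
  have ht : Filter.Tendsto
      (fun ε' => ENNReal.ofReal (Real.exp ε') * A D' S + ENNReal.ofReal δ) (nhdsWithin ε (Ioi ε))
      (nhds (ENNReal.ofReal (Real.exp ε) * A D' S + ENNReal.ofReal δ)) := by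
    refine Filter.Tendsto.mono_left ?_ nhdsWithin_le_nhds
    refine (ENNReal.Tendsto.mul_const ?_ (Or.inr (measure_ne_top _ _))).add_const _
    exact ENNReal.tendsto_ofReal (Real.continuous_exp.tendsto ε)
  exact ge_of_tendsto ht (eventually_mem_nhdsWithin.mono fun ε' hε' => h ε' hε' D D' hD S hS)

theorem HolderBound.one_le {Ω : Type*} [MeasurableSpace Ω] {P Q : Measure Ω}
    [IsProbabilityMeasure P] [IsProbabilityMeasure Q] {r : ℝ} {K : ℝ≥0∞}
    (h : HolderBound r K P Q) : 1 ≤ K := by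
  simpa using h (fun _ => 1) measurable_const

theorem exists_exponent {C : ℝ≥0∞} {n T : ℕ} {t ε : ℝ} (hn : 0 < n)
    (h1 : 1 ≤ (C ^ (1 / ((n + 1 : ℕ) : ℝ))) ^ T)
    (h : (T : EReal) * (((n : ℝ)⁻¹ : ℝ) * ENNReal.log C) + (t : EReal) < (ε : EReal)) :
    ∃ L : ℝ, L + t < ε ∧ (C ^ (1 / ((n + 1 : ℕ) : ℝ))) ^ T =
      ENNReal.ofReal (Real.exp (L * (n / (n + 1)))) := by
  have hn' : (0 : ℝ) < n := Nat.cast_pos.2 hn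
  -- For `T = 0` the moment may be infinite a priori, but its product with `0` is `0` in `EReal`.
  -- For `T > 0` the two hypotheses force `C` to be positive and finite.
  rcases T.eq_zero_or_pos with rfl | hT
  · refine ⟨0, ?_, by simp⟩
    simpa using h
  have hT' : (0 : ℝ) < T := Nat.cast_pos.2 hT
  have hC0 : C ≠ 0 := by
    rintro rfl
    rw [ENNReal.zero_rpow_of_pos (by positivity), zero_pow hT.ne'] at h1
    simp at h1
  have hC1 : C ≠ ⊤ := by
    rintro rfl
    rw [ENNReal.log_top, EReal.coe_mul_top_of_pos (by positivity)] at h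
    have : (T : EReal) * ⊤ = ⊤ := EReal.coe_mul_top_of_pos hT'
    rw [this, EReal.top_add_coe] at h
    exact not_top_lt h
  obtain ⟨C, rfl⟩ : ∃ a : ℝ, C = ENNReal.ofReal a := ⟨_, (ENNReal.ofReal_toReal hC1).symm⟩
  have hC : 0 < C := by simpa using hC0
  refine ⟨T * ((n : ℝ)⁻¹ * Real.log C), ?_, ?_⟩
  · rw [ENNReal.log_ofReal_of_pos hC] at h
    exact_mod_cast h
  · rw [ENNReal.ofReal_rpow_of_pos hC, ← ENNReal.ofReal_pow (by positivity),
      Real.rpow_def_of_pos hC, ← Real.exp_nat_mul]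
    congr 2
    push_cast
    field_simp

theorem Neighbors.modelMix_le {Z : Type*} {d : ℕ} (f : EuclideanSpace ℝ (Fin d) → Z → ℝ)
    {c q η τ σ : ℝ} (hc : 0 < c) (hq₀ : 0 ≤ q) (hq₁ : q ≤ 1) (hη : 0 < η) (hτ : 0 < τ)
    (hσ : 0 < σ) (w₀ wPrev : EuclideanSpace ℝ (Fin d)) (T : ℕ) {n : ℕ} (hn : 0 < n) {δ ε : ℝ}
    (hδ : 0 < δ)
    (h : (T : EReal) * (((n : ℝ)⁻¹ : ℝ) * ENNReal.log (renyiMoment q σ (τ / (2 * η)) c (n + 1))) +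
      ((Real.log (1 / δ) / n : ℝ) : EReal) < (ε : EReal)) :
    IsDP (modelMix f c q η τ σ w₀ wPrev T) ε δ := by
  intro D D' hD S hS
  have hn' : (0 : ℝ) < n := Nat.cast_pos.2 hn
  have hr : ((n + 1 : ℕ) : ℝ).HolderConjugate (Real.conjExponent ((n + 1 : ℕ) : ℝ)) :=
    Real.HolderConjugate.conjExponent (by push_cast; linarith)
  have hH := hD.holderBound_modelMix f hc hq₀ hq₁ hη hτ hσ hr w₀ wPrev T
  have := fun D => isProbabilityMeasure_modelMix f c q η τ σ hq₀ hq₁ w₀ wPrev T D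
  obtain ⟨L, hL, hK⟩ := exists_exponent hn hH.one_le h
  rw [hK] at hH
  refine (hH.measure_le hn' (by exact_mod_cast hr) hδ hS).trans ?_
  gcongr

theorem exists_nat_of_one_lt {α : ℤ} (hα : 1 < α) :
    ∃ n : ℕ, 0 < n ∧ (α : ℝ) = ((n + 1 : ℕ) : ℝ) := by
  obtain ⟨n, rfl⟩ : ∃ n : ℕ, α = n + 1 := ⟨(α - 1).toNat, by omega⟩
  exact ⟨n, by omega, by push_cast; rfl⟩

end

/-! ### The privacy guarantee and the one-hot worst case -/

theorem mainTheorem4 {Z : Type*} {d : ℕ} (f : EuclideanSpace ℝ (Fin d) → Z → ℝ)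
    (c q η τ σ : ℝ) (hc : 0 < c) (hq₀ : 0 ≤ q) (hq₁ : q ≤ 1) (hη : 0 < η) (hτ : 0 < τ)
    (hσ : 0 < σ) (w₀ wPrev : EuclideanSpace ℝ (Fin d)) (T : ℕ) :
    (∀ ε δ : ℝ, 0 < δ →
      (⨅ (α : ℤ) (_ : 1 < α),
        (T : EReal) * renyiDiv (α : ℝ)
            (mixture q (mixedLaw η τ σ 0) (mixedLaw η τ σ c)) (mixedLaw η τ σ 0)
          + ((Real.log (1 / δ) / ((α : ℝ) - 1) : ℝ) : EReal)) ≤ (ε : EReal) →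
      IsDP (modelMix f c q η τ σ w₀ wPrev T) ε δ) ∧
    (∀ α : ℤ, 1 < α →
      (∀ v : EuclideanSpace ℝ (Fin d), ‖v‖ ≤ c →
        renyiDiv (α : ℝ) (mixture q (mixedVec η τ σ 0) (mixedVec η τ σ v)) (mixedVec η τ σ 0) ≤
          renyiDiv (α : ℝ)
            (mixture q (mixedLaw η τ σ 0) (mixedLaw η τ σ c)) (mixedLaw η τ σ 0)) ∧
      (∀ j : Fin d,
        renyiDiv (α : ℝ)
            (mixture q (mixedVec η τ σ 0) (mixedVec η τ σ (EuclideanSpace.single j c)))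
            (mixedVec η τ σ 0) =
          renyiDiv (α : ℝ)
            (mixture q (mixedLaw η τ σ 0) (mixedLaw η τ σ c)) (mixedLaw η τ σ 0))) := by
  have hB : 0 < τ / (2 * η) := by positivity
  have : ∀ D, IsProbabilityMeasure (modelMix f c q η τ σ w₀ wPrev T D) :=
    isProbabilityMeasure_modelMix f c q η τ σ hq₀ hq₁ w₀ wPrev T
  simp_rw [mixedLaw_eq_boxLaw]
  refine ⟨fun ε δ hδ h => isDP_of_forall_gt fun ε' hε' => ?_, fun α hα => ?_⟩
  -- Slightly above `ε` a single order `α = n + 1` already suffices.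
  · obtain ⟨α, h⟩ := iInf_lt_iff.1 (h.trans_lt (EReal.coe_lt_coe_iff.2 hε'))
    obtain ⟨hα, h⟩ := iInf_lt_iff.1 h
    obtain ⟨n, hn, hαn⟩ := exists_nat_of_one_lt hα
    rw [hαn, renyiDiv_boxLaw hσ hB c (n + 1)] at h
    refine Neighbors.modelMix_le f hc hq₀ hq₁ hη hτ hσ w₀ wPrev T hn hδ ?_
    simpa using h
  · obtain ⟨n, -, hαn⟩ := exists_nat_of_one_lt hα
    rw [hαn]
    refine ⟨fun v hv => ?_, fun j => ?_⟩
    · rw [renyiDiv_boxLaw hσ hB c (n + 1), renyiDiv_mixedVec hη hτ hσ v (n + 1)]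
      refine EReal_coe_mul_log_mono (by simp) (renyiMomentVec_le hσ hB hc (fun _ => le_rfl) ?_ _)
      rw [← EuclideanSpace.real_norm_sq_eq]
      exact pow_le_pow_left₀ (norm_nonneg _) hv 2
    · rw [renyiDiv_boxLaw hσ hB c (n + 1), renyiDiv_mixedVec hη hτ hσ _ (n + 1),
        PiLp.ofLp_single, renyiMomentVec_single hσ hB j]
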